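/- \textbf{Conventions.} Let $R$ be a commutative ring with unit. An \emph{$R$-supermodule} is an $R$-module with a decomposition $M=M_{\bar 0}\oplus M_{\bar 1}$; $|x|$ is the parity of a homogeneous element, formulas with signs are stated for homogeneous elements and extended linearly, and $\Pi$ is the parity change functor. An \emph{associative superdialgebra} $D$ over $R$ is an $R$-supermodule with two even bilinear associative products $\dashv,\vdash$ such that $a\dashv(b\dashv c)=a\dashv(b\vdash c)$, $(a\vdash b)\dashv c=a\vdash(b\dashv c)$ and $(a\dashv b)\vdash c=(a\vdash b)\vdash c$; it is \emph{unital} if it has a chosen bar-unit $1$, i.e. $a\dashv 1=a=1\vdash a$ for all $a$. Put $[a,b]=a\dashv b-(-1)^{|a||b|}\,b\vdash a$. \textbf{Matrices.} Let $\mathfrak{gl}(m,n,D)$ be the supermodule of $(m+n)\times(m+n)$ matrices over $D$, where the matrix $E_{ij}(a)$ with entry $a$ in position $(i,j)$ has parity $|i|+|j|+|a|$ (the first $m$ indices even, the last $n$ odd), with $(x\dashv y)_{ij}=\sum_k x_{ik}\dashv y_{kj}$, $(x\vdash y)_{ij}=\sum_k x_{ik}\vdash y_{kj}$ and $[x,y]=x\dashv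 y-(-1)^{|x||y|}\,y\vdash x$. It is a Leibniz superalgebra, that is, its bracket is even and $[x,[y,z]]=[[x,y],z]-(-1)^{|y||z|}[[x,z],y]$. Let $\mathfrak{sl}(m,n,D)=[\mathfrak{gl}(m,n,D),\mathfrak{gl}(m,n,D)]$. \textbf{Homology.} For a Leibniz superalgebra $L$ let $\mathrm{HL}_2(L)=\operatorname{Ker}\delta_2/\operatorname{Im}\delta_3$, where $\delta_2(x\otimes y)=[x,y]$ and $\delta_3(x\otimes y\otimes z)=-[x,y]\otimes z+x\otimes[y,z]+(-1)^{|y||z|}[x,z]\otimes y$. Let $\mathrm{HHS}_1(D)=\operatorname{Ker}d_1/(\operatorname{Im}d_2+I)$, where $d_1(a\otimes b)=[a,b]$, $$d_2(a\otimes b\otimes c)=(a\dashv b)\otimes c-a\otimes(b\dashv c)+(-1)^{|c|(|a|+|b|)}(c\vdash a)\otimes b,$$ and $I\subseteq D\otimes_R D$ is spanned by the elements $a\otimes(b\dashv c)-a\otimes(b\vdash c)$. For an integer $k\ge 0$ let $D_k=D/I_k$, where $I_k$ is the two-sided ideal (for both products) generated by the elements $ka$ and $a\dashv b-(-1)^{|a||b|}b\vdash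 a$. \textbf{Theorem.} Let $D$ be a unital associative superdialgebra over $R$ that has an $R$-basis containing its bar-unit. Then there are isomorphisms of $R$-supermodules $$\mathrm{HL}_2(\mathfrak{sl}(m,n,D))\cong\begin{cases}\mathrm{HHS}_1(D)&\text{if } m+n\ge 5\text{ or }(m,n)=(2,1),\\ \mathrm{HHS}_1(D)\oplus D_3^6&\text{if }(m,n)=(3,0),\\ \mathrm{HHS}_1(D)\oplus D_2^6&\text{if }(m,n)=(4,0),\\ \mathrm{HHS}_1(D)\oplus\Pi(D_2)^6&\text{if }(m,n)=(3,1),\\ \mathrm{HHS}_1(D)\oplus D_2^4\oplus D_0^2&\text{if }(m,n)=(2,2).\end{cases}$$ -/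

import Mathlib

open scoped TensorProduct

namespace SuperLeibniz

/-- The Koszul sign `(-1)^(i j)` of two parities. -/
def sgn (i j : ZMod 2) : ℤ := (-1) ^ (i.val * j.val)

/-! ### Supermodules -/

/-- The structure of an `R`-supermodule on `M`: a decomposition `M = M₀ ⊕ M₁`. -/
structure SuperGrading (R M : Type*) [CommRing R] [AddCommGroup M] [Module R M] where
  deg : ZMod 2 → Submodule R M
  isInternal : DirectSum.IsInternal deg

namespace SuperGrading

variable {R M N P : Type*} [CommRing R] [AddCommGroup M] [Module R M]
  [AddCommGroup N] [Module R N] [AddCommGroup P] [Module R P]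

theorem two_cases : ∀ i : ZMod 2, i = 0 ∨ i = 1 := by
  decide

theorem univ_two : (Set.univ : Set (ZMod 2)) = {0, 1} := by
  ext i
  simpa using two_cases i

theorem internal_of_proj (deg : ZMod 2 → Submodule R M) (p : ZMod 2 → M →ₗ[R] M)
    (hmem : ∀ i x, p i x ∈ deg i) (hsum : ∀ x, p 0 x + p 1 x = x)
    (hne : ∀ i j x, i ≠ j → x ∈ deg i → p j x = 0) : DirectSum.IsInternal deg := by
  rw [DirectSum.isInternal_submodule_iff_isCompl deg (i := 0) (j := 1) (by decide) univ_two]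
  constructor
  · rw [Submodule.disjoint_def]
    intro x h0 h1
    rw [← hsum x, hne 1 0 x (by decide) h1, hne 0 1 x (by decide) h0, add_zero]
  · rw [codisjoint_iff, eq_top_iff]
    intro x _
    rw [← hsum x]
    exact Submodule.add_mem_sup (hmem 0 x) (hmem 1 x)

/-- The projection onto the homogeneous component of parity `i`. -/
noncomputable def proj (A : SuperGrading R M) (i : ZMod 2) : M →ₗ[R] M :=
  (A.deg i).subtype ∘ₗ DirectSum.component R (ZMod 2) (fun j => A.deg j) i ∘ₗ
    (LinearEquiv.ofBijective (DirectSum.coeLinearMap A.deg) A.isInternal).symm.toLinearMap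

theorem proj_mem (A : SuperGrading R M) (i : ZMod 2) (x : M) : A.proj i x ∈ A.deg i := by
  simp [proj]

theorem proj_of_mem (A : SuperGrading R M) {i : ZMod 2} {x : M} (h : x ∈ A.deg i)
    (j : ZMod 2) : A.proj j x = if i = j then x else 0 := by
  have : (LinearEquiv.ofBijective (DirectSum.coeLinearMap A.deg) A.isInternal).symm x
      = DirectSum.lof R (ZMod 2) (fun j => A.deg j) i ⟨x, h⟩ := by
    rw [LinearEquiv.symm_apply_eq]
    exact (DirectSum.coeLinearMap_lof A.deg i ⟨x, h⟩).symm
  simp only [proj, LinearMap.comp_apply, LinearEquiv.coe_coe, this]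
  split_ifs with hij
  · subst hij
    simp [DirectSum.component.lof_self]
  · simp [DirectSum.component.of, hij]

theorem proj_add (A : SuperGrading R M) (x : M) : A.proj 0 x + A.proj 1 x = x := by
  have hx : x ∈ A.deg 0 ⊔ A.deg 1 := by
    have := (DirectSum.isInternal_submodule_iff_isCompl A.deg (i := 0) (j := 1)
      (by decide) univ_two).1 A.isInternal
    rw [this.sup_eq_top]
    trivial
  obtain ⟨y, hy, z, hz, rfl⟩ := Submodule.mem_sup.1 hx
  simp [A.proj_of_mem hy, A.proj_of_mem hz]

/-- Every element is a sum of homogeneous elements. -/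
theorem induction (A : SuperGrading R M) {q : M → Prop} (hadd : ∀ x y, q x → q y → q (x + y))
    (hom : ∀ i, ∀ x ∈ A.deg i, q x) (x : M) : q x := by
  rw [← A.proj_add x]
  exact hadd _ _ (hom 0 _ (A.proj_mem 0 x)) (hom 1 _ (A.proj_mem 1 x))

/-- Even linear maps, i.e. morphisms of supermodules. -/
def IsEven (A : SuperGrading R M) (B : SuperGrading R N) (f : M →ₗ[R] N) : Prop :=
  ∀ i, ∀ x ∈ A.deg i, f x ∈ B.deg i

/-- Two supermodules are isomorphic: there is a linear equivalence that preserves parity. -/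
def Iso (A : SuperGrading R M) (B : SuperGrading R N) : Prop :=
  ∃ e : M ≃ₗ[R] N, ∀ i, (A.deg i).map e.toLinearMap = B.deg i

/-- Graded submodules. -/
def IsHomog (A : SuperGrading R M) (S : Submodule R M) : Prop :=
  ∀ i, ∀ x ∈ S, A.proj i x ∈ S

theorem IsEven.map_proj {A : SuperGrading R M} {B : SuperGrading R N} {f : M →ₗ[R] N}
    (h : IsEven A B f) (i : ZMod 2) (x : M) : f (A.proj i x) = B.proj i (f x) := by
  induction x using A.induction with
  | hadd x y hx hy => simp [hx, hy]
  | hom j x hx =>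
    rw [A.proj_of_mem hx, B.proj_of_mem (h j x hx)]
    split_ifs <;> simp

theorem IsEven.ker {A : SuperGrading R M} {B : SuperGrading R N} {f : M →ₗ[R] N}
    (h : IsEven A B f) : A.IsHomog (LinearMap.ker f) := by
  intro i x hx
  rw [LinearMap.mem_ker] at hx ⊢
  rw [h.map_proj, hx, map_zero]

theorem IsEven.range {A : SuperGrading R M} {B : SuperGrading R N} {f : M →ₗ[R] N}
    (h : IsEven A B f) : B.IsHomog (LinearMap.range f) := by
  rintro i _ ⟨x, rfl⟩
  exact ⟨A.proj i x, h.map_proj i x⟩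

theorem IsHomog.sup {A : SuperGrading R M} {S T : Submodule R M} (hS : A.IsHomog S)
    (hT : A.IsHomog T) : A.IsHomog (S ⊔ T) := by
  intro i x hx
  obtain ⟨y, hy, z, hz, rfl⟩ := Submodule.mem_sup.1 hx
  rw [map_add]
  exact Submodule.add_mem_sup (hS i y hy) (hT i z hz)

theorem IsHomog.span {A : SuperGrading R M} {s : Set M}
    (h : ∀ x ∈ s, ∀ i, A.proj i x ∈ Submodule.span R s) : A.IsHomog (Submodule.span R s) := by
  intro i x hx
  induction hx using Submodule.span_induction with
  | mem x hx => exact h x hx i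
  | zero => simp
  | add x y _ _ hx hy => rw [map_add]; exact add_mem hx hy
  | smul a x _ hx => rw [map_smul]; exact Submodule.smul_mem _ a hx

theorem IsEven.comp {A : SuperGrading R M} {B : SuperGrading R N} {C : SuperGrading R P}
    {g : N →ₗ[R] P} {f : M →ₗ[R] N} (hg : IsEven B C g) (hf : IsEven A B f) :
    IsEven A C (g ∘ₗ f) := fun i x hx => hg i _ (hf i x hx)

theorem IsEven.add {A : SuperGrading R M} {B : SuperGrading R N} {f g : M →ₗ[R] N}
    (hf : IsEven A B f) (hg : IsEven A B g) : IsEven A B (f + g) :=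
  fun i x hx => add_mem (hf i x hx) (hg i x hx)

theorem IsEven.sub {A : SuperGrading R M} {B : SuperGrading R N} {f g : M →ₗ[R] N}
    (hf : IsEven A B f) (hg : IsEven A B g) : IsEven A B (f - g) :=
  fun i x hx => sub_mem (hf i x hx) (hg i x hx)

theorem IsEven.neg {A : SuperGrading R M} {B : SuperGrading R N} {f : M →ₗ[R] N}
    (hf : IsEven A B f) : IsEven A B (-f) :=
  fun i x hx => neg_mem (hf i x hx)

/-- A graded submodule is a supermodule. -/
def restrict (A : SuperGrading R M) (S : Submodule R M) (hS : A.IsHomog S) :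
    SuperGrading R S where
  deg i := (A.deg i).comap S.subtype
  isInternal := by
    refine internal_of_proj _ (fun i => (A.proj i).restrict (hS i)) ?_ ?_ ?_
    · intro i x
      exact A.proj_mem i x
    · intro x
      exact Subtype.ext (A.proj_add x)
    · intro i j x hij hx
      refine Subtype.ext ?_
      have := A.proj_of_mem (Submodule.mem_comap.1 hx) j
      simpa [hij] using this

/-- The quotient of a supermodule by a graded submodule. -/
def quotient (A : SuperGrading R M) (S : Submodule R M) (hS : A.IsHomog S) :
    SuperGrading R (M ⧸ S) where
  deg i := (A.deg i).map S.mkQ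
  isInternal := by
    refine internal_of_proj _ (fun i => S.mapQ S (A.proj i) (hS i)) ?_ ?_ ?_
    · intro i x
      obtain ⟨x, rfl⟩ := S.mkQ_surjective x
      exact ⟨A.proj i x, A.proj_mem i x, rfl⟩
    · intro x
      obtain ⟨x, rfl⟩ := S.mkQ_surjective x
      simp only [Submodule.mkQ_apply, Submodule.mapQ_apply, ← Submodule.Quotient.mk_add, proj_add]
    · rintro i j _ hij ⟨x, hx, rfl⟩
      simp [A.proj_of_mem hx, hij]

/-- For graded submodules `Z` and `B`, the quotient of `Z` by `B ∩ Z`. -/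
def subquotient (A : SuperGrading R M) (Z B : Submodule R M) (hZ : A.IsHomog Z)
    (hB : A.IsHomog B) : SuperGrading R (Z ⧸ B.submoduleOf Z) :=
  (A.restrict Z hZ).quotient (B.submoduleOf Z) (by
    have h : IsEven (A.restrict Z hZ) A Z.subtype := fun i x hx => hx
    intro i x hx
    change Z.subtype _ ∈ B
    rw [h.map_proj]
    exact hB i _ hx)

/-- The direct sum of two supermodules. -/
def prod (A : SuperGrading R M) (B : SuperGrading R N) : SuperGrading R (M × N) where
  deg i := (A.deg i).prod (B.deg i)
  isInternal := by
    refine internal_of_proj _ (fun i => (A.proj i).prodMap (B.proj i)) ?_ ?_ ?_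
    · intro i x
      exact ⟨A.proj_mem i _, B.proj_mem i _⟩
    · intro x
      exact Prod.ext (A.proj_add _) (B.proj_add _)
    · rintro i j ⟨x, y⟩ hij ⟨hx, hy⟩
      simp [A.proj_of_mem hx, B.proj_of_mem hy, hij]

/-- The direct sum of `k` copies of a supermodule. -/
def copies (A : SuperGrading R M) (k : ℕ) : SuperGrading R (Fin k → M) where
  deg i := Submodule.pi Set.univ fun _ => A.deg i
  isInternal := by
    refine internal_of_proj _ (fun i => LinearMap.pi fun s => A.proj i ∘ₗ LinearMap.proj s)
      ?_ ?_ ?_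
    · intro i x s _
      exact A.proj_mem i _
    · intro x
      exact funext fun s => A.proj_add _
    · intro i j x hij hx
      funext s
      simp [A.proj_of_mem (hx s trivial), hij]

/-- The parity change `Π`: the same module with the parities exchanged. -/
def parityChange (A : SuperGrading R M) : SuperGrading R M where
  deg i := A.deg (i + 1)
  isInternal := by
    refine internal_of_proj _ (fun i => A.proj (i + 1)) ?_ ?_ ?_
    · intro i x
      exact A.proj_mem _ x
    · intro x
      rw [add_comm]
      exact A.proj_add x
    · intro i j x hij hx
      simp [A.proj_of_mem hx, hij]

/-- The tensor product of two supermodules, `|x ⊗ y| = |x| + |y|`. -/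
noncomputable def tensor (A : SuperGrading R M) (B : SuperGrading R N) :
    SuperGrading R (M ⊗[R] N) where
  deg k := ⨆ i, Submodule.map₂ (TensorProduct.mk R M N) (A.deg i) (B.deg (k - i))
  isInternal := by
    refine internal_of_proj _
      (fun k => ∑ i, TensorProduct.map (A.proj i) (B.proj (k - i))) ?_ ?_ ?_
    · intro k t
      induction t using TensorProduct.induction_on with
      | zero => simp
      | add x y hx hy => rw [map_add]; exact add_mem hx hy
      | tmul x y =>
        rw [LinearMap.sum_apply]
        refine sum_mem fun i _ => ?_
        exact Submodule.mem_iSup_of_mem i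
          (Submodule.apply_mem_map₂ _ (A.proj_mem i x) (B.proj_mem _ y))
    · intro t
      induction t using TensorProduct.induction_on with
      | zero => simp
      | add x y hx hy =>
        rw [map_add, map_add, add_add_add_comm, hx, hy]
      | tmul x y =>
        conv_rhs => rw [← A.proj_add x, ← B.proj_add y]
        simp [TensorProduct.add_tmul, TensorProduct.tmul_add,
          show (Finset.univ : Finset (ZMod 2)) = {0, 1} from by decide]
        abel
    · intro k l t hkl ht
      refine (Submodule.mem_iSup _).1 ht (LinearMap.ker _) fun i => ?_
      rw [Submodule.map₂_le]
      intro x hx y hy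
      simp only [LinearMap.mem_ker, LinearMap.sum_apply, TensorProduct.mk_apply,
        TensorProduct.map_tmul]
      refine Finset.sum_eq_zero fun j _ => ?_
      rw [A.proj_of_mem hx, B.proj_of_mem hy]
      by_cases hij : i = j
      · subst hij
        simp [hkl]
      · simp [hij]

theorem tmul_mem {A : SuperGrading R M} {B : SuperGrading R N} {i j : ZMod 2} {x : M} {y : N}
    (hx : x ∈ A.deg i) (hy : y ∈ B.deg j) : x ⊗ₜ[R] y ∈ (A.tensor B).deg (i + j) := by
  refine Submodule.mem_iSup_of_mem i (Submodule.apply_mem_map₂ _ hx ?_)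
  simpa using hy

theorem isEven_tensor {A : SuperGrading R M} {B : SuperGrading R N} {C : SuperGrading R P}
    {f : M ⊗[R] N →ₗ[R] P}
    (h : ∀ i j, ∀ x ∈ A.deg i, ∀ y ∈ B.deg j, f (x ⊗ₜ y) ∈ C.deg (i + j)) :
    IsEven (A.tensor B) C f := by
  intro k t ht
  refine (Submodule.mem_iSup _).1 ht ((C.deg k).comap f) fun i => ?_
  rw [Submodule.map₂_le]
  intro x hx y hy
  simpa using h i (k - i) x hx y hy

/-- The signed flip `x ⊗ y ↦ (-1)^(|x| |y|) y ⊗ x`. -/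
noncomputable def flip (A : SuperGrading R M) : M ⊗[R] M →ₗ[R] M ⊗[R] M :=
  ∑ i, ∑ j, sgn i j •
    ((TensorProduct.comm R M M).toLinearMap ∘ₗ TensorProduct.map (A.proj i) (A.proj j))

theorem flip_tmul (A : SuperGrading R M) {i j : ZMod 2} {x y : M} (hx : x ∈ A.deg i)
    (hy : y ∈ A.deg j) : A.flip (x ⊗ₜ y) = sgn i j • (y ⊗ₜ[R] x) := by
  simp only [flip, LinearMap.sum_apply, LinearMap.smul_apply, LinearMap.comp_apply,
    TensorProduct.map_tmul, LinearEquiv.coe_coe, TensorProduct.comm_tmul]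
  rw [Finset.sum_eq_single i, Finset.sum_eq_single j]
  · simp [A.proj_of_mem hx, A.proj_of_mem hy]
  · intro b _ hb
    simp [A.proj_of_mem hy, hb.symm]
  · simp
  · intro b _ hb
    simp [A.proj_of_mem hx, hb.symm]
  · simp

theorem isEven_flip (A : SuperGrading R M) : IsEven (A.tensor A) (A.tensor A) A.flip := by
  refine isEven_tensor fun i j x hx y hy => ?_
  rw [A.flip_tmul hx hy, add_comm]
  exact zsmul_mem (tmul_mem hy hx) _

theorem IsEven.lTensor {A : SuperGrading R M} {B : SuperGrading R N} {C : SuperGrading R P}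
    {f : N →ₗ[R] P} (h : IsEven B C f) :
    IsEven (A.tensor B) (A.tensor C) (LinearMap.lTensor M f) :=
  isEven_tensor fun _ _ _ hx _ hy => tmul_mem hx (h _ _ hy)

theorem IsEven.rTensor {A : SuperGrading R M} {B : SuperGrading R N} {C : SuperGrading R P}
    {f : N →ₗ[R] P} (h : IsEven B C f) :
    IsEven (B.tensor A) (C.tensor A) (LinearMap.rTensor M f) :=
  isEven_tensor fun _ _ _ hx _ hy => tmul_mem (h _ _ hx) hy

theorem isEven_assoc_symm (A : SuperGrading R M) (B : SuperGrading R N) (C : SuperGrading R P) :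
    IsEven (A.tensor (B.tensor C)) ((A.tensor B).tensor C)
      (TensorProduct.assoc R M N P).symm.toLinearMap := by
  refine isEven_tensor fun i k x hx t ht => ?_
  refine (Submodule.mem_iSup _).1 ht ((((A.tensor B).tensor C).deg (i + k)).comap
    ((TensorProduct.assoc R M N P).symm.toLinearMap ∘ₗ TensorProduct.mk R M _ x)) fun j => ?_
  rw [Submodule.map₂_le]
  intro y hy z hz
  have := tmul_mem (tmul_mem hx hy) hz
  rw [show i + j + (k - j) = i + k by ring] at this
  simpa using this

end SuperGrading

open SuperGrading

/-! ### Leibniz superalgebras and their second homology -/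

/-- Leibniz superalgebras over `R` with underlying module `L`. -/
structure LeibnizSuperalgebra (R L : Type*) [CommRing R] [AddCommGroup L] [Module R L]
    extends SuperGrading R L where
  bracket : L →ₗ[R] L →ₗ[R] L
  bracket_mem : ∀ i j, ∀ x ∈ deg i, ∀ y ∈ deg j, bracket x y ∈ deg (i + j)
  leibniz : ∀ j k, ∀ x, ∀ y ∈ deg j, ∀ z ∈ deg k,
    bracket x (bracket y z) = bracket (bracket x y) z - sgn j k • bracket (bracket x z) y

namespace LeibnizSuperalgebra

variable {R L : Type*} [CommRing R] [AddCommGroup L] [Module R L]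

/-- The underlying module of the commutator `[L, L]`, the span of all brackets
(which is an ideal). -/
def commutator (𝔏 : LeibnizSuperalgebra R L) : Submodule R L :=
  Submodule.span R {z | ∃ x y, z = 𝔏.bracket x y}

theorem bracket_mem_commutator (𝔏 : LeibnizSuperalgebra R L) (x y : L) :
    𝔏.bracket x y ∈ 𝔏.commutator := Submodule.subset_span ⟨x, y, rfl⟩

theorem isEven_lift_bracket (𝔏 : LeibnizSuperalgebra R L) :
    IsEven (𝔏.tensor 𝔏.toSuperGrading) 𝔏.toSuperGrading (TensorProduct.lift 𝔏.bracket) :=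
  isEven_tensor fun i j x hx y hy => by simpa using 𝔏.bracket_mem i j x hx y hy

theorem isHomog_commutator (𝔏 : LeibnizSuperalgebra R L) : 𝔏.IsHomog 𝔏.commutator := by
  refine IsHomog.span ?_
  rintro _ ⟨x, y, rfl⟩ i
  have h := 𝔏.isEven_lift_bracket.map_proj i (x ⊗ₜ y)
  rw [TensorProduct.lift.tmul] at h
  rw [← h]
  generalize (𝔏.tensor 𝔏.toSuperGrading).proj i (x ⊗ₜ[R] y) = t
  induction t using TensorProduct.induction_on with
  | zero => simp
  | add x y hx hy => rw [map_add]; exact add_mem hx hy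
  | tmul x y =>
    rw [TensorProduct.lift.tmul]
    exact 𝔏.bracket_mem_commutator x y

/-- The commutator `[L, L]` as a Leibniz superalgebra. -/
def derived (𝔏 : LeibnizSuperalgebra R L) : LeibnizSuperalgebra R 𝔏.commutator where
  toSuperGrading := 𝔏.restrict 𝔏.commutator 𝔏.isHomog_commutator
  bracket := LinearMap.mk₂ R
    (fun x y => ⟨𝔏.bracket x y, 𝔏.bracket_mem_commutator x y⟩)
    (fun x x' y => Subtype.ext (by simp)) (fun a x y => Subtype.ext (by simp))
    (fun x y y' => Subtype.ext (by simp)) (fun a x y => Subtype.ext (by simp))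
  bracket_mem i j x hx y hy := 𝔏.bracket_mem i j x hx y hy
  leibniz j k x y hy z hz := Subtype.ext (𝔏.leibniz j k x y hy z hz)

/-- `δ₂ (x ⊗ y) = [x, y]`. -/
def δ₂ (𝔏 : LeibnizSuperalgebra R L) : L ⊗[R] L →ₗ[R] L := TensorProduct.lift 𝔏.bracket

/-- `δ₃ (x ⊗ y ⊗ z) = -[x, y] ⊗ z + x ⊗ [y, z] + (-1)^(|y| |z|) [x, z] ⊗ y`. -/
noncomputable def δ₃ (𝔏 : LeibnizSuperalgebra R L) : L ⊗[R] (L ⊗[R] L) →ₗ[R] L ⊗[R] L :=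
  -(LinearMap.rTensor L 𝔏.δ₂ ∘ₗ (TensorProduct.assoc R L L L).symm.toLinearMap)
    + LinearMap.lTensor L 𝔏.δ₂
    + LinearMap.rTensor L 𝔏.δ₂ ∘ₗ (TensorProduct.assoc R L L L).symm.toLinearMap ∘ₗ
        LinearMap.lTensor L 𝔏.flip

theorem δ₃_tmul (𝔏 : LeibnizSuperalgebra R L) {j k : ZMod 2} (x : L) {y z : L}
    (hy : y ∈ 𝔏.deg j) (hz : z ∈ 𝔏.deg k) :
    𝔏.δ₃ (x ⊗ₜ (y ⊗ₜ z)) = -(𝔏.bracket x y ⊗ₜ[R] z) + x ⊗ₜ[R] 𝔏.bracket y z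
      + sgn j k • (𝔏.bracket x z ⊗ₜ[R] y) := by
  simp [δ₃, δ₂, 𝔏.flip_tmul hy hz]

theorem δ₂_δ₃ (𝔏 : LeibnizSuperalgebra R L) (t : L ⊗[R] (L ⊗[R] L)) : 𝔏.δ₂ (𝔏.δ₃ t) = 0 := by
  induction t using TensorProduct.induction_on with
  | zero => simp
  | add s t hs ht => rw [map_add, map_add, hs, ht, add_zero]
  | tmul x t =>
    induction t using TensorProduct.induction_on with
    | zero => simp
    | add s t hs ht => rw [TensorProduct.tmul_add, map_add, map_add, hs, ht, add_zero]
    | tmul y z =>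
      induction y using 𝔏.induction with
      | hadd y y' hy hy' =>
        rw [TensorProduct.add_tmul, TensorProduct.tmul_add, map_add, map_add, hy, hy', add_zero]
      | hom j y hy =>
        induction z using 𝔏.induction with
        | hadd z z' hz hz' =>
          rw [TensorProduct.tmul_add, TensorProduct.tmul_add, map_add, map_add, hz, hz', add_zero]
        | hom k z hz =>
          rw [𝔏.δ₃_tmul x hy hz]
          simp only [δ₂, map_add, map_neg, map_zsmul, TensorProduct.lift.tmul,
            𝔏.leibniz j k x y hy z hz]
          abel

theorem isEven_δ₂ (𝔏 : LeibnizSuperalgebra R L) :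
    IsEven (𝔏.tensor 𝔏.toSuperGrading) 𝔏.toSuperGrading 𝔏.δ₂ := 𝔏.isEven_lift_bracket

theorem isEven_δ₃ (𝔏 : LeibnizSuperalgebra R L) :
    IsEven (𝔏.tensor (𝔏.tensor 𝔏.toSuperGrading)) (𝔏.tensor 𝔏.toSuperGrading) 𝔏.δ₃ := by
  have ha := isEven_assoc_symm 𝔏.toSuperGrading 𝔏.toSuperGrading 𝔏.toSuperGrading
  exact ((𝔏.isEven_δ₂.rTensor.comp ha).neg.add 𝔏.isEven_δ₂.lTensor).add
    (𝔏.isEven_δ₂.rTensor.comp (ha.comp 𝔏.isEven_flip.lTensor))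

/-- The second Leibniz homology `HL₂(L) = Ker δ₂ / Im δ₃` with trivial coefficients. -/
abbrev HL₂ (𝔏 : LeibnizSuperalgebra R L) : Type _ :=
  LinearMap.ker 𝔏.δ₂ ⧸ (LinearMap.range 𝔏.δ₃).submoduleOf (LinearMap.ker 𝔏.δ₂)

/-- The supermodule structure of `HL₂(L)`, induced from `L ⊗ L`. -/
noncomputable def gradingHL₂ (𝔏 : LeibnizSuperalgebra R L) : SuperGrading R 𝔏.HL₂ :=
  (𝔏.tensor 𝔏.toSuperGrading).subquotient _ _ 𝔏.isEven_δ₂.ker 𝔏.isEven_δ₃.range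

end LeibnizSuperalgebra

/-! ### Superdialgebras -/

/-- Associative superdialgebras over `R` with underlying module `D`;
`left` is the product `⊣` and `right` is the product `⊢`. -/
structure Superdialgebra (R D : Type*) [CommRing R] [AddCommGroup D] [Module R D]
    extends SuperGrading R D where
  left : D →ₗ[R] D →ₗ[R] D
  right : D →ₗ[R] D →ₗ[R] D
  left_mem : ∀ i j, ∀ a ∈ deg i, ∀ b ∈ deg j, left a b ∈ deg (i + j)
  right_mem : ∀ i j, ∀ a ∈ deg i, ∀ b ∈ deg j, right a b ∈ deg (i + j)
  left_assoc : ∀ a b c, left (left a b) c = left a (left b c)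
  right_assoc : ∀ a b c, right (right a b) c = right a (right b c)
  left_left : ∀ a b c, left a (left b c) = left a (right b c)
  right_left : ∀ a b c, left (right a b) c = right a (left b c)
  right_right : ∀ a b c, right (left a b) c = right (right a b) c

namespace Superdialgebra

variable {R D : Type*} [CommRing R] [AddCommGroup D] [Module R D]

/-- `e` is a bar-unit: `a ⊣ e = a = e ⊢ a`. -/
def IsBarUnit (𝒟 : Superdialgebra R D) (e : D) : Prop :=
  ∀ a, 𝒟.left a e = a ∧ 𝒟.right e a = a

/-- `a ⊗ b ↦ a ⊣ b`. -/
def lmul (𝒟 : Superdialgebra R D) : D ⊗[R] D →ₗ[R] D := TensorProduct.lift 𝒟.left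

/-- `a ⊗ b ↦ a ⊢ b`. -/
def rmul (𝒟 : Superdialgebra R D) : D ⊗[R] D →ₗ[R] D := TensorProduct.lift 𝒟.right

theorem isEven_lmul (𝒟 : Superdialgebra R D) :
    IsEven (𝒟.tensor 𝒟.toSuperGrading) 𝒟.toSuperGrading 𝒟.lmul :=
  isEven_tensor fun i j x hx y hy => by simpa [lmul] using 𝒟.left_mem i j x hx y hy

theorem isEven_rmul (𝒟 : Superdialgebra R D) :
    IsEven (𝒟.tensor 𝒟.toSuperGrading) 𝒟.toSuperGrading 𝒟.rmul :=
  isEven_tensor fun i j x hx y hy => by simpa [rmul] using 𝒟.right_mem i j x hx y hy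

/-- The Hochschild boundary `d₁ (a ⊗ b) = a ⊣ b - (-1)^(|a| |b|) b ⊢ a`. -/
noncomputable def d₁ (𝒟 : Superdialgebra R D) : D ⊗[R] D →ₗ[R] D :=
  𝒟.lmul - 𝒟.rmul ∘ₗ 𝒟.flip

theorem d₁_tmul (𝒟 : Superdialgebra R D) {i j : ZMod 2} {a b : D} (ha : a ∈ 𝒟.deg i)
    (hb : b ∈ 𝒟.deg j) : 𝒟.d₁ (a ⊗ₜ b) = 𝒟.left a b - sgn i j • 𝒟.right b a := by
  simp [d₁, lmul, rmul, 𝒟.flip_tmul ha hb]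

theorem isEven_d₁ (𝒟 : Superdialgebra R D) :
    IsEven (𝒟.tensor 𝒟.toSuperGrading) 𝒟.toSuperGrading 𝒟.d₁ :=
  𝒟.isEven_lmul.sub (𝒟.isEven_rmul.comp 𝒟.isEven_flip)

/-- The Leibniz superalgebra structure on a superdialgebra, with the bracket
`[a, b] = a ⊣ b - (-1)^(|a| |b|) b ⊢ a` on homogeneous elements. -/
noncomputable def toLeibniz (𝒟 : Superdialgebra R D) : LeibnizSuperalgebra R D where
  toSuperGrading := 𝒟.toSuperGrading
  bracket := TensorProduct.curry 𝒟.d₁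
  bracket_mem i j x hx y hy := 𝒟.isEven_d₁ _ _ (tmul_mem hx hy)
  leibniz j k x y hy z hz := by
    induction x using 𝒟.induction with
    | hadd x x' hx hx' =>
      simp only [map_add, LinearMap.add_apply, hx, hx', smul_add]
      abel
    | hom i x hx =>
      have hm : ∀ {i j : ZMod 2} {a b : D}, a ∈ 𝒟.deg i → b ∈ 𝒟.deg j →
          𝒟.left a b - sgn i j • 𝒟.right b a ∈ 𝒟.deg (i + j) := by
        intro i j a b ha hb
        rw [← 𝒟.d₁_tmul ha hb]
        exact 𝒟.isEven_d₁ _ _ (tmul_mem ha hb)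
      simp only [TensorProduct.curry_apply]
      rw [𝒟.d₁_tmul hy hz, 𝒟.d₁_tmul hx hy, 𝒟.d₁_tmul hx hz, 𝒟.d₁_tmul hx (hm hy hz),
        𝒟.d₁_tmul (hm hx hy) hz, 𝒟.d₁_tmul (hm hx hz) hy]
      simp only [map_sub, map_zsmul, LinearMap.sub_apply, LinearMap.smul_apply, 𝒟.right_left,
        𝒟.right_right, 𝒟.right_assoc, ← 𝒟.left_left, 𝒟.left_assoc]
      rcases two_cases i with rfl | rfl <;> rcases two_cases j with rfl | rfl <;>
        rcases two_cases k with rfl | rfl <;>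
        simp [sgn, show (1 + 1 : ZMod 2) = 0 from by decide, ZMod.val_one] <;> abel

/-- The Hochschild boundary
`d₂ (a ⊗ b ⊗ c) = (a ⊣ b) ⊗ c - a ⊗ (b ⊣ c) + (-1)^(|c| (|a| + |b|)) (c ⊢ a) ⊗ b`. -/
noncomputable def d₂ (𝒟 : Superdialgebra R D) : D ⊗[R] (D ⊗[R] D) →ₗ[R] D ⊗[R] D :=
  LinearMap.rTensor D 𝒟.lmul ∘ₗ (TensorProduct.assoc R D D D).symm.toLinearMap
    - LinearMap.lTensor D 𝒟.lmul
    + LinearMap.rTensor D (𝒟.rmul ∘ₗ 𝒟.flip) ∘ₗ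
        (TensorProduct.assoc R D D D).symm.toLinearMap ∘ₗ LinearMap.lTensor D 𝒟.flip

theorem d₂_tmul (𝒟 : Superdialgebra R D) {i j k : ZMod 2} {a b c : D} (ha : a ∈ 𝒟.deg i)
    (hb : b ∈ 𝒟.deg j) (hc : c ∈ 𝒟.deg k) :
    𝒟.d₂ (a ⊗ₜ (b ⊗ₜ c)) = 𝒟.left a b ⊗ₜ[R] c - a ⊗ₜ[R] 𝒟.left b c
      + sgn k (i + j) • (𝒟.right c a ⊗ₜ[R] b) := by
  have h : sgn k (i + j) = sgn j k * sgn i k := by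
    rcases two_cases i with rfl | rfl <;> rcases two_cases j with rfl | rfl <;>
      rcases two_cases k with rfl | rfl <;> rfl
  simp only [d₂, LinearMap.add_apply, LinearMap.sub_apply, LinearMap.comp_apply,
    LinearEquiv.coe_coe, TensorProduct.assoc_symm_tmul, LinearMap.rTensor_tmul,
    LinearMap.lTensor_tmul, lmul, rmul, 𝒟.flip_tmul hb hc, TensorProduct.tmul_smul, map_zsmul,
    𝒟.flip_tmul ha hc, TensorProduct.lift.tmul, h, mul_smul, ← TensorProduct.smul_tmul']

theorem isEven_d₂ (𝒟 : Superdialgebra R D) :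
    IsEven (𝒟.tensor (𝒟.tensor 𝒟.toSuperGrading)) (𝒟.tensor 𝒟.toSuperGrading) 𝒟.d₂ := by
  have ha := isEven_assoc_symm 𝒟.toSuperGrading 𝒟.toSuperGrading 𝒟.toSuperGrading
  exact ((𝒟.isEven_lmul.rTensor.comp ha).sub 𝒟.isEven_lmul.lTensor).add
    ((𝒟.isEven_rmul.comp 𝒟.isEven_flip).rTensor.comp (ha.comp 𝒟.isEven_flip.lTensor))

/-- The submodule `I` of `D ⊗ D` spanned by the elements `a ⊗ (b ⊣ c) - a ⊗ (b ⊢ c)`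
(an ideal of the superdialgebra `D ⊗ D`). -/
def I (𝒟 : Superdialgebra R D) : Submodule R (D ⊗[R] D) :=
  Submodule.span R {t | ∃ a b c, t = a ⊗ₜ[R] 𝒟.left b c - a ⊗ₜ[R] 𝒟.right b c}

theorem I_eq (𝒟 : Superdialgebra R D) :
    𝒟.I = LinearMap.range (LinearMap.lTensor D (𝒟.lmul - 𝒟.rmul)) := by
  apply le_antisymm
  · refine Submodule.span_le.2 ?_
    rintro _ ⟨a, b, c, rfl⟩
    exact ⟨a ⊗ₜ (b ⊗ₜ c), by simp [lmul, rmul]⟩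
  · rintro _ ⟨t, rfl⟩
    induction t using TensorProduct.induction_on with
    | zero => simp
    | add s t hs ht => rw [map_add]; exact add_mem hs ht
    | tmul a t =>
      induction t using TensorProduct.induction_on with
      | zero => simp
      | add s t hs ht => rw [TensorProduct.tmul_add, map_add]; exact add_mem hs ht
      | tmul b c =>
        exact Submodule.subset_span ⟨a, b, c, by simp [lmul, rmul]⟩

theorem isHomog_I (𝒟 : Superdialgebra R D) : (𝒟.tensor 𝒟.toSuperGrading).IsHomog 𝒟.I := by
  rw [I_eq]
  exact (𝒟.isEven_lmul.sub 𝒟.isEven_rmul).lTensor.range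

theorem range_d₂_le (𝒟 : Superdialgebra R D) :
    LinearMap.range 𝒟.d₂ ⊔ 𝒟.I ≤ LinearMap.ker 𝒟.d₁ := by
  have key : ∀ {i j k : ZMod 2} {a b c : D}, a ∈ 𝒟.deg i → b ∈ 𝒟.deg j → c ∈ 𝒟.deg k →
      𝒟.d₁ (𝒟.d₂ (a ⊗ₜ (b ⊗ₜ c))) = 0 ∧
      𝒟.d₁ (LinearMap.lTensor D (𝒟.lmul - 𝒟.rmul) (a ⊗ₜ (b ⊗ₜ c))) = 0 := by
    intro i j k a b c ha hb hc
    constructor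
    · rw [𝒟.d₂_tmul ha hb hc]
      simp only [map_add, map_sub, map_zsmul]
      rw [𝒟.d₁_tmul (𝒟.left_mem _ _ _ ha _ hb) hc, 𝒟.d₁_tmul ha (𝒟.left_mem _ _ _ hb _ hc),
        𝒟.d₁_tmul (𝒟.right_mem _ _ _ hc _ ha) hb]
      simp only [𝒟.right_left, 𝒟.right_right, 𝒟.right_assoc, 𝒟.left_assoc]
      rcases two_cases i with rfl | rfl <;> rcases two_cases j with rfl | rfl <;>
        rcases two_cases k with rfl | rfl <;>
        simp [sgn, show (1 + 1 : ZMod 2) = 0 from by decide, ZMod.val_one] <;> abel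
    · simp only [LinearMap.lTensor_tmul, LinearMap.sub_apply, lmul, rmul, TensorProduct.lift.tmul,
        TensorProduct.tmul_sub, map_sub]
      rw [𝒟.d₁_tmul ha (𝒟.left_mem _ _ _ hb _ hc), 𝒟.d₁_tmul ha (𝒟.right_mem _ _ _ hb _ hc),
        𝒟.left_left, 𝒟.right_right, sub_self]
  have all : ∀ t : D ⊗[R] (D ⊗[R] D), 𝒟.d₁ (𝒟.d₂ t) = 0 ∧
      𝒟.d₁ (LinearMap.lTensor D (𝒟.lmul - 𝒟.rmul) t) = 0 := by
    intro t
    induction t using (𝒟.tensor (𝒟.tensor 𝒟.toSuperGrading)).induction with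
    | hadd s t hs ht => simp only [map_add, hs, ht, add_zero, and_self]
    | hom l t ht =>
      refine (Submodule.mem_iSup _).1 ht (LinearMap.ker (𝒟.d₁ ∘ₗ 𝒟.d₂) ⊓
        LinearMap.ker (𝒟.d₁ ∘ₗ LinearMap.lTensor D (𝒟.lmul - 𝒟.rmul))) fun i => ?_
      rw [Submodule.map₂_le]
      intro a ha s hs
      refine (Submodule.mem_iSup _).1 hs ((LinearMap.ker (𝒟.d₁ ∘ₗ 𝒟.d₂) ⊓
        LinearMap.ker (𝒟.d₁ ∘ₗ LinearMap.lTensor D (𝒟.lmul - 𝒟.rmul))).comap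
          (TensorProduct.mk R D (D ⊗[R] D) a)) fun j => ?_
      rw [Submodule.map₂_le]
      intro b hb c hc
      exact key ha hb hc
  rw [I_eq]
  refine sup_le ?_ ?_
  · rintro _ ⟨t, rfl⟩
    exact (all t).1
  · rintro _ ⟨t, rfl⟩
    exact (all t).2

/-- The first Hochschild homology `Ker d₁ / (Im d₂ + I)` of a superdialgebra. -/
abbrev HHS₁ (𝒟 : Superdialgebra R D) : Type _ :=
  LinearMap.ker 𝒟.d₁ ⧸ (LinearMap.range 𝒟.d₂ ⊔ 𝒟.I).submoduleOf (LinearMap.ker 𝒟.d₁)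

/-- The supermodule structure of `HHS₁(D)`, induced from `D ⊗ D`. -/
noncomputable def gradingHHS₁ (𝒟 : Superdialgebra R D) : SuperGrading R 𝒟.HHS₁ :=
  (𝒟.tensor 𝒟.toSuperGrading).subquotient _ _ 𝒟.isEven_d₁.ker
    (𝒟.isEven_d₂.range.sup 𝒟.isHomog_I)

/-- Two-sided ideals of a superdialgebra, for both products. -/
def IsIdeal (𝒟 : Superdialgebra R D) (J : Submodule R D) : Prop :=
  ∀ x y, x ∈ J ∨ y ∈ J → 𝒟.left x y ∈ J ∧ 𝒟.right x y ∈ J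

/-- The ideal `I_m` of `D` generated by the elements `m a` and
`a ⊣ b - (-1)^(|a| |b|) b ⊢ a`. -/
def idealI (𝒟 : Superdialgebra R D) (m : ℕ) : Submodule R D :=
  sInf {J | 𝒟.IsIdeal J ∧ (∀ a, m • a ∈ J) ∧
    ∀ i j, ∀ a ∈ 𝒟.deg i, ∀ b ∈ 𝒟.deg j, 𝒟.left a b - sgn i j • 𝒟.right b a ∈ J}

theorem isHomog_idealI (𝒟 : Superdialgebra R D) (m : ℕ) : 𝒟.IsHomog (𝒟.idealI m) := by
  intro k x hx
  refine Submodule.mem_sInf.2 fun J hJ => ?_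
  obtain ⟨hI, hm, hc⟩ := hJ
  -- the largest graded submodule contained in `J`
  let J' : Submodule R D := ⨅ l, J.comap (𝒟.proj l)
  have hJ' : ∀ {z : D}, z ∈ J' ↔ ∀ l, 𝒟.proj l z ∈ J := by
    intro z
    simp [J']
  have hhom : ∀ {i : ZMod 2} {z : D}, z ∈ 𝒟.deg i → z ∈ J → z ∈ J' := by
    intro i z hz hzJ
    refine hJ'.2 fun l => ?_
    rw [𝒟.proj_of_mem hz]
    split_ifs
    · exact hzJ
    · exact zero_mem J
  refine hJ'.1 (Submodule.mem_sInf.1 hx J' ⟨?_, ?_, ?_⟩) k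
  · intro y z h
    have : ∀ i j, 𝒟.left (𝒟.proj i y) (𝒟.proj j z) ∈ J' ∧
        𝒟.right (𝒟.proj i y) (𝒟.proj j z) ∈ J' := by
      intro i j
      have h' := hI (𝒟.proj i y) (𝒟.proj j z) (h.imp (fun h => hJ'.1 h i) fun h => hJ'.1 h j)
      exact ⟨hhom (𝒟.left_mem _ _ _ (𝒟.proj_mem i y) _ (𝒟.proj_mem j z)) h'.1,
        hhom (𝒟.right_mem _ _ _ (𝒟.proj_mem i y) _ (𝒟.proj_mem j z)) h'.2⟩
    rw [← 𝒟.proj_add y, ← 𝒟.proj_add z]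
    simp only [map_add, LinearMap.add_apply]
    exact ⟨add_mem (add_mem (this 0 0).1 (this 1 0).1) (add_mem (this 0 1).1 (this 1 1).1),
      add_mem (add_mem (this 0 0).2 (this 1 0).2) (add_mem (this 0 1).2 (this 1 1).2)⟩
  · intro a
    refine hJ'.2 fun l => ?_
    rw [map_nsmul]
    exact hm _
  · intro i j a ha b hb
    refine hhom (i := i + j) ?_ (hc i j a ha b hb)
    rw [← 𝒟.d₁_tmul ha hb]
    exact 𝒟.isEven_d₁ _ _ (tmul_mem ha hb)

/-- The quotient `D_m = D / I_m`. -/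
abbrev Quo (𝒟 : Superdialgebra R D) (m : ℕ) : Type _ := D ⧸ 𝒟.idealI m

/-- The supermodule structure of `D_m`. -/
def gradingQuo (𝒟 : Superdialgebra R D) (m : ℕ) : SuperGrading R (𝒟.Quo m) :=
  𝒟.quotient (𝒟.idealI m) (𝒟.isHomog_idealI m)

/-! ### Matrices -/

/-- The parity of a row or column index: the first `m` indices are even, the last `n` are odd. -/
def idx {m n : ℕ} : Fin m ⊕ Fin n → ZMod 2 := Sum.elim (fun _ => 0) (fun _ => 1)

/-- The supermodule `M(m, n, D)`: the matrix `E_ij(a)` has parity `|i| + |j| + |a|`. -/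
def matrixGrading (A : SuperGrading R D) (m n : ℕ) :
    SuperGrading R (Matrix (Fin m ⊕ Fin n) (Fin m ⊕ Fin n) D) where
  deg k :=
    { carrier := {x | ∀ i j, x i j ∈ A.deg (k - idx i - idx j)}
      zero_mem' := fun _ _ => zero_mem _
      add_mem' := fun hx hy i j => add_mem (hx i j) (hy i j)
      smul_mem' := fun r _ hx i j => Submodule.smul_mem _ r (hx i j) }
  isInternal := by
    refine internal_of_proj _ (fun k =>
      { toFun := fun x => Matrix.of fun i j => A.proj (k - idx i - idx j) (x i j)
        map_add' := fun x y => by ext; simp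
        map_smul' := fun r x => by ext; simp }) ?_ ?_ ?_
    · intro k x i j
      exact A.proj_mem _ _
    · intro x
      ext i j
      have h := A.proj_add (x i j)
      rcases two_cases (idx i + idx j) with h' | h'
      · have h0 : (0 - idx i - idx j : ZMod 2) = 0 := by rw [sub_sub, h']; decide
        have h1 : (1 - idx i - idx j : ZMod 2) = 1 := by rw [sub_sub, h']; decide
        simpa only [LinearMap.coe_mk, AddHom.coe_mk, Matrix.add_apply, Matrix.of_apply, h0, h1] using h
      · have h0 : (0 - idx i - idx j : ZMod 2) = 1 := by rw [sub_sub, h']; decide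
        have h1 : (1 - idx i - idx j : ZMod 2) = 0 := by rw [sub_sub, h']; decide
        rw [add_comm] at h
        simpa only [LinearMap.coe_mk, AddHom.coe_mk, Matrix.add_apply, Matrix.of_apply, h0, h1] using h
    · intro k l x hkl hx
      ext i j
      simp [A.proj_of_mem (hx i j), hkl]

/-- The superdialgebra `M(m, n, D)` of matrices, with the products
`(x ⊣ y)_ij = ∑ k, x_ik ⊣ y_kj` and `(x ⊢ y)_ij = ∑ k, x_ik ⊢ y_kj`. -/
def matrix (𝒟 : Superdialgebra R D) (m n : ℕ) :
    Superdialgebra R (Matrix (Fin m ⊕ Fin n) (Fin m ⊕ Fin n) D) where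
  toSuperGrading := matrixGrading 𝒟.toSuperGrading m n
  left := LinearMap.mk₂ R (fun x y => Matrix.of fun i j => ∑ k, 𝒟.left (x i k) (y k j))
    (fun x x' y => by ext; simp [Finset.sum_add_distrib])
    (fun r x y => by ext; simp [Finset.smul_sum])
    (fun x y y' => by ext; simp [Finset.sum_add_distrib])
    (fun r x y => by ext; simp [Finset.smul_sum])
  right := LinearMap.mk₂ R (fun x y => Matrix.of fun i j => ∑ k, 𝒟.right (x i k) (y k j))
    (fun x x' y => by ext; simp [Finset.sum_add_distrib])
    (fun r x y => by ext; simp [Finset.smul_sum])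
    (fun x y y' => by ext; simp [Finset.sum_add_distrib])
    (fun r x y => by ext; simp [Finset.smul_sum])
  left_mem p q x hx y hy i j := by
    simp only [LinearMap.mk₂_apply, Matrix.of_apply]
    refine Submodule.sum_mem _ fun k _ => ?_
    have h := 𝒟.left_mem _ _ _ (hx i k) _ (hy k j)
    have e : p - idx i - idx k + (q - idx k - idx j) = p + q - idx i - idx j := by
      have : idx k + idx k = 0 := CharTwo.add_self_eq_zero _
      linear_combination -this
    rwa [e] at h
  right_mem p q x hx y hy i j := by
    simp only [LinearMap.mk₂_apply, Matrix.of_apply]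
    refine Submodule.sum_mem _ fun k _ => ?_
    have h := 𝒟.right_mem _ _ _ (hx i k) _ (hy k j)
    have e : p - idx i - idx k + (q - idx k - idx j) = p + q - idx i - idx j := by
      have : idx k + idx k = 0 := CharTwo.add_self_eq_zero _
      linear_combination -this
    rwa [e] at h
  left_assoc x y z := by
    ext i j
    simp only [LinearMap.mk₂_apply, Matrix.of_apply, map_sum, LinearMap.sum_apply, 𝒟.left_assoc]
    exact Finset.sum_comm
  right_assoc x y z := by
    ext i j
    simp only [LinearMap.mk₂_apply, Matrix.of_apply, map_sum, LinearMap.sum_apply, 𝒟.right_assoc]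
    exact Finset.sum_comm
  left_left x y z := by
    ext i j
    simp only [LinearMap.mk₂_apply, Matrix.of_apply, map_sum, 𝒟.left_left]
  right_left x y z := by
    ext i j
    simp only [LinearMap.mk₂_apply, Matrix.of_apply, map_sum, LinearMap.sum_apply, 𝒟.right_left]
    exact Finset.sum_comm
  right_right x y z := by
    ext i j
    simp only [LinearMap.mk₂_apply, Matrix.of_apply, map_sum, LinearMap.sum_apply, 𝒟.right_right]

/-- The general Leibniz superalgebra `gl(m, n, D)`. -/
noncomputable def gl (𝒟 : Superdialgebra R D) (m n : ℕ) :
    LeibnizSuperalgebra R (Matrix (Fin m ⊕ Fin n) (Fin m ⊕ Fin n) D) :=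
  (𝒟.matrix m n).toLeibniz

/-- The special linear Leibniz superalgebra `sl(m, n, D) = [gl(m, n, D), gl(m, n, D)]`. -/
noncomputable def sl (𝒟 : Superdialgebra R D) (m n : ℕ) :
    LeibnizSuperalgebra R (𝒟.gl m n).commutator :=
  (𝒟.gl m n).derived

end Superdialgebra

end SuperLeibniz

/-!
The even component of the bar-unit is again a bar-unit, so assume that `1` is even. Write `cls x y`
for the class of `x ⊗ y` in `(L ⊗ L) / Im δ₃`, where `L = sl(m, n, D)` and `m + n ≥ 3`. The
off-diagonal matrix units `E_ij(a)` satisfy Steinberg relations (`steinbergFamily_root`), and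
everything about `HL₂(L)` is derived from these relations and from explicit cocycles.

The defining relation of `cls`, applied to three root vectors, shows that `cls (E_kl(b)) (E_lj(c))`
depends only on `k`, `j` and `b ⊣ c`, and that the classes of opposite root vectors can all be moved
to a single diagonal place `o`. Consequently `(L ⊗ L) / Im δ₃` is spanned by one class for every
root, one diagonal class for every `k ≠ o`, the image of a map `handle` from `D ⊗ D`, and the
*crossed* classes of pairs `E_ij(a)`, `E_kl(b)` with `j ≠ k` and `i ≠ l`, whose bracket vanishes
formally (`SteinbergFamily.cls_mem`). The boundary `δ₂` is injective on the first two kinds,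
restricts to `d₁` on `handle`, and kills the crossed classes. So a cycle is homologous to the sum of
a Hochschild cycle, placed at `o`, and a crossed chain (`exists_normalForm_of_cycle`). The map
`handle` sends `Im d₂ + I` to boundaries, and the supertrace form `x ⊗ y ↦ ∑ ± x_ik ⊗ y_ki` is a
left inverse of it on homology. This splits off `HHS₁(D)` and leaves the span of the crossed classes
as the complement (`iso_of_crossed`).

A crossed class vanishes if some index is not involved in it (`SteinbergFamily.cls_eq_zero`), which
settles `m + n ≥ 5`. For three indices, the two roots share a row or a column. Acting with a
diagonal element `[E_kl(1), E_lk(1)]` multiplies the class by an integer weight, but it must also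
kill it (`SteinbergFamily.cls_weight`); the weight is a unit if the parities of the three indices
differ, and `-3` if they agree. For four indices, the classes attached to a choice of two rows are
all multiples of a single family `cls (E_kl(c)) (E_ij(1))`, and weights show that they are killed by
`2`, unless the rows have one parity and the columns the other. In each case this family is a
supertrace in `c`, invariant under permutations of factors, and therefore factors through `D_N` with
`N = 3`, `2` or `0` (`idealI_le_ker`).

That nothing more is killed is shown by explicit cocycles `form₃`, `form₂`, `form₀` with values in
`D_N`, built from the products `x_kl ⊣ y_ij` of matrix entries. Their cocycle identities hold
because the given indices are all there are, so that the vanishing of the supertrace of elements of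
`L` in `D_N` eliminates one diagonal entry. They take the value `c` on `E_kl(c) ⊗ E_ij(1)` and
separate the six families (`iso_of_representatives`).
-/

namespace SuperLeibniz

open SuperGrading

/-! ### Signs, supermodules and induction on homogeneous tensors -/

@[simp] theorem sgn_zero_left (j : ZMod 2) : sgn 0 j = 1 := by
  simp [sgn]

@[simp] theorem sgn_zero_right (i : ZMod 2) : sgn i 0 = 1 := by
  simp [sgn]

theorem sgn_mul_self : ∀ i j : ZMod 2, sgn i j * sgn i j = 1 := by
  decide

theorem sgn_smul_sgn_smul {M : Type*} [AddCommGroup M] (i j : ZMod 2) (x : M) :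
    sgn i j • sgn i j • x = x := by
  rw [smul_smul, sgn_mul_self, one_smul]

theorem sgn_smul_mem_iff {R M : Type*} [CommRing R] [AddCommGroup M] [Module R M]
    {S : Submodule R M} {i j : ZMod 2} {x : M} : sgn i j • x ∈ S ↔ x ∈ S := by
  refine ⟨fun h => ?_, fun h => zsmul_mem h _⟩
  rw [← sgn_smul_sgn_smul i j x]
  exact zsmul_mem h _

theorem sgn_smul_eq_zero_iff {M : Type*} [AddCommGroup M] {i j : ZMod 2} {x : M} :
    sgn i j • x = 0 ↔ x = 0 := by
  refine ⟨fun h => ?_, fun h => by rw [h, smul_zero]⟩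
  rw [← sgn_smul_sgn_smul i j x, h, smul_zero]

/-- Over `2`-torsion elements all signs are trivial. -/
theorem sgn_smul_of_two_nsmul {M : Type*} [AddCommGroup M] (i j : ZMod 2) {x : M}
    (h : 2 • x = 0) : sgn i j • x = x := by
  have h' : -x = x := by
    rw [neg_eq_iff_add_eq_zero, ← two_nsmul, h]
  rcases two_cases i with rfl | rfl <;> rcases two_cases j with rfl | rfl <;>
    simp [sgn, ZMod.val_one, h']

namespace SuperGrading

variable {R M N P Q : Type*} [CommRing R] [AddCommGroup M] [Module R M]
  [AddCommGroup N] [Module R N] [AddCommGroup P] [Module R P] [AddCommGroup Q] [Module R Q]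

theorem tensor_induction (A : SuperGrading R M) (B : SuperGrading R N) (f : M ⊗[R] N →ₗ[R] Q)
    (S : Submodule R Q) (h : ∀ i j, ∀ x ∈ A.deg i, ∀ y ∈ B.deg j, f (x ⊗ₜ y) ∈ S)
    (t : M ⊗[R] N) : f t ∈ S := by
  induction t using TensorProduct.induction_on with
  | zero => simp
  | add s t hs ht => rw [map_add]; exact add_mem hs ht
  | tmul x y =>
    induction x using A.induction with
    | hadd x x' hx hx' => rw [TensorProduct.add_tmul, map_add]; exact add_mem hx hx'
    | hom i x hx =>
      induction y using B.induction with
      | hadd y y' hy hy' => rw [TensorProduct.tmul_add, map_add]; exact add_mem hy hy'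
      | hom j y hy => exact h i j x hx y hy

theorem tensor_induction₃ (A : SuperGrading R M) (B : SuperGrading R N) (C : SuperGrading R P)
    (f : M ⊗[R] (N ⊗[R] P) →ₗ[R] Q) (S : Submodule R Q)
    (h : ∀ i j k, ∀ x ∈ A.deg i, ∀ y ∈ B.deg j, ∀ z ∈ C.deg k, f (x ⊗ₜ (y ⊗ₜ z)) ∈ S)
    (t : M ⊗[R] (N ⊗[R] P)) : f t ∈ S := by
  induction t using TensorProduct.induction_on with
  | zero => simp
  | add s t hs ht => rw [map_add]; exact add_mem hs ht
  | tmul x t =>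
    induction x using A.induction with
    | hadd x x' hx hx' => rw [TensorProduct.add_tmul, map_add]; exact add_mem hx hx'
    | hom i x hx =>
      exact B.tensor_induction C (f ∘ₗ TensorProduct.mk R M (N ⊗[R] P) x) S
        (fun j k y hy z hz => h i j k x hx y hy z hz) t

/-- An even bijection is an isomorphism of supermodules. -/
theorem Iso.of_bijective {A : SuperGrading R M} {B : SuperGrading R N} (f : M →ₗ[R] N)
    (hf : IsEven A B f) (hb : Function.Bijective f) : Iso A B := by
  refine ⟨LinearEquiv.ofBijective f hb, fun i => le_antisymm ?_ ?_⟩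
  · rintro _ ⟨x, hx, rfl⟩
    exact hf i x hx
  · intro y hy
    obtain ⟨x, rfl⟩ := hb.2 y
    refine ⟨A.proj i x, A.proj_mem i x, ?_⟩
    change f (A.proj i x) = f x
    rw [hf.map_proj, B.proj_of_mem hy, if_pos rfl]

theorem Iso.trans {A : SuperGrading R M} {B : SuperGrading R N} {C : SuperGrading R P}
    (h : Iso A B) (h' : Iso B C) : Iso A C := by
  obtain ⟨e, he⟩ := h
  obtain ⟨e', he'⟩ := h'
  refine ⟨e.trans e', fun i => ?_⟩
  rw [← he', ← he, LinearEquiv.coe_trans, Submodule.map_comp]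

theorem iso_prod_of_subsingleton [Subsingleton N] (A : SuperGrading R M) (B : SuperGrading R N) :
    Iso (A.prod B) A := by
  refine Iso.of_bijective (LinearMap.fst R M N) (fun i x hx => hx.1) ⟨?_, ?_⟩
  · rintro ⟨x, y⟩ ⟨x', y'⟩ h
    exact Prod.ext h (Subsingleton.elim _ _)
  · intro x
    exact ⟨(x, 0), rfl⟩

/-- The parity automorphism `x ↦ (-1)^|x| x`. -/
noncomputable def parity (A : SuperGrading R M) : M →ₗ[R] M := A.proj 0 - A.proj 1

theorem parity_of_mem (A : SuperGrading R M) {i : ZMod 2} {x : M} (h : x ∈ A.deg i) :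
    A.parity x = sgn i 1 • x := by
  simp only [parity, LinearMap.sub_apply, A.proj_of_mem h]
  rcases two_cases i with rfl | rfl <;> simp [sgn, ZMod.val_one]

end SuperGrading

/-! ### The quotient of `L ⊗ L` by the boundaries -/

namespace LeibnizSuperalgebra

variable {R L : Type*} [CommRing R] [AddCommGroup L] [Module R L]

/-- The class of `x ⊗ y` in `(L ⊗ L) / Im δ₃`. For perfect `L`, this quotient is the universal
central extension of `L`. -/
noncomputable def cls (𝔏 : LeibnizSuperalgebra R L) :
    L →ₗ[R] L →ₗ[R] (L ⊗[R] L) ⧸ LinearMap.range 𝔏.δ₃ :=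
  TensorProduct.curry (LinearMap.range 𝔏.δ₃).mkQ

theorem cls_apply (𝔏 : LeibnizSuperalgebra R L) (x y : L) :
    𝔏.cls x y = (LinearMap.range 𝔏.δ₃).mkQ (x ⊗ₜ y) := rfl

theorem cls_bracket_right (𝔏 : LeibnizSuperalgebra R L) (x : L) {y z : L} {j k : ZMod 2}
    (hy : y ∈ 𝔏.deg j) (hz : z ∈ 𝔏.deg k) :
    𝔏.cls x (𝔏.bracket y z)
      = 𝔏.cls (𝔏.bracket x y) z - sgn j k • 𝔏.cls (𝔏.bracket x z) y := by
  have h : (LinearMap.range 𝔏.δ₃).mkQ (𝔏.δ₃ (x ⊗ₜ (y ⊗ₜ z))) = 0 := by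
    rw [Submodule.mkQ_apply, Submodule.Quotient.mk_eq_zero]
    exact ⟨_, rfl⟩
  rw [𝔏.δ₃_tmul x hy hz, map_add, map_add, map_neg, map_zsmul] at h
  simp only [cls_apply]
  rw [← sub_eq_zero, ← h]
  abel

theorem cls_bracket_left (𝔏 : LeibnizSuperalgebra R L) (x : L) {y z : L} {j k : ZMod 2}
    (hy : y ∈ 𝔏.deg j) (hz : z ∈ 𝔏.deg k) :
    𝔏.cls (𝔏.bracket x y) z
      = 𝔏.cls x (𝔏.bracket y z) + sgn j k • 𝔏.cls (𝔏.bracket x z) y := by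
  rw [𝔏.cls_bracket_right x hy hz]
  abel

end LeibnizSuperalgebra

/-! ### Boundaries of the commutator bracket are Hochschild boundaries -/

namespace Superdialgebra

variable {R D : Type*} [CommRing R] [AddCommGroup D] [Module R D]

theorem tmul_left_sub_right_mem_I (𝒟 : Superdialgebra R D) (a b c : D) :
    a ⊗ₜ[R] (𝒟.left b c - 𝒟.right b c) ∈ 𝒟.I := by
  rw [TensorProduct.tmul_sub]
  exact Submodule.subset_span ⟨a, b, c, rfl⟩

/-- Antisymmetrising the Hochschild boundary gives the Leibniz boundary, up to the
submodule `I`. -/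
theorem δ₃_toLeibniz_mem (𝒟 : Superdialgebra R D) (t : D ⊗[R] (D ⊗[R] D)) :
    𝒟.toLeibniz.δ₃ t ∈ LinearMap.range 𝒟.d₂ ⊔ 𝒟.I := by
  refine tensor_induction₃ 𝒟.toSuperGrading 𝒟.toSuperGrading 𝒟.toSuperGrading _ _ ?_ t
  intro i j k a ha b hb c hc
  have key : 𝒟.toLeibniz.δ₃ (a ⊗ₜ (b ⊗ₜ c)) = -𝒟.d₂ (a ⊗ₜ (b ⊗ₜ c))
      + sgn j k • 𝒟.d₂ (a ⊗ₜ (c ⊗ₜ b))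
      + sgn j k • (a ⊗ₜ[R] (𝒟.left c b - 𝒟.right c b)) := by
    rw [𝒟.toLeibniz.δ₃_tmul (j := j) (k := k) a hb hc, 𝒟.d₂_tmul ha hb hc, 𝒟.d₂_tmul ha hc hb]
    have e (x y : D) : 𝒟.toLeibniz.bracket x y = 𝒟.d₁ (x ⊗ₜ y) := rfl
    rw [e, e, e, 𝒟.d₁_tmul ha hb, 𝒟.d₁_tmul hb hc, 𝒟.d₁_tmul ha hc]
    simp only [TensorProduct.sub_tmul, TensorProduct.tmul_sub]
    rcases two_cases i with rfl | rfl <;> rcases two_cases j with rfl | rfl <;>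
        rcases two_cases k with rfl | rfl <;>
        simp [sgn, show (1 + 1 : ZMod 2) = 0 from by decide, ZMod.val_one,
          TensorProduct.neg_tmul, TensorProduct.tmul_neg] <;> abel
  rw [key]
  exact add_mem (add_mem (neg_mem (Submodule.mem_sup_left (LinearMap.mem_range_self _ _)))
    (zsmul_mem (Submodule.mem_sup_left (LinearMap.mem_range_self _ _)) _))
    (zsmul_mem (Submodule.mem_sup_right (𝒟.tmul_left_sub_right_mem_I a c b)) _)

/-- The even part of a bar-unit is a bar-unit. -/
theorem IsBarUnit.proj_zero {𝒟 : Superdialgebra R D} {e : D} (he : 𝒟.IsBarUnit e) :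
    𝒟.IsBarUnit (𝒟.proj 0 e) := by
  have key : ∀ i, ∀ a ∈ 𝒟.deg i, 𝒟.left a (𝒟.proj 0 e) = a ∧ 𝒟.right (𝒟.proj 0 e) a = a := by
    intro i a ha
    have hl : ∀ j, 𝒟.left a (𝒟.proj j e) ∈ 𝒟.deg (i + j) := fun j =>
      𝒟.left_mem _ _ _ ha _ (𝒟.proj_mem j e)
    have hr : ∀ j, 𝒟.right (𝒟.proj j e) a ∈ 𝒟.deg (j + i) := fun j =>
      𝒟.right_mem _ _ _ (𝒟.proj_mem j e) _ ha
    have h1 : i + 1 ≠ i := by simp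
    have h2 : 1 + i ≠ i := by simp
    constructor
    · have h := congrArg (𝒟.proj i) (he a).1
      rw [← 𝒟.proj_add e, map_add, map_add, 𝒟.proj_of_mem (hl 0), 𝒟.proj_of_mem (hl 1),
        𝒟.proj_of_mem ha, if_pos (add_zero i), if_neg h1, if_pos rfl, add_zero] at h
      exact h
    · have h := congrArg (𝒟.proj i) (he a).2
      rw [← 𝒟.proj_add e, map_add, LinearMap.add_apply, map_add, 𝒟.proj_of_mem (hr 0),
        𝒟.proj_of_mem (hr 1), 𝒟.proj_of_mem ha, if_pos (zero_add i), if_neg h2, if_pos rfl,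
        add_zero] at h
      exact h
  intro a
  induction a using 𝒟.induction with
  | hadd x y hx hy => simp only [map_add, LinearMap.add_apply, hx, hy, and_self]
  | hom i a ha => exact key i a ha

end Superdialgebra

/-! ### Steinberg families -/

/-- A family of linear maps `E i j : D → L` which multiply like the off-diagonal matrix units
`E_ij(a)` of a matrix Leibniz superalgebra whose rows have parities `par`, and which generate `L`
in the sense of `span`. The maps `E i i` play no role. The condition `diag` says that
`[E_ij(a), E_ji(1)]` and `[E_ji(a), E_ij(1)]` agree up to the sign of the supertrace. -/
structure SteinbergFamily {R D L ι : Type*} [CommRing R] [AddCommGroup D] [Module R D]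
    [AddCommGroup L] [Module R L] (𝒟 : Superdialgebra R D) (e : D) (par : ι → ZMod 2)
    (𝔏 : LeibnizSuperalgebra R L) (E : ι → ι → D →ₗ[R] L) : Prop where
  bar : 𝒟.IsBarUnit e
  even : e ∈ 𝒟.deg 0
  mem : ∀ {i j : ι}, i ≠ j → ∀ {α : ZMod 2} {a : D}, a ∈ 𝒟.deg α →
    E i j a ∈ 𝔏.deg (par i + par j + α)
  mul : ∀ {i j k : ι}, i ≠ j → j ≠ k → i ≠ k → ∀ a b : D,
    𝔏.bracket (E i j a) (E j k b) = E i k (𝒟.left a b)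
  mul_swap : ∀ {i j k : ι}, i ≠ j → j ≠ k → i ≠ k → ∀ {α β : ZMod 2} {a b : D},
    a ∈ 𝒟.deg α → b ∈ 𝒟.deg β → 𝔏.bracket (E j k b) (E i j a)
      = -(sgn (par j + par k + β) (par i + par j + α) • E i k (𝒟.right a b))
  zero : ∀ {i j k l : ι}, i ≠ j → k ≠ l → j ≠ k → i ≠ l → ∀ a b : D,
    𝔏.bracket (E i j a) (E k l b) = 0
  diag : ∀ {i j : ι}, i ≠ j → ∀ {α : ZMod 2} {a : D}, a ∈ 𝒟.deg α →
    𝔏.bracket (E i j a) (E j i e)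
      = -(sgn (par i + par j + α) (par i + par j) • 𝔏.bracket (E j i a) (E i j e))
  span : ∀ S : Submodule R L, (∀ i j, i ≠ j → ∀ a, E i j a ∈ S) →
    (∀ i j, i ≠ j → ∀ α β, ∀ a ∈ 𝒟.deg α, ∀ b ∈ 𝒟.deg β,
      𝔏.bracket (E i j a) (E j i b) ∈ S) → S = ⊤

namespace SteinbergFamily

variable {R D L ι : Type*} [CommRing R] [AddCommGroup D] [Module R D]
  [AddCommGroup L] [Module R L] {𝒟 : Superdialgebra R D} {e : D} {par : ι → ZMod 2}
  {𝔏 : LeibnizSuperalgebra R L} {E : ι → ι → D →ₗ[R] L}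

theorem mem_unit (S : SteinbergFamily 𝒟 e par 𝔏 E) {i j : ι} (h : i ≠ j) :
    E i j e ∈ 𝔏.deg (par i + par j) := by
  simpa using S.mem h S.even

/-- The elements `e ⊢ b` and `b` agree, but `e ⊣ b` and `b` need not: they are only
indistinguishable as right factors of `⊣`. -/
theorem left_unit_left (S : SteinbergFamily 𝒟 e par 𝔏 E) (a b : D) :
    𝒟.left a (𝒟.left e b) = 𝒟.left a b := by
  rw [← 𝒟.left_assoc, (S.bar a).1]

/-- Two root vectors whose formal product vanishes have trivial class as soon as there is an
index different from the four involved. -/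
theorem cls_eq_zero (S : SteinbergFamily 𝒟 e par 𝔏 E) {i j k l p : ι} (hij : i ≠ j) (hkl : k ≠ l)
    (hjk : j ≠ k) (hil : i ≠ l) (hi : i ≠ p) (hj : p ≠ j) (hk : p ≠ k) (hl : p ≠ l) (a b : D) :
    𝔏.cls (E i j a) (E k l b) = 0 := by
  induction b using 𝒟.induction with
  | hadd x y hx hy => rw [map_add, map_add, hx, hy, add_zero]
  | hom β b hb =>
    have h := 𝔏.cls_bracket_left (E i p a) (S.mem_unit hj) (S.mem hkl hb)
    rw [S.mul hi hj hij, (S.bar a).1, S.zero hj hkl hjk hl, S.zero hi hkl hk hil] at h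
    simpa using h

/-- The identity of boundaries for `E_kl(b)`, `E_kj(c)` and `E_lk(1)`. -/
theorem cls_mul_eq (S : SteinbergFamily 𝒟 e par 𝔏 E) {k l j : ι} (hkl : k ≠ l) (hlj : l ≠ j)
    (hkj : k ≠ j) (b c : D) :
    𝔏.cls (E k l b) (E l j c) = 𝔏.cls (𝔏.bracket (E k l b) (E l k e)) (E k j c) := by
  induction c using 𝒟.induction with
  | hadd x y hx hy => rw [map_add, map_add, hx, hy, map_add, map_add]
  | hom γ c hc =>
    have h := 𝔏.cls_bracket_right (E k l b) (S.mem hkj hc) (S.mem_unit hkl.symm)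
    have h' := S.mul_swap hkl.symm hkj hlj S.even hc
    rw [(S.bar c).2, add_zero] at h'
    rw [h', S.zero hkl hkj hkl.symm hkj, map_zero, LinearMap.zero_apply, zero_sub, map_neg,
      map_zsmul, neg_inj] at h
    rw [← sgn_smul_sgn_smul (par k + par j + γ) (par l + par k) (𝔏.cls (E k l b) (E l j c)), h,
      sgn_smul_sgn_smul]

theorem cls_swap_eq (S : SteinbergFamily 𝒟 e par 𝔏 E) {k l j : ι} (hkl : k ≠ l) (hlj : l ≠ j)
    (hkj : k ≠ j) (b : D) {γ : ZMod 2} {c : D} (hc : c ∈ 𝒟.deg γ) :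
    𝔏.cls (𝔏.bracket (E l k b) (E k l e)) (E k j c)
      = sgn (par k + par l) (par k + par j + γ)
        • 𝔏.cls (E l j (𝒟.left b c)) (E k l e) := by
  rw [𝔏.cls_bracket_left _ (S.mem_unit hkl) (S.mem hkj hc), S.zero hkl hkj hkl.symm hkj,
    S.mul hkl.symm hkj hlj, map_zero, zero_add]

theorem cls_mul_eq_swap (S : SteinbergFamily 𝒟 e par 𝔏 E) {k l j : ι} (hkl : k ≠ l) (hlj : l ≠ j)
    (hkj : k ≠ j) {β γ : ZMod 2} {b c : D} (hb : b ∈ 𝒟.deg β) (hc : c ∈ 𝒟.deg γ) :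
    𝔏.cls (E k l b) (E l j c) = -(sgn (par k + par l) (par l + par j + β + γ)
        • 𝔏.cls (E l j (𝒟.left b c)) (E k l e)) := by
  rw [S.cls_mul_eq hkl hlj hkj, S.diag hkl hb, map_neg, LinearMap.neg_apply, map_zsmul,
    LinearMap.smul_apply, S.cls_swap_eq hkl hlj hkj b hc, smul_smul]
  congr 2
  generalize par k = k, par l = l, par j = j
  clear hb hc
  revert k l j β γ
  decide

/-- Products of root vectors along `k → l → j` only depend on the product of the entries. -/
theorem cls_mul (S : SteinbergFamily 𝒟 e par 𝔏 E) {k l j : ι} (hkl : k ≠ l) (hlj : l ≠ j)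
    (hkj : k ≠ j) (b c : D) :
    𝔏.cls (E k l b) (E l j c) = 𝔏.cls (E k l (𝒟.left b c)) (E l j e) := by
  induction b using 𝒟.induction with
  | hadd x y hx hy => simp only [map_add, LinearMap.add_apply, hx, hy]
  | hom β b hb =>
    induction c using 𝒟.induction with
    | hadd x y hx hy => simp only [map_add, LinearMap.add_apply, hx, hy]
    | hom γ c hc =>
      rw [S.cls_mul_eq_swap hkl hlj hkj hb hc,
        S.cls_mul_eq_swap hkl hlj hkj (𝒟.left_mem _ _ _ hb _ hc) S.even, (S.bar _).1, add_zero,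
        add_assoc]

theorem cls_swap_unit_mem (S : SteinbergFamily 𝒟 e par 𝔏 E) {k l j : ι} (hkl : k ≠ l)
    (hlj : l ≠ j) (hkj : k ≠ j) {W : Submodule R _}
    (hW : ∀ c, 𝔏.cls (E k l c) (E l j e) ∈ W) (b : D) :
    𝔏.cls (E l j b) (E k l e) ∈ W := by
  induction b using 𝒟.induction with
  | hadd x y hx hy => simp only [map_add, LinearMap.add_apply]; exact add_mem hx hy
  | hom β b hb =>
    have h := hW b
    rwa [S.cls_mul_eq_swap hkl hlj hkj hb S.even, neg_mem_iff, sgn_smul_mem_iff, (S.bar b).1] at h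

/-- Products of root vectors in the order `l → j`, `k → l` lie in the span of those along
`k → l → j`: this follows by expanding the pairing of `E_kj(b)` with `[E_jk(1), E_kj(c)]`
in two ways. -/
theorem cls_swap_mem (S : SteinbergFamily 𝒟 e par 𝔏 E) {k l j : ι} (hkl : k ≠ l)
    (hlj : l ≠ j) (hkj : k ≠ j) {W : Submodule R _}
    (hW : ∀ c, 𝔏.cls (E k l c) (E l j e) ∈ W) (b c : D) :
    𝔏.cls (E l j b) (E k l c) ∈ W := by
  induction b using 𝒟.induction with
  | hadd x y hx hy => simp only [map_add, LinearMap.add_apply]; exact add_mem hx hy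
  | hom β b hb =>
    induction c using 𝒟.induction with
    | hadd x y hx hy => simp only [map_add]; exact add_mem hx hy
    | hom γ c hc =>
      have hWP : ∀ x y, 𝔏.cls (E k l x) (E l j y) ∈ W := by
        intro x y
        rw [S.cls_mul hkl hlj hkj]
        exact hW _
      have hjk := hkj.symm
      have hjl := hlj.symm
      have hlk := hkl.symm
      -- the expansion with `E_kj(c) = [E_kl(c), E_lj(1)]`
      have h1 : 𝔏.bracket (E j k e) (E k j c) = 𝔏.bracket (E j l (𝒟.left e c)) (E l j e)
          + sgn (par k + par l + γ) (par l + par j) • sgn (par j + par k) (par l + par j) •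
            𝔏.bracket (E l k e) (E k l c) := by
        have h := 𝔏.leibniz _ _ (E j k e) _ (S.mem hkl hc) _ (S.mem_unit hlj)
        have h' := S.mul_swap hlj hjk hlk S.even S.even
        rw [add_zero, add_zero, (S.bar e).2] at h'
        rw [S.mul hkl hlj hkj, (S.bar c).1, S.mul hjk hkl hjl, h', map_neg, LinearMap.neg_apply,
          map_zsmul, LinearMap.smul_apply, smul_neg, sub_neg_eq_add] at h
        exact h
      -- the expansion with `E_kj(c) = ∓[E_lj(c), E_kl(1)]`
      have h2 : 𝔏.bracket (E j k e) (E k j c) = -(sgn (par l + par j + γ) (par k + par l) •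
          (-(sgn (par j + par k) (par l + par j + γ) •
            𝔏.bracket (E l k (𝒟.right c e)) (E k l e))
          - sgn (par l + par j + γ) (par k + par l) • 𝔏.bracket (E j l e) (E l j c))) := by
        have h := 𝔏.leibniz _ _ (E j k e) _ (S.mem hlj hc) _ (S.mem_unit hkl)
        have h' := S.mul_swap hkl hlj hkj S.even hc
        have h'' := S.mul_swap hlj hjk hlk hc S.even
        rw [add_zero] at h' h''
        rw [h', (S.bar c).2, h'', S.mul hjk hkl hjl, (S.bar e).1, map_neg, map_neg,
          LinearMap.neg_apply, map_zsmul, map_zsmul, LinearMap.smul_apply] at h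
        rw [← h, smul_neg, neg_neg, sgn_smul_sgn_smul]
      have c1 : 𝔏.cls (E k j b) (𝔏.bracket (E j l (𝒟.left e c)) (E l j e)) ∈ W := by
        have hm := 𝒟.left_mem _ _ _ S.even _ hc
        rw [𝔏.cls_bracket_right _ (S.mem hjl hm) (S.mem_unit hlj), S.mul hkj hjl hkl,
          S.zero hkj hlj hjl hkj, map_zero, LinearMap.zero_apply, smul_zero, sub_zero]
        exact hWP _ _
      have c2 : 𝔏.cls (E k j b) (𝔏.bracket (E j l e) (E l j c)) ∈ W := by
        rw [𝔏.cls_bracket_right _ (S.mem_unit hjl) (S.mem hlj hc), S.mul hkj hjl hkl,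
          S.zero hkj hlj hjl hkj, map_zero, LinearMap.zero_apply, smul_zero, sub_zero]
        exact hWP _ _
      have c3 : 𝔏.cls (E k j b) (𝔏.bracket (E l k (𝒟.right c e)) (E k l e)) ∈ W := by
        have hm := 𝒟.right_mem _ _ _ hc _ S.even
        rw [𝔏.cls_bracket_right _ (S.mem hlk hm) (S.mem_unit hkl),
          S.zero hkj hkl hjk hkl, S.mul_swap hlk hkj hlj hm hb, map_zero, LinearMap.zero_apply,
          smul_zero, sub_zero, map_neg, LinearMap.neg_apply, map_zsmul, LinearMap.smul_apply,
          neg_mem_iff, sgn_smul_mem_iff]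
        exact S.cls_swap_unit_mem hkl hlj hkj hW _
      have c4 : 𝔏.cls (E k j b) (𝔏.bracket (E l k e) (E k l c)) ∈ W := by
        have h := congrArg (𝔏.cls (E k j b)) (h1.symm.trans h2)
        rw [map_add, map_zsmul, map_zsmul, ← eq_sub_iff_add_eq'] at h
        rw [← sgn_smul_mem_iff, ← sgn_smul_mem_iff, h]
        refine sub_mem ?_ c1
        rw [map_neg, map_zsmul, map_sub, map_neg, map_zsmul, map_zsmul]
        exact neg_mem (zsmul_mem (sub_mem (neg_mem (zsmul_mem c3 _)) (zsmul_mem c2 _)) _)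
      rwa [𝔏.cls_bracket_right _ (S.mem_unit hlk) (S.mem hkl hc),
        S.zero hkj hkl hjk hkl, S.mul_swap hlk hkj hlj S.even hb, map_zero, LinearMap.zero_apply,
        smul_zero, sub_zero, map_neg, LinearMap.neg_apply, map_zsmul, LinearMap.smul_apply,
        neg_mem_iff, sgn_smul_mem_iff, (S.bar b).2] at c4

/-- The class of a product along `k → l → j` does not depend on the middle index. -/
theorem cls_mul_middle (S : SteinbergFamily 𝒟 e par 𝔏 E) {k l j p : ι} (hkl : k ≠ l)
    (hlj : l ≠ j) (hkj : k ≠ j) (hkp : k ≠ p) (hpl : p ≠ l) (hpj : p ≠ j) (b c : D) :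
    𝔏.cls (E k l b) (E l j c) = 𝔏.cls (E k p (𝒟.left b c)) (E p j e) := by
  induction c using 𝒟.induction with
  | hadd x y hx hy => simp only [map_add, LinearMap.add_apply, hx, hy]
  | hom γ c hc =>
    have h := 𝔏.cls_bracket_left (E k p b) (S.mem_unit hpl) (S.mem hlj hc)
    rw [S.mul hkp hpl hkl, (S.bar b).1, S.mul hpl hlj hpj, S.zero hkp hlj hpl hkj, map_zero,
      LinearMap.zero_apply, smul_zero, add_zero, S.cls_mul hkp hpj hkj, S.left_unit_left] at h
    exact h

/-- The class of `E_kl(b) ⊗ E_lk(c c')`, for both products `c c'`, in terms of a third index. -/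
theorem cls_opposite (S : SteinbergFamily 𝒟 e par 𝔏 E) {k l p : ι} (hkl : k ≠ l) (hkp : k ≠ p)
    (hlp : l ≠ p) {β γ γ' : ZMod 2} {b c c' : D} (hb : b ∈ 𝒟.deg β) (hc : c ∈ 𝒟.deg γ)
    (hc' : c' ∈ 𝒟.deg γ') :
    𝔏.cls (E k l b) (E l k (𝒟.left c c')) = 𝔏.cls (E k p (𝒟.left b c)) (E p k c')
      + sgn (par p + par k + γ') (par p + par k + β + γ)
        • 𝔏.cls (E p l (𝒟.right c' b)) (E l p c) := by
  rw [← S.mul hlp hkp.symm hkl.symm, 𝔏.cls_bracket_right _ (S.mem hlp hc) (S.mem hkp.symm hc'),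
    S.mul hkl hlp hkp, S.mul_swap hkp.symm hkl hlp.symm hc' hb, map_neg, LinearMap.neg_apply,
    smul_neg, sub_neg_eq_add, map_zsmul, LinearMap.smul_apply, smul_smul]
  congr 2
  clear hb hc hc'
  generalize par k = k, par l = l, par p = p
  revert k l p β γ γ'
  decide

theorem cls_opposite' (S : SteinbergFamily 𝒟 e par 𝔏 E) {k l p : ι} (hkl : k ≠ l) (hkp : k ≠ p)
    (hlp : l ≠ p) {β γ γ' : ZMod 2} {b c c' : D} (hb : b ∈ 𝒟.deg β) (hc : c ∈ 𝒟.deg γ)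
    (hc' : c' ∈ 𝒟.deg γ') :
    𝔏.cls (E k l b) (E l k (𝒟.right c c')) = 𝔏.cls (E k p (𝒟.left b c)) (E p k c')
      + sgn (par p + par k + γ') (par p + par k + β + γ)
        • 𝔏.cls (E p l (𝒟.right c' b)) (E l p c) := by
  have h := 𝔏.cls_bracket_right (E k l b) (S.mem hkp.symm hc') (S.mem hlp hc)
  rw [S.mul_swap hlp hkp.symm hkl.symm hc hc', S.mul hkl hlp hkp,
    S.mul_swap hkp.symm hkl hlp.symm hc' hb, map_neg, map_neg, map_zsmul, map_zsmul,
    LinearMap.neg_apply, LinearMap.smul_apply, neg_eq_iff_eq_neg, neg_sub, sub_neg_eq_add] at h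
  rw [← sgn_smul_sgn_smul (par p + par k + γ') (par l + par p + γ)
    (𝔏.cls (E k l b) (E l k (𝒟.right c c'))), h, smul_add, sgn_smul_sgn_smul, smul_smul]
  congr 2
  clear hb hc hc' h
  generalize par k = k, par l = l, par p = p
  revert k l p β γ γ'
  decide

theorem cls_opposite_unit (S : SteinbergFamily 𝒟 e par 𝔏 E) {k l p : ι} (hkl : k ≠ l)
    (hkp : k ≠ p) (hlp : l ≠ p) {β γ : ZMod 2} {b c : D} (hb : b ∈ 𝒟.deg β)
    (hc : c ∈ 𝒟.deg γ) :
    𝔏.cls (E k l b) (E l k c) = 𝔏.cls (E k p (𝒟.left b c)) (E p k e)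
      + sgn (par p + par k) (par p + par k + β + γ) • 𝔏.cls (E p l b) (E l p c) := by
  have h := S.cls_opposite hkl hkp hlp hb hc S.even
  rwa [(S.bar c).1, (S.bar b).2, add_zero] at h

theorem cls_opposite_unit' (S : SteinbergFamily 𝒟 e par 𝔏 E) {k l p : ι} (hkl : k ≠ l)
    (hkp : k ≠ p) (hlp : l ≠ p) {β γ : ZMod 2} {b c : D} (hb : b ∈ 𝒟.deg β)
    (hc : c ∈ 𝒟.deg γ) :
    𝔏.cls (E k l b) (E l k c) = 𝔏.cls (E k p b) (E p k c)
      + sgn (par p + par k + γ) (par p + par k + β)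
        • 𝔏.cls (E p l (𝒟.right c b)) (E l p e) := by
  have h := S.cls_opposite' hkl hkp hlp hb S.even hc
  rwa [(S.bar c).2, (S.bar b).1, add_zero] at h

end SteinbergFamily

/-! ### Diagonal classes and the spanning theorem -/

/-- The map `a ⊗ b ↦ E_ok(a) ⊗ E_ko(b) - (-1)^(|a| |b|) E_ok(b ⊢ a) ⊗ E_ko(1)`, which lifts
Hochschild chains of `D` to chains of `L` supported at the diagonal place `o`. -/
noncomputable def handle {R D L ι : Type*} [CommRing R] [AddCommGroup D] [Module R D]
    [AddCommGroup L] [Module R L] (𝒟 : Superdialgebra R D) (e : D)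
    (E : ι → ι → D →ₗ[R] L) (o k : ι) : D ⊗[R] D →ₗ[R] L ⊗[R] L :=
  TensorProduct.map (E o k) (E k o) ∘ₗ
    (LinearMap.id - (TensorProduct.mk R D D).flip e ∘ₗ 𝒟.rmul ∘ₗ 𝒟.flip)

namespace SteinbergFamily

variable {R D L ι : Type*} [CommRing R] [AddCommGroup D] [Module R D]
  [AddCommGroup L] [Module R L] {𝒟 : Superdialgebra R D} {e : D} {par : ι → ZMod 2}
  {𝔏 : LeibnizSuperalgebra R L} {E : ι → ι → D →ₗ[R] L}

theorem mkQ_handle (o k : ι) {α β : ZMod 2} {a b : D} (ha : a ∈ 𝒟.deg α) (hb : b ∈ 𝒟.deg β) :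
    (LinearMap.range 𝔏.δ₃).mkQ (handle 𝒟 e E o k (a ⊗ₜ b)) = 𝔏.cls (E o k a) (E k o b)
      - sgn α β • 𝔏.cls (E o k (𝒟.right b a)) (E k o e) := by
  simp only [handle, LinearMap.comp_apply, LinearMap.sub_apply, LinearMap.id_apply,
    𝒟.flip_tmul ha hb, map_zsmul, Superdialgebra.rmul, TensorProduct.lift.tmul, map_sub,
    LinearMap.flip_apply, TensorProduct.mk_apply, TensorProduct.map_tmul,
    LeibnizSuperalgebra.cls_apply]

/-- The class of `handle` does not depend on its second index. -/
theorem mkQ_handle_eq (S : SteinbergFamily 𝒟 e par 𝔏 E) {o l p : ι} (hol : o ≠ l) (hop : o ≠ p)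
    (hlp : l ≠ p) (t : D ⊗[R] D) : (LinearMap.range 𝔏.δ₃).mkQ (handle 𝒟 e E o l t)
      = (LinearMap.range 𝔏.δ₃).mkQ (handle 𝒟 e E o p t) := by
  rw [← sub_eq_zero, ← map_sub]
  refine (Submodule.mem_bot R).1 (tensor_induction 𝒟.toSuperGrading 𝒟.toSuperGrading
    ((LinearMap.range 𝔏.δ₃).mkQ ∘ₗ (handle 𝒟 e E o l - handle 𝒟 e E o p)) ⊥ ?_ t)
  intro β γ b hb c hc
  rw [Submodule.mem_bot, LinearMap.comp_apply, LinearMap.sub_apply, map_sub, mkQ_handle o l hb hc,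
    mkQ_handle o p hb hc, S.cls_opposite_unit' hol hop hlp hb hc]
  have h := S.cls_opposite_unit hol hop hlp (𝒟.right_mem _ _ _ hc _ hb) S.even
  rw [(S.bar _).1] at h
  rw [h, smul_add, smul_smul]
  have hs : ∀ x y : ZMod 2, sgn β γ * sgn (x + y) (x + y + (γ + β) + 0)
      = sgn (x + y + γ) (x + y + β) := by
    clear hb hc h
    revert β γ
    decide
  rw [hs]
  abel

theorem mkQ_handle_d₂ (S : SteinbergFamily 𝒟 e par 𝔏 E) {o l p : ι} (hol : o ≠ l) (hop : o ≠ p)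
    (hlp : l ≠ p) (t : D ⊗[R] (D ⊗[R] D)) :
    (LinearMap.range 𝔏.δ₃).mkQ (handle 𝒟 e E o l (𝒟.d₂ t)) = 0 := by
  refine (Submodule.mem_bot R).1 (tensor_induction₃ 𝒟.toSuperGrading 𝒟.toSuperGrading
    𝒟.toSuperGrading ((LinearMap.range 𝔏.δ₃).mkQ ∘ₗ handle 𝒟 e E o l ∘ₗ 𝒟.d₂) ⊥ ?_ t)
  intro α β γ a ha b hb c hc
  have hab := 𝒟.left_mem _ _ _ ha _ hb
  have hbc := 𝒟.left_mem _ _ _ hb _ hc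
  have hca := 𝒟.right_mem _ _ _ hc _ ha
  rw [Submodule.mem_bot, LinearMap.comp_apply, LinearMap.comp_apply, 𝒟.d₂_tmul ha hb hc, map_add,
    map_sub, map_add, map_sub, map_zsmul, map_zsmul, S.mkQ_handle_eq hol hop hlp (_ ⊗ₜ c),
    mkQ_handle o p hab hc, mkQ_handle o l ha hbc, mkQ_handle o l hca hb,
    S.cls_opposite hol hop hlp ha hb hc, S.cls_opposite_unit hol hop hlp hca hb, 𝒟.right_right,
    𝒟.right_assoc, 𝒟.right_left]
  simp only [smul_add, smul_sub, smul_smul]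
  have h1 : sgn γ (α + β) * sgn (par p + par o) (par p + par o + (γ + α) + β)
      = sgn (par p + par o + γ) (par p + par o + α + β) := by
    generalize par p + par o = x
    clear ha hb hc hab hbc hca
    revert α β γ x
    decide
  have h2 : sgn γ (α + β) * sgn (γ + α) β = sgn α (β + γ) := by
    clear ha hb hc hab hbc hca h1
    revert α β γ
    decide
  have h3 : sgn (α + β) γ = sgn γ (α + β) := by
    clear ha hb hc hab hbc hca h1 h2
    revert α β γ
    decide
  rw [h1, h2, h3]
  abel

theorem mkQ_handle_I (S : SteinbergFamily 𝒟 e par 𝔏 E) {o l p : ι} (hol : o ≠ l) (hop : o ≠ p)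
    (hlp : l ≠ p) {t : D ⊗[R] D} (ht : t ∈ 𝒟.I) :
    (LinearMap.range 𝔏.δ₃).mkQ (handle 𝒟 e E o l t) = 0 := by
  rw [𝒟.I_eq] at ht
  obtain ⟨t, rfl⟩ := ht
  refine (Submodule.mem_bot R).1 (tensor_induction₃ 𝒟.toSuperGrading 𝒟.toSuperGrading
    𝒟.toSuperGrading ((LinearMap.range 𝔏.δ₃).mkQ ∘ₗ handle 𝒟 e E o l ∘ₗ
      LinearMap.lTensor D (𝒟.lmul - 𝒟.rmul)) ⊥ ?_ t)
  intro α β γ a ha b hb c hc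
  have h : LinearMap.lTensor D (𝒟.lmul - 𝒟.rmul) (a ⊗ₜ (b ⊗ₜ c))
      = a ⊗ₜ[R] 𝒟.left b c - a ⊗ₜ[R] 𝒟.right b c := by
    simp [Superdialgebra.lmul, Superdialgebra.rmul]
  rw [Submodule.mem_bot, LinearMap.comp_apply, LinearMap.comp_apply, h, map_sub, map_sub,
    mkQ_handle o l ha (𝒟.left_mem _ _ _ hb _ hc), mkQ_handle o l ha (𝒟.right_mem _ _ _ hb _ hc),
    S.cls_opposite hol hop hlp ha hb hc, S.cls_opposite' hol hop hlp ha hb hc, 𝒟.right_right,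
    sub_self]

/-- Hochschild boundaries and elements of `I` lift to Leibniz boundaries. -/
theorem handle_mem_range (S : SteinbergFamily 𝒟 e par 𝔏 E) {o l p : ι} (hol : o ≠ l)
    (hop : o ≠ p) (hlp : l ≠ p) {t : D ⊗[R] D} (ht : t ∈ LinearMap.range 𝒟.d₂ ⊔ 𝒟.I) :
    handle 𝒟 e E o l t ∈ LinearMap.range 𝔏.δ₃ := by
  obtain ⟨_, ⟨s, rfl⟩, u, hu, rfl⟩ := Submodule.mem_sup.1 ht
  rw [← Submodule.Quotient.mk_eq_zero, ← Submodule.mkQ_apply, map_add, map_add,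
    S.mkQ_handle_d₂ hol hop hlp, S.mkQ_handle_I hol hop hlp hu, add_zero]

section Opposite

variable {W : Submodule R ((L ⊗[R] L) ⧸ LinearMap.range 𝔏.δ₃)} {o k₀ : ι}

/-- All classes `E_ok(b) ⊗ E_ko(c)` with `o` fixed are combinations of those with `c = 1` and of
the classes of `handle`. -/
theorem cls_base_mem (S : SteinbergFamily 𝒟 e par 𝔏 E) (hk₀ : o ≠ k₀)
    (hG : ∀ k, o ≠ k → ∀ c, 𝔏.cls (E o k c) (E k o e) ∈ W)
    (hh : ∀ t, (LinearMap.range 𝔏.δ₃).mkQ (handle 𝒟 e E o k₀ t) ∈ W) {k : ι} (hk : o ≠ k)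
    {β γ : ZMod 2} {b c : D} (hb : b ∈ 𝒟.deg β) (hc : c ∈ 𝒟.deg γ) :
    𝔏.cls (E o k b) (E k o c) ∈ W := by
  have h : (LinearMap.range 𝔏.δ₃).mkQ (handle 𝒟 e E o k (b ⊗ₜ c)) ∈ W := by
    by_cases hkk : k = k₀
    · rw [hkk]
      exact hh _
    · rw [S.mkQ_handle_eq hk hk₀ hkk]
      exact hh _
  rw [mkQ_handle o k hb hc] at h
  have h' := add_mem h (zsmul_mem (hG k hk (𝒟.right c b)) (sgn β γ))
  rwa [sub_add_cancel] at h'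

theorem cls_opposite_mem (S : SteinbergFamily 𝒟 e par 𝔏 E) (hk₀ : o ≠ k₀)
    (third : ∀ i j : ι, ∃ p, i ≠ p ∧ j ≠ p)
    (hG : ∀ k, o ≠ k → ∀ c, 𝔏.cls (E o k c) (E k o e) ∈ W)
    (hh : ∀ t, (LinearMap.range 𝔏.δ₃).mkQ (handle 𝒟 e E o k₀ t) ∈ W) {k l : ι} (hkl : k ≠ l)
    {β γ : ZMod 2} {b c : D} (hb : b ∈ 𝒟.deg β) (hc : c ∈ 𝒟.deg γ) :
    𝔏.cls (E k l b) (E l k c) ∈ W := by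
  have base : ∀ {k : ι}, o ≠ k → ∀ {β γ : ZMod 2} {b c : D}, b ∈ 𝒟.deg β → c ∈ 𝒟.deg γ →
      𝔏.cls (E o k b) (E k o c) ∈ W := fun hk _ _ _ _ hb hc => S.cls_base_mem hk₀ hG hh hk hb hc
  have off : ∀ {p l : ι}, o ≠ p → o ≠ l → p ≠ l → ∀ {β γ : ZMod 2} {b c : D}, b ∈ 𝒟.deg β →
      c ∈ 𝒟.deg γ → 𝔏.cls (E p l b) (E l p c) ∈ W := by
    intro p l hop hol hpl β γ b c hb hc
    have h := S.cls_opposite_unit hol hop hpl.symm hb hc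
    rw [← sub_eq_iff_eq_add'] at h
    rw [← sgn_smul_mem_iff, ← h]
    exact sub_mem (base hol hb hc) (base hop (𝒟.left_mem _ _ _ hb _ hc) S.even)
  by_cases hok : o = k
  · subst hok
    exact base hkl hb hc
  by_cases hol : o = l
  · subst hol
    obtain ⟨p, hkp, hop⟩ := third k o
    -- the place `(k, o)` is reached through the class of `E_kp ⊗ E_pk` with `k, p ≠ o`
    have h := S.cls_opposite_unit' hkp hkl (Ne.symm hop) hb hc
    rw [← sub_eq_iff_eq_add] at h
    rw [← h]
    refine sub_mem (off hok hop hkp hb hc) (zsmul_mem ?_ _)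
    exact base hop (𝒟.right_mem _ _ _ hc _ hb) S.even
  · exact off hok hol hkl hb hc

end Opposite

/-- A bracket of root vectors which are not opposite is a root vector or zero. -/
theorem bracket_eq (S : SteinbergFamily 𝒟 e par 𝔏 E) {i j k l : ι} (hij : i ≠ j) (hkl : k ≠ l)
    (h : ¬(k = j ∧ l = i)) {α β : ZMod 2} {a b : D} (ha : a ∈ 𝒟.deg α) (hb : b ∈ 𝒟.deg β) :
    𝔏.bracket (E i j a) (E k l b) = 0 ∨
      ∃ i' j' a', i' ≠ j' ∧ 𝔏.bracket (E i j a) (E k l b) = E i' j' a' := by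
  by_cases hjk : j = k
  · subst hjk
    have hil : i ≠ l := fun h' => h ⟨rfl, h'.symm⟩
    exact Or.inr ⟨i, l, _, hil, S.mul hij hkl hil a b⟩
  · by_cases hil : i = l
    · subst hil
      refine Or.inr ⟨k, j, -(sgn (par i + par j + α) (par k + par i + β) • 𝒟.right b a),
        Ne.symm hjk, ?_⟩
      rw [S.mul_swap hkl hij (Ne.symm hjk) hb ha, map_neg, map_zsmul]
    · exact Or.inl (S.zero hij hkl hjk hil a b)

/-- It suffices to test membership on pairs of root vectors. -/
theorem cls_mem_of_root (S : SteinbergFamily 𝒟 e par 𝔏 E)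
    (third : ∀ i j : ι, ∃ p, i ≠ p ∧ j ≠ p)
    {W : Submodule R ((L ⊗[R] L) ⧸ LinearMap.range 𝔏.δ₃)}
    (hW : ∀ i j k l, i ≠ j → k ≠ l → ∀ α β, ∀ a ∈ 𝒟.deg α, ∀ b ∈ 𝒟.deg β,
      𝔏.cls (E i j a) (E k l b) ∈ W) (x y : L) : 𝔏.cls x y ∈ W := by
  have hW' : ∀ i j k l, i ≠ j → k ≠ l → ∀ a b, 𝔏.cls (E i j a) (E k l b) ∈ W := by
    intro i j k l hij hkl a b
    induction a using 𝒟.induction with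
    | hadd x y hx hy => simp only [map_add, LinearMap.add_apply]; exact add_mem hx hy
    | hom α a ha =>
      induction b using 𝒟.induction with
      | hadd x y hx hy => simp only [map_add]; exact add_mem hx hy
      | hom β b hb => exact hW i j k l hij hkl α β a ha b hb
  -- a diagonal element against a root vector, when the two roots are not proportional
  have step : ∀ i j k l, i ≠ j → k ≠ l → ¬(k = j ∧ l = i) → ¬(k = i ∧ l = j) → ∀ α β γ,
      ∀ a ∈ 𝒟.deg α, ∀ b ∈ 𝒟.deg β, ∀ c ∈ 𝒟.deg γ,
      𝔏.cls (𝔏.bracket (E i j a) (E j i b)) (E k l c) ∈ W := by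
    intro i j k l hij hkl h1 h2 α β γ a ha b hb c hc
    rw [𝔏.cls_bracket_left _ (S.mem hij.symm hb) (S.mem hkl hc)]
    refine add_mem ?_ (zsmul_mem ?_ _)
    · rcases S.bracket_eq hij.symm hkl h2 hb hc with h | ⟨i', j', a', hij', h⟩
      · rw [h, map_zero]
        exact zero_mem _
      · rw [h]
        exact hW' _ _ _ _ hij hij' _ _
    · rcases S.bracket_eq hij hkl h1 ha hc with h | ⟨i', j', a', hij', h⟩
      · rw [h, map_zero, LinearMap.zero_apply]
        exact zero_mem _
      · rw [h]
        exact hW' _ _ _ _ hij' hij.symm _ _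
  -- rewriting a diagonal element with a third index
  have root : ∀ k l, k ≠ l → ∀ x c, 𝔏.cls x (E k l c) ∈ W := by
    intro k l hkl x c
    induction c using 𝒟.induction with
    | hadd x y hx hy => simp only [map_add]; exact add_mem hx hy
    | hom γ c hc =>
      have hx : x ∈ W.comap (𝔏.cls.flip (E k l c)) := by
        rw [S.span (W.comap (𝔏.cls.flip (E k l c))) ?_ ?_]
        · trivial
        · intro i j hij a
          exact hW' i j k l hij hkl a c
        · intro i j hij α β a ha b hb
          change 𝔏.cls (𝔏.bracket (E i j a) (E j i b)) (E k l c) ∈ W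
          by_cases h : (k = j ∧ l = i) ∨ (k = i ∧ l = j)
          · obtain ⟨p, hip, hjp⟩ := third i j
            have hm := 𝔏.leibniz _ _ (E i p a) _ (S.mem_unit hjp.symm) _ (S.mem hij.symm hb)
            rw [S.mul hjp.symm hij.symm hip.symm, S.mul hip hjp.symm hij, (S.bar a).1,
              S.mul_swap hij.symm hip hjp hb ha, map_neg, LinearMap.neg_apply, map_zsmul,
              LinearMap.smul_apply, smul_neg, sub_neg_eq_add, ← sub_eq_iff_eq_add] at hm
            rw [← hm, map_sub, LinearMap.sub_apply, map_zsmul, map_zsmul, LinearMap.smul_apply,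
              LinearMap.smul_apply]
            refine sub_mem ?_ (zsmul_mem (zsmul_mem ?_ _) _)
            · refine step i p k l hip hkl ?_ ?_ _ _ _ _ ha _ (𝒟.left_mem _ _ _ S.even _ hb) _ hc
              · rintro ⟨rfl, rfl⟩
                rcases h with ⟨rfl, -⟩ | ⟨rfl, -⟩ <;> contradiction
              · rintro ⟨rfl, rfl⟩
                rcases h with ⟨-, rfl⟩ | ⟨-, rfl⟩ <;> contradiction
            · refine step j p k l hjp hkl ?_ ?_ _ _ _ _ (𝒟.right_mem _ _ _ hb _ ha) _ S.even _ hc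
              · rintro ⟨rfl, rfl⟩
                rcases h with ⟨rfl, -⟩ | ⟨rfl, -⟩ <;> contradiction
              · rintro ⟨rfl, rfl⟩
                rcases h with ⟨-, rfl⟩ | ⟨-, rfl⟩ <;> contradiction
          · exact step i j k l hij hkl (fun h' => h (Or.inl h')) (fun h' => h (Or.inr h'))
              _ _ _ a ha b hb c hc
      exact hx
  have hy : y ∈ W.comap (𝔏.cls x) := by
    rw [S.span (W.comap (𝔏.cls x)) (fun i j hij a => root i j hij x a) ?_]
    · trivial
    · intro i j hij α β a ha b hb
      rw [Submodule.mem_comap, 𝔏.cls_bracket_right _ (S.mem hij ha) (S.mem hij.symm hb)]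
      exact sub_mem (root _ _ hij.symm _ _) (zsmul_mem (root _ _ hij _ _) _)
  exact hy

/-- The classes that span `(L ⊗ L) / Im δ₃`: a root vector for every root, a diagonal element for
every `k ≠ o`, the classes of `handle`, and the pairs of root vectors whose formal product
vanishes. -/
theorem cls_mem (S : SteinbergFamily 𝒟 e par 𝔏 E) {o k₀ : ι} (hk₀ : o ≠ k₀)
    (third : ∀ i j : ι, ∃ p, i ≠ p ∧ j ≠ p)
    {W : Submodule R ((L ⊗[R] L) ⧸ LinearMap.range 𝔏.δ₃)}
    (hF : ∀ k j, k ≠ j → ∃ l, k ≠ l ∧ l ≠ j ∧ ∀ c, 𝔏.cls (E k l c) (E l j e) ∈ W)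
    (hG : ∀ k, o ≠ k → ∀ c, 𝔏.cls (E o k c) (E k o e) ∈ W)
    (hh : ∀ t, (LinearMap.range 𝔏.δ₃).mkQ (handle 𝒟 e E o k₀ t) ∈ W)
    (hX : ∀ i j k l, i ≠ j → k ≠ l → j ≠ k → i ≠ l → ∀ a b, 𝔏.cls (E i j a) (E k l b) ∈ W)
    (x y : L) : 𝔏.cls x y ∈ W := by
  have hF' : ∀ {k l j}, k ≠ l → l ≠ j → k ≠ j → ∀ c, 𝔏.cls (E k l c) (E l j e) ∈ W := by
    intro k l j hkl hlj hkj c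
    obtain ⟨p, hkp, hpj, hp⟩ := hF k j hkj
    by_cases hpl : p = l
    · rw [← hpl]
      exact hp c
    · rw [S.cls_mul_middle hkl hlj hkj hkp hpl hpj]
      exact hp _
  refine S.cls_mem_of_root third ?_ x y
  intro i j k l hij hkl α β a ha b hb
  by_cases hjk : j = k
  · subst hjk
    by_cases hil : i = l
    · subst hil
      exact S.cls_opposite_mem hk₀ third hG hh hij ha hb
    · rw [S.cls_mul hij hkl hil]
      exact hF' hij hkl hil _
  · by_cases hil : i = l
    · subst hil
      exact S.cls_swap_mem hkl hij (Ne.symm hjk) (hF' hkl hij (Ne.symm hjk)) a b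
    · exact hX i j k l hij hkl hjk hil a b

end SteinbergFamily

/-! ### Matrix units -/

namespace Superdialgebra

variable {R D : Type*} [CommRing R] [AddCommGroup D] [Module R D] {m n : ℕ}

theorem single_mem (A : SuperGrading R D) (i j : Fin m ⊕ Fin n) {α : ZMod 2} {a : D}
    (ha : a ∈ A.deg α) :
    Matrix.single i j a ∈ (matrixGrading A m n).deg (idx i + idx j + α) := by
  intro k l
  rw [Matrix.single_apply]
  split_ifs with h
  · obtain ⟨rfl, rfl⟩ := h
    rwa [show idx i + idx j + α - idx i - idx j = α by ring]
  · exact zero_mem _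

theorem left_single (𝒟 : Superdialgebra R D) (i j k l : Fin m ⊕ Fin n) (a b : D) :
    (𝒟.matrix m n).left (Matrix.single i j a) (Matrix.single k l b)
      = if j = k then Matrix.single i l (𝒟.left a b) else 0 := by
  ext p q
  change ∑ s, 𝒟.left (Matrix.single i j a p s) (Matrix.single k l b s q) = _
  rw [Finset.sum_eq_single j]
  · by_cases hjk : j = k
    · subst hjk
      by_cases hip : i = p <;> by_cases hlq : l = q <;> simp [hip, hlq]
    · simp [hjk, Ne.symm hjk]
  · intro s _ hs
    simp [Ne.symm hs]
  · simp

theorem right_single (𝒟 : Superdialgebra R D) (i j k l : Fin m ⊕ Fin n) (a b : D) :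
    (𝒟.matrix m n).right (Matrix.single i j a) (Matrix.single k l b)
      = if j = k then Matrix.single i l (𝒟.right a b) else 0 := by
  ext p q
  change ∑ s, 𝒟.right (Matrix.single i j a p s) (Matrix.single k l b s q) = _
  rw [Finset.sum_eq_single j]
  · by_cases hjk : j = k
    · subst hjk
      by_cases hip : i = p <;> by_cases hlq : l = q <;> simp [hip, hlq]
    · simp [hjk, Ne.symm hjk]
  · intro s _ hs
    simp [Ne.symm hs]
  · simp

theorem bracket_single (𝒟 : Superdialgebra R D) (i j k l : Fin m ⊕ Fin n) {α β : ZMod 2}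
    {a b : D} (ha : a ∈ 𝒟.deg α) (hb : b ∈ 𝒟.deg β) :
    (𝒟.gl m n).bracket (Matrix.single i j a) (Matrix.single k l b)
      = (if j = k then Matrix.single i l (𝒟.left a b) else 0)
        - sgn (idx i + idx j + α) (idx k + idx l + β)
          • (if l = i then Matrix.single k j (𝒟.right b a) else 0) := by
  rw [← left_single, ← right_single]
  exact (𝒟.matrix m n).d₁_tmul (single_mem 𝒟.toSuperGrading i j ha)
    (single_mem 𝒟.toSuperGrading k l hb)

theorem bracket_single' (𝒟 : Superdialgebra R D) {i j k l : Fin m ⊕ Fin n} (h : l ≠ i) (a b : D) :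
    (𝒟.gl m n).bracket (Matrix.single i j a) (Matrix.single k l b)
      = if j = k then Matrix.single i l (𝒟.left a b) else 0 := by
  induction a using 𝒟.induction with
  | hadd x y hx hy =>
    simp only [Matrix.single_add, map_add, LinearMap.add_apply, hx, hy]
    split_ifs <;> simp
  | hom α a ha =>
    induction b using 𝒟.induction with
    | hadd x y hx hy =>
      simp only [Matrix.single_add, map_add, hx, hy]
      split_ifs <;> simp
    | hom β b hb => rw [𝒟.bracket_single i j k l ha hb, if_neg h, smul_zero, sub_zero]

variable {P : Type*} [AddCommGroup P] [Module R P]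

/-- Matrices are spanned by matrix units with homogeneous entries. -/
theorem matrix_mem_of_single (A : SuperGrading R D)
    (S : Submodule R (Matrix (Fin m ⊕ Fin n) (Fin m ⊕ Fin n) D))
    (h : ∀ i j α, ∀ a ∈ A.deg α, Matrix.single i j a ∈ S) (x) : x ∈ S := by
  rw [Matrix.matrix_eq_sum_single x]
  refine sum_mem fun i _ => sum_mem fun j _ => ?_
  generalize x i j = a
  induction a using A.induction with
  | hadd x y hx hy => rw [Matrix.single_add]; exact add_mem hx hy
  | hom α a ha => exact h i j α a ha

theorem matrix_tensor_induction (A : SuperGrading R D) (S : Submodule R P)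
    (f : Matrix (Fin m ⊕ Fin n) (Fin m ⊕ Fin n) D ⊗[R]
      Matrix (Fin m ⊕ Fin n) (Fin m ⊕ Fin n) D →ₗ[R] P)
    (h : ∀ i j k l α β, ∀ a ∈ A.deg α, ∀ b ∈ A.deg β,
      f (Matrix.single i j a ⊗ₜ Matrix.single k l b) ∈ S) (t) : f t ∈ S := by
  induction t using TensorProduct.induction_on with
  | zero => simp
  | add s t hs ht => rw [map_add]; exact add_mem hs ht
  | tmul x y =>
    refine matrix_mem_of_single A (S.comap (f ∘ₗ (TensorProduct.mk R _ _).flip y)) ?_ x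
    intro i j α a ha
    exact matrix_mem_of_single A (S.comap (f ∘ₗ TensorProduct.mk R _ _ (Matrix.single i j a)))
      (fun k l β b hb => h i j k l α β a ha b hb) y

theorem matrix_tensor_induction₃ (A : SuperGrading R D) (S : Submodule R P)
    (f : Matrix (Fin m ⊕ Fin n) (Fin m ⊕ Fin n) D ⊗[R]
      (Matrix (Fin m ⊕ Fin n) (Fin m ⊕ Fin n) D ⊗[R]
        Matrix (Fin m ⊕ Fin n) (Fin m ⊕ Fin n) D) →ₗ[R] P)
    (h : ∀ i j k l p q α β γ, ∀ a ∈ A.deg α, ∀ b ∈ A.deg β, ∀ c ∈ A.deg γ,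
      f (Matrix.single i j a ⊗ₜ (Matrix.single k l b ⊗ₜ Matrix.single p q c)) ∈ S) (t) :
    f t ∈ S := by
  induction t using TensorProduct.induction_on with
  | zero => simp
  | add s t hs ht => rw [map_add]; exact add_mem hs ht
  | tmul x t =>
    refine matrix_mem_of_single A (S.comap (f ∘ₗ (TensorProduct.mk R _ _).flip t)) ?_ x
    intro i j α a ha
    exact matrix_tensor_induction A S (f ∘ₗ TensorProduct.mk R _ _ (Matrix.single i j a))
      (fun k l p q β γ b hb c hc => h i j k l p q α β γ a ha b hb c hc) t

/-! ### The off-diagonal matrix units form a Steinberg family of `sl` -/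

open Classical in
/-- The map `a ↦ E_ij(a)` into `sl(m, n, D)`; it has the junk value `0` if the matrix units do not
lie in `sl(m, n, D)`. -/
noncomputable def root (𝒟 : Superdialgebra R D) (m n : ℕ) (i j : Fin m ⊕ Fin n) :
    D →ₗ[R] (𝒟.gl m n).commutator :=
  if h : ∀ a, Matrix.singleLinearMap R i j a ∈ (𝒟.gl m n).commutator then
    (Matrix.singleLinearMap R i j).codRestrict _ h else 0

variable {𝒟 : Superdialgebra R D} {e : D}

theorem coe_root (he : 𝒟.IsBarUnit e) {i j : Fin m ⊕ Fin n} (hij : i ≠ j) (a : D) :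
    (𝒟.root m n i j a : Matrix (Fin m ⊕ Fin n) (Fin m ⊕ Fin n) D) = Matrix.single i j a := by
  have h : ∀ a, Matrix.singleLinearMap R i j a ∈ (𝒟.gl m n).commutator := by
    intro a
    have h := 𝒟.bracket_single' (j := j) (k := j) hij.symm a e
    rw [if_pos rfl, (he a).1] at h
    rw [Matrix.singleLinearMap_apply, ← h]
    exact (𝒟.gl m n).bracket_mem_commutator _ _
  rw [root, dif_pos h]
  rfl

theorem coe_bracket (x y : (𝒟.gl m n).commutator) :
    (((𝒟.sl m n).bracket x y : (𝒟.gl m n).commutator) :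
      Matrix (Fin m ⊕ Fin n) (Fin m ⊕ Fin n) D) = (𝒟.gl m n).bracket x y := rfl

theorem coe_bracket_root_opposite (he : 𝒟.IsBarUnit e) {i j : Fin m ⊕ Fin n} (hij : i ≠ j)
    {α β : ZMod 2} {a b : D} (ha : a ∈ 𝒟.deg α) (hb : b ∈ 𝒟.deg β) :
    (((𝒟.sl m n).bracket (𝒟.root m n i j a) (𝒟.root m n j i b) : (𝒟.gl m n).commutator) :
      Matrix (Fin m ⊕ Fin n) (Fin m ⊕ Fin n) D) = Matrix.single i i (𝒟.left a b)
        - sgn (idx i + idx j + α) (idx i + idx j + β) • Matrix.single j j (𝒟.right b a) := by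
  rw [coe_bracket, coe_root he hij, coe_root he hij.symm, 𝒟.bracket_single i j j i ha hb,
    if_pos rfl, if_pos rfl, add_comm (idx j) (idx i)]

/-- The algebra `sl(m, n, D)` is spanned by the off-diagonal matrix units and the brackets of
opposite ones. -/
theorem root_span (he : 𝒟.IsBarUnit e) (he' : e ∈ 𝒟.deg 0)
    (third : ∀ i j : Fin m ⊕ Fin n, ∃ p, i ≠ p ∧ j ≠ p)
    (S : Submodule R (𝒟.gl m n).commutator)
    (h₁ : ∀ i j, i ≠ j → ∀ a, 𝒟.root m n i j a ∈ S)
    (h₂ : ∀ i j, i ≠ j → ∀ α β, ∀ a ∈ 𝒟.deg α, ∀ b ∈ 𝒟.deg β,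
      (𝒟.sl m n).bracket (𝒟.root m n i j a) (𝒟.root m n j i b) ∈ S) : S = ⊤ := by
  have h₁' : ∀ i j, i ≠ j → ∀ a, Matrix.single i j a ∈ S.map (𝒟.gl m n).commutator.subtype :=
    fun i j hij a => ⟨_, h₁ i j hij a, coe_root he hij a⟩
  have h₂' : ∀ i j, i ≠ j → ∀ α β, ∀ a ∈ 𝒟.deg α, ∀ b ∈ 𝒟.deg β,
      Matrix.single i i (𝒟.left a b) - sgn (idx i + idx j + α) (idx i + idx j + β)
        • Matrix.single j j (𝒟.right b a) ∈ S.map (𝒟.gl m n).commutator.subtype :=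
    fun i j hij α β a ha b hb =>
      ⟨_, h₂ i j hij α β a ha b hb, coe_bracket_root_opposite he hij ha hb⟩
  have key : (𝒟.gl m n).commutator ≤ S.map (𝒟.gl m n).commutator.subtype := by
    refine Submodule.span_le.2 ?_
    rintro _ ⟨x, y, rfl⟩
    refine matrix_tensor_induction 𝒟.toSuperGrading _ (TensorProduct.lift (𝒟.gl m n).bracket)
      ?_ (x ⊗ₜ y)
    intro i j k l α β a ha b hb
    rw [TensorProduct.lift.tmul, 𝒟.bracket_single i j k l ha hb]
    by_cases hjk : j = k
    · subst hjk
      by_cases hil : i = l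
      · subst hil
        rw [if_pos rfl, if_pos rfl, add_comm (idx j)]
        by_cases hij : i = j
        · subst hij
          -- a diagonal commutator is a difference of brackets of opposite root vectors
          obtain ⟨p, hp, -⟩ := third i i
          have h := sub_mem (h₂' i p hp _ _ _ ha _ hb)
            (zsmul_mem (h₂' i p hp _ _ _ (𝒟.right_mem _ _ _ hb _ ha) _ he') (sgn α β))
          rw [(he _).1, (he _).2, smul_sub, smul_smul] at h
          have h1 : sgn α β * sgn (idx i + idx p + (β + α)) (idx i + idx p + 0)
              = sgn (idx i + idx p + α) (idx i + idx p + β) := by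
            generalize idx i + idx p = x
            clear ha hb h
            revert α β x
            decide
          have h2 : sgn (idx i + idx i + α) (idx i + idx i + β) = sgn α β := by
            rw [CharTwo.add_self_eq_zero, zero_add, zero_add]
          rw [h1, sub_sub_sub_cancel_right] at h
          rwa [h2]
        · exact h₂' i j hij α β a ha b hb
      · rw [if_pos rfl, if_neg (Ne.symm hil), smul_zero, sub_zero]
        exact h₁' i l hil _
    · rw [if_neg hjk, zero_sub, neg_mem_iff, sgn_smul_mem_iff]
      split_ifs with h
      · exact h₁' k j (Ne.symm hjk) _
      · exact zero_mem _
  rw [eq_top_iff]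
  intro x _
  obtain ⟨y, hy, hyx⟩ := key x.2
  rwa [← Subtype.ext hyx]

theorem steinbergFamily_root (he : 𝒟.IsBarUnit e) (he' : e ∈ 𝒟.deg 0)
    (third : ∀ i j : Fin m ⊕ Fin n, ∃ p, i ≠ p ∧ j ≠ p) :
    SteinbergFamily 𝒟 e idx (𝒟.sl m n) (𝒟.root m n) where
  bar := he
  even := he'
  mem := by
    intro i j hij α a ha
    change (𝒟.root m n i j a : Matrix (Fin m ⊕ Fin n) (Fin m ⊕ Fin n) D) ∈
      (matrixGrading 𝒟.toSuperGrading m n).deg _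
    rw [coe_root he hij]
    exact single_mem 𝒟.toSuperGrading i j ha
  mul := by
    intro i j k hij hjk hik a b
    apply Subtype.ext
    rw [coe_bracket, coe_root he hij, coe_root he hjk, coe_root he hik,
      𝒟.bracket_single' hik.symm, if_pos rfl]
  mul_swap := by
    intro i j k hij hjk hik α β a b ha hb
    apply Subtype.ext
    rw [coe_bracket, coe_root he hij, coe_root he hjk, 𝒟.bracket_single j k i j hb ha,
      if_neg hik.symm, if_pos rfl, zero_sub, ← coe_root he hik]
    rfl
  zero := by
    intro i j k l hij hkl hjk hil a b
    apply Subtype.ext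
    rw [coe_bracket, coe_root he hij, coe_root he hkl, 𝒟.bracket_single' hil.symm, if_neg hjk]
    rfl
  diag := by
    intro i j hij α a ha
    apply Subtype.ext
    have h : ∀ (s : ℤ) (x : (𝒟.gl m n).commutator),
        ((-(s • x) : (𝒟.gl m n).commutator) : Matrix (Fin m ⊕ Fin n) (Fin m ⊕ Fin n) D)
          = -(s • (x : Matrix (Fin m ⊕ Fin n) (Fin m ⊕ Fin n) D)) := fun s x => rfl
    rw [h, coe_bracket_root_opposite he hij ha he', coe_bracket_root_opposite he hij.symm ha he',
      (he a).1, (he a).2, add_zero, add_zero, add_comm (idx j) (idx i), smul_sub,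
      sgn_smul_sgn_smul, neg_sub]
  span := root_span he he' third

end Superdialgebra

/-! ### The supertrace form -/

namespace Superdialgebra

variable {R D : Type*} [CommRing R] [AddCommGroup D] [Module R D] {m n : ℕ}

/-- The sign `(-1)^(δ (1 + |a|))` of a diagonal entry `a` in the supertrace. -/
noncomputable def twist (A : SuperGrading R D) (δ : ZMod 2) : D →ₗ[R] D :=
  if δ = 0 then LinearMap.id else -A.parity

theorem twist_of_mem (A : SuperGrading R D) (δ : ZMod 2) {α : ZMod 2} {a : D}
    (ha : a ∈ A.deg α) : twist A δ a = sgn δ (1 + α) • a := by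
  rcases two_cases δ with rfl | rfl
  · simp [twist]
  · rw [twist, if_neg (by decide), LinearMap.neg_apply, A.parity_of_mem ha]
    rcases two_cases α with rfl | rfl <;>
      simp [sgn, ZMod.val_one, show (1 + 1 : ZMod 2) = 0 from by decide]

/-- The sign `(-1)^(δ (1 + |a| + |b|))` on `a ⊗ b`. -/
noncomputable def twist₂ (A : SuperGrading R D) (δ : ZMod 2) : D ⊗[R] D →ₗ[R] D ⊗[R] D :=
  if δ = 0 then LinearMap.id else -TensorProduct.map A.parity A.parity

theorem twist₂_tmul (A : SuperGrading R D) (δ : ZMod 2) {α β : ZMod 2} {a b : D}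
    (ha : a ∈ A.deg α) (hb : b ∈ A.deg β) :
    twist₂ A δ (a ⊗ₜ b) = sgn δ (1 + α + β) • (a ⊗ₜ[R] b) := by
  rcases two_cases δ with rfl | rfl
  · simp [twist₂]
  · rw [twist₂, if_neg (by decide), LinearMap.neg_apply, TensorProduct.map_tmul,
      A.parity_of_mem ha, A.parity_of_mem hb]
    rcases two_cases α with rfl | rfl <;> rcases two_cases β with rfl | rfl <;>
      simp [sgn, ZMod.val_one, show (1 + 1 : ZMod 2) = 0 from by decide,
        TensorProduct.neg_tmul, TensorProduct.tmul_neg]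

theorem twist₂_isEven (A : SuperGrading R D) (δ : ZMod 2) :
    IsEven (A.tensor A) (A.tensor A) (twist₂ A δ) := by
  refine isEven_tensor fun i j x hx y hy => ?_
  rw [twist₂_tmul A δ hx hy]
  exact zsmul_mem (tmul_mem hx hy) _

/-- The supertrace, normalised so that the diagonal place `o` has sign `1`. -/
noncomputable def strace (A : SuperGrading R D) (o : Fin m ⊕ Fin n) :
    Matrix (Fin m ⊕ Fin n) (Fin m ⊕ Fin n) D →ₗ[R] D :=
  ∑ i, twist A (idx i + idx o) ∘ₗ Matrix.entryLinearMap R D i i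

/-- The supertrace form `x ⊗ y ↦ ∑ ± x_ik ⊗ y_ki`, normalised so that `i = o` has sign `1`.
It is the generalised trace in Hochschild degree one. -/
noncomputable def traceForm (A : SuperGrading R D) (o : Fin m ⊕ Fin n) :
    Matrix (Fin m ⊕ Fin n) (Fin m ⊕ Fin n) D ⊗[R] Matrix (Fin m ⊕ Fin n) (Fin m ⊕ Fin n) D
      →ₗ[R] D ⊗[R] D :=
  ∑ i, ∑ k, twist₂ A (idx i + idx o) ∘ₗ
    TensorProduct.map (Matrix.entryLinearMap R D i k) (Matrix.entryLinearMap R D k i)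

theorem strace_single (A : SuperGrading R D) (o i j : Fin m ⊕ Fin n) {α : ZMod 2} {a : D}
    (ha : a ∈ A.deg α) : strace A o (Matrix.single i j a)
      = if i = j then sgn (idx i + idx o) (1 + α) • a else 0 := by
  simp only [strace, LinearMap.sum_apply, LinearMap.comp_apply, Matrix.entryLinearMap_apply]
  rw [Finset.sum_eq_single i]
  · by_cases hij : i = j
    · subst hij
      rw [Matrix.single_apply_same, if_pos rfl, twist_of_mem A _ ha]
    · rw [Matrix.single_apply_of_ne _ _ _ _ _ (by tauto), if_neg hij, map_zero]
  · intro k _ hk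
    rw [Matrix.single_apply_of_ne _ _ _ _ _ (by tauto), map_zero]
  · simp

theorem traceForm_single (A : SuperGrading R D) (o i j k l : Fin m ⊕ Fin n) {α β : ZMod 2}
    {a b : D} (ha : a ∈ A.deg α) (hb : b ∈ A.deg β) :
    traceForm A o (Matrix.single i j a ⊗ₜ Matrix.single k l b)
      = if j = k ∧ l = i then sgn (idx i + idx o) (1 + α + β) • (a ⊗ₜ[R] b) else 0 := by
  simp only [traceForm, LinearMap.sum_apply, LinearMap.comp_apply, TensorProduct.map_tmul,
    Matrix.entryLinearMap_apply]
  rw [Finset.sum_eq_single i, Finset.sum_eq_single j]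
  · rw [Matrix.single_apply_same]
    split_ifs with h
    · obtain ⟨rfl, rfl⟩ := h
      rw [Matrix.single_apply_same, twist₂_tmul A _ ha hb]
    · rw [Matrix.single_apply_of_ne _ _ _ _ _ (by tauto), TensorProduct.tmul_zero, map_zero]
  · intro s _ hs
    rw [Matrix.single_apply_of_ne _ _ _ _ _ (by tauto), TensorProduct.zero_tmul, map_zero]
  · simp
  · intro s _ hs
    refine Finset.sum_eq_zero fun t _ => ?_
    rw [Matrix.single_apply_of_ne _ _ _ _ _ (by tauto), TensorProduct.zero_tmul, map_zero]
  · simp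

theorem traceForm_isEven (A : SuperGrading R D) (o : Fin m ⊕ Fin n) :
    IsEven ((matrixGrading A m n).tensor (matrixGrading A m n)) (A.tensor A) (traceForm A o) := by
  refine isEven_tensor fun p q x hx y hy => ?_
  simp only [traceForm, LinearMap.sum_apply, LinearMap.comp_apply, TensorProduct.map_tmul,
    Matrix.entryLinearMap_apply]
  refine sum_mem fun i _ => sum_mem fun k _ => twist₂_isEven A _ _ _ ?_
  have h := tmul_mem (hx i k) (hy k i)
  rwa [show p - idx i - idx k + (q - idx k - idx i) = p + q by
    have h1 : idx k + idx k = 0 := CharTwo.add_self_eq_zero _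
    have h2 : idx i + idx i = 0 := CharTwo.add_self_eq_zero _
    linear_combination -h1 - h2] at h

theorem d₁_traceForm (𝒟 : Superdialgebra R D) (o : Fin m ⊕ Fin n) (t) :
    𝒟.d₁ (traceForm 𝒟.toSuperGrading o t)
      = strace 𝒟.toSuperGrading o ((𝒟.gl m n).δ₂ t) := by
  rw [← sub_eq_zero]
  refine (Submodule.mem_bot R).1 (matrix_tensor_induction 𝒟.toSuperGrading ⊥
    (𝒟.d₁ ∘ₗ traceForm 𝒟.toSuperGrading o - strace 𝒟.toSuperGrading o ∘ₗ (𝒟.gl m n).δ₂) ?_ t)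
  intro i j k l α β a ha b hb
  have hl := 𝒟.left_mem _ _ _ ha _ hb
  have hr := 𝒟.right_mem _ _ _ hb _ ha
  rw [Submodule.mem_bot, LinearMap.sub_apply, sub_eq_zero, LinearMap.comp_apply,
    LinearMap.comp_apply, traceForm_single _ o i j k l ha hb, LeibnizSuperalgebra.δ₂,
    TensorProduct.lift.tmul, 𝒟.bracket_single i j k l ha hb, map_sub, map_zsmul]
  by_cases hjk : j = k
  · subst hjk
    by_cases hli : l = i
    · subst hli
      rw [if_pos ⟨rfl, rfl⟩, if_pos rfl, if_pos rfl, strace_single _ _ _ _ hl,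
        strace_single _ _ _ _ hr, if_pos rfl, if_pos rfl, map_zsmul, 𝒟.d₁_tmul ha hb, smul_sub,
        smul_smul, smul_smul, add_assoc]
      congr 2
      generalize idx l = x, idx j = y, idx o = z
      clear ha hb hl hr
      revert α β x y z
      decide
    · simp [hli, strace_single _ _ _ _ hl, Ne.symm hli]
  · by_cases hli : l = i
    · subst hli
      simp [hjk, strace_single _ _ _ _ hr, Ne.symm hjk]
    · simp [hjk, hli]

theorem traceForm_d₂_mem (𝒟 : Superdialgebra R D) (o : Fin m ⊕ Fin n) (t) :
    traceForm 𝒟.toSuperGrading o ((𝒟.matrix m n).d₂ t) ∈ LinearMap.range 𝒟.d₂ := by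
  refine matrix_tensor_induction₃ 𝒟.toSuperGrading _
    (traceForm 𝒟.toSuperGrading o ∘ₗ (𝒟.matrix m n).d₂) ?_ t
  intro i j k l p q α β γ a ha b hb c hc
  rw [LinearMap.comp_apply, (𝒟.matrix m n).d₂_tmul (single_mem 𝒟.toSuperGrading i j ha)
    (single_mem 𝒟.toSuperGrading k l hb) (single_mem 𝒟.toSuperGrading p q hc), left_single,
    left_single, right_single, map_add, map_sub, map_zsmul]
  by_cases h : j = k ∧ l = p ∧ q = i
  · obtain ⟨rfl, rfl, rfl⟩ := h
    rw [if_pos rfl, if_pos rfl, if_pos rfl,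
      traceForm_single _ _ _ _ _ _ (𝒟.left_mem _ _ _ ha _ hb) hc,
      traceForm_single _ _ _ _ _ _ ha (𝒟.left_mem _ _ _ hb _ hc),
      traceForm_single _ _ _ _ _ _ (𝒟.right_mem _ _ _ hc _ ha) hb, if_pos ⟨rfl, rfl⟩,
      if_pos ⟨rfl, rfl⟩, if_pos ⟨rfl, rfl⟩]
    refine ⟨sgn (idx q + idx o) (1 + α + β + γ) • (a ⊗ₜ (b ⊗ₜ c)), ?_⟩
    rw [map_zsmul, 𝒟.d₂_tmul ha hb hc, smul_add, smul_sub, smul_smul, smul_smul]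
    congr 2
    · congr 2; ring
    · congr 2; ring
    · generalize idx q = x, idx j = y, idx l = z, idx o = w
      clear ha hb hc
      revert α β γ x y z w
      decide
  · have h1 : traceForm 𝒟.toSuperGrading o ((if j = k then Matrix.single i l (𝒟.left a b) else 0)
        ⊗ₜ Matrix.single p q c) = 0 := by
      split_ifs with hjk
      · rw [traceForm_single _ _ _ _ _ _ (𝒟.left_mem _ _ _ ha _ hb) hc, if_neg (by tauto)]
      · rw [TensorProduct.zero_tmul, map_zero]
    have h2 : traceForm 𝒟.toSuperGrading o (Matrix.single i j a ⊗ₜ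
        (if l = p then Matrix.single k q (𝒟.left b c) else 0)) = 0 := by
      split_ifs with hlp
      · rw [traceForm_single _ _ _ _ _ _ ha (𝒟.left_mem _ _ _ hb _ hc), if_neg (by tauto)]
      · rw [TensorProduct.tmul_zero, map_zero]
    have h3 : traceForm 𝒟.toSuperGrading o ((if q = i then Matrix.single p j (𝒟.right c a) else 0)
        ⊗ₜ Matrix.single k l b) = 0 := by
      split_ifs with hqi
      · rw [traceForm_single _ _ _ _ _ _ (𝒟.right_mem _ _ _ hc _ ha) hb, if_neg (by tauto)]
      · rw [TensorProduct.zero_tmul, map_zero]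
    rw [h1, h2, h3, smul_zero, sub_zero, add_zero]
    exact zero_mem _

theorem traceForm_I_mem (𝒟 : Superdialgebra R D) (o : Fin m ⊕ Fin n) {t}
    (ht : t ∈ (𝒟.matrix m n).I) : traceForm 𝒟.toSuperGrading o t ∈ 𝒟.I := by
  rw [I_eq] at ht
  obtain ⟨t, rfl⟩ := ht
  refine matrix_tensor_induction₃ 𝒟.toSuperGrading _ (traceForm 𝒟.toSuperGrading o ∘ₗ
    LinearMap.lTensor _ ((𝒟.matrix m n).lmul - (𝒟.matrix m n).rmul)) ?_ t
  intro i j k l p q α β γ a ha b hb c hc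
  have h : LinearMap.lTensor _ ((𝒟.matrix m n).lmul - (𝒟.matrix m n).rmul)
      (Matrix.single i j a ⊗ₜ (Matrix.single k l b ⊗ₜ Matrix.single p q c))
      = Matrix.single i j a ⊗ₜ[R] (if l = p then Matrix.single k q (𝒟.left b c) else 0)
        - Matrix.single i j a ⊗ₜ[R] (if l = p then Matrix.single k q (𝒟.right b c) else 0) := by
    simp only [LinearMap.lTensor_tmul, LinearMap.sub_apply, lmul, rmul, TensorProduct.lift.tmul,
      TensorProduct.tmul_sub, left_single, right_single]
  rw [LinearMap.comp_apply, h, map_sub]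
  split_ifs with hlp
  · rw [traceForm_single _ _ _ _ _ _ ha (𝒟.left_mem _ _ _ hb _ hc),
      traceForm_single _ _ _ _ _ _ ha (𝒟.right_mem _ _ _ hb _ hc)]
    split_ifs with h'
    · rw [← smul_sub, ← TensorProduct.tmul_sub]
      exact zsmul_mem (𝒟.tmul_left_sub_right_mem_I a b c) _
    · rw [sub_zero]
      exact zero_mem _
  · rw [sub_self]
    exact zero_mem _

/-- The supertrace form is a Leibniz `2`-cocycle with values in `D ⊗ D / (Im d₂ + I)`. -/
theorem traceForm_δ₃_mem (𝒟 : Superdialgebra R D) (o : Fin m ⊕ Fin n) (t) :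
    traceForm 𝒟.toSuperGrading o ((𝒟.gl m n).δ₃ t) ∈ LinearMap.range 𝒟.d₂ ⊔ 𝒟.I := by
  obtain ⟨_, ⟨s, rfl⟩, u, hu, h⟩ := Submodule.mem_sup.1 ((𝒟.matrix m n).δ₃_toLeibniz_mem t)
  change traceForm 𝒟.toSuperGrading o ((𝒟.matrix m n).toLeibniz.δ₃ t) ∈ _
  rw [← h, map_add]
  exact add_mem (Submodule.mem_sup_left (𝒟.traceForm_d₂_mem o s))
    (Submodule.mem_sup_right (𝒟.traceForm_I_mem o hu))

end Superdialgebra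

/-! ### Passing to the commutator subalgebra -/

namespace LeibnizSuperalgebra

variable {R L : Type*} [CommRing R] [AddCommGroup L] [Module R L]

/-- The map `[L, L] ⊗ [L, L] → L ⊗ L` (which need not be injective). -/
noncomputable def incl₂ (𝔏 : LeibnizSuperalgebra R L) :
    𝔏.commutator ⊗[R] 𝔏.commutator →ₗ[R] L ⊗[R] L :=
  TensorProduct.map 𝔏.commutator.subtype 𝔏.commutator.subtype

theorem δ₂_incl₂ (𝔏 : LeibnizSuperalgebra R L) (t) :
    𝔏.δ₂ (𝔏.incl₂ t) = 𝔏.derived.δ₂ t := by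
  induction t using TensorProduct.induction_on with
  | zero => simp
  | add s t hs ht => rw [map_add, map_add, hs, ht, map_add, Submodule.coe_add]
  | tmul x y => rfl

theorem incl₂_δ₃_tmul (𝔏 : LeibnizSuperalgebra R L) {j k : ZMod 2} (x : 𝔏.commutator)
    {y z : 𝔏.commutator} (hy : y ∈ 𝔏.derived.deg j) (hz : z ∈ 𝔏.derived.deg k) :
    𝔏.incl₂ (𝔏.derived.δ₃ (x ⊗ₜ (y ⊗ₜ z))) = -(𝔏.bracket (x : L) y ⊗ₜ[R] (z : L))
      + (x : L) ⊗ₜ[R] 𝔏.bracket (y : L) z + sgn j k • (𝔏.bracket (x : L) z ⊗ₜ[R] (y : L)) := by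
  rw [𝔏.derived.δ₃_tmul x hy hz, map_add, map_add, map_neg, map_zsmul]
  rfl

theorem incl₂_δ₃ (𝔏 : LeibnizSuperalgebra R L) (t) :
    ∃ s, 𝔏.incl₂ (𝔏.derived.δ₃ t) = 𝔏.δ₃ s := by
  refine tensor_induction₃ 𝔏.derived.toSuperGrading 𝔏.derived.toSuperGrading
    𝔏.derived.toSuperGrading (𝔏.incl₂ ∘ₗ 𝔏.derived.δ₃)
    (LinearMap.range 𝔏.δ₃) ?_ t |>.imp fun _ => Eq.symm
  intro i j k x hx y hy z hz
  refine ⟨x.1 ⊗ₜ (y.1 ⊗ₜ z.1), ?_⟩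
  rw [LinearMap.comp_apply, 𝔏.incl₂_δ₃_tmul x hy hz, 𝔏.δ₃_tmul x.1 (y := y.1) (z := z.1) hy hz]

theorem incl₂_isEven (𝔏 : LeibnizSuperalgebra R L) :
    IsEven (𝔏.derived.tensor 𝔏.derived.toSuperGrading) (𝔏.tensor 𝔏.toSuperGrading) 𝔏.incl₂ :=
  isEven_tensor fun _ _ _ hx _ hy => tmul_mem hx hy

end LeibnizSuperalgebra

namespace SuperGrading

variable {R M N P : Type*} [CommRing R] [AddCommGroup M] [Module R M]
  [AddCommGroup N] [Module R N] [AddCommGroup P] [Module R P]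

/-- A criterion for an isomorphism of a subquotient `Z / T` with the direct sum of a subquotient
`Z' / T'` and a supermodule, in terms of representatives. -/
theorem subquotient_iso_prod {A : SuperGrading R M} {B : SuperGrading R N} (C : SuperGrading R P)
    {Z T : Submodule R M} {Z' T' : Submodule R N} (hZ : A.IsHomog Z) (hT : A.IsHomog T)
    (hZ' : B.IsHomog Z') (hT' : B.IsHomog T') (g : M →ₗ[R] N)
    (f : M →ₗ[R] P) (hg : IsEven A B g) (hf : IsEven A C f) (hgZ : ∀ t ∈ Z, g t ∈ Z')
    (hgf : ∀ t ∈ T, g t ∈ T' ∧ f t = 0) (hinj : ∀ t ∈ Z, g t ∈ T' → f t = 0 → t ∈ T)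
    (hsurj : ∀ s ∈ Z', ∀ y, ∃ t ∈ Z, g t - s ∈ T' ∧ f t = y) :
    Iso (A.subquotient Z T hZ hT) ((B.subquotient Z' T' hZ' hT').prod C) := by
  let Φ₀ : Z →ₗ[R] (Z' ⧸ T'.submoduleOf Z') × P :=
    ((T'.submoduleOf Z').mkQ ∘ₗ g.restrict hgZ).prod (f ∘ₗ Z.subtype)
  have hΦ₀ : ∀ t : Z, Φ₀ t = 0 ↔ g t ∈ T' ∧ f t = 0 := by
    intro t
    rw [Prod.ext_iff]
    refine and_congr ?_ Iff.rfl
    change (T'.submoduleOf Z').mkQ (g.restrict hgZ t) = 0 ↔ _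
    rw [Submodule.mkQ_apply, Submodule.Quotient.mk_eq_zero]
    exact Iff.rfl
  have hle : T.submoduleOf Z ≤ LinearMap.ker Φ₀ := by
    intro t ht
    rw [LinearMap.mem_ker, hΦ₀]
    exact hgf t ht
  refine Iso.of_bijective (Submodule.liftQ _ Φ₀ hle) ?_ ⟨?_, ?_⟩
  · rintro i _ ⟨t, ht, rfl⟩
    rw [Submodule.mkQ_apply, Submodule.liftQ_apply]
    exact ⟨⟨g.restrict hgZ t, hg i _ ht, rfl⟩, hf i _ ht⟩
  · rw [injective_iff_map_eq_zero]
    intro u hu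
    obtain ⟨t, rfl⟩ := Submodule.mkQ_surjective _ u
    rw [Submodule.mkQ_apply, Submodule.liftQ_apply, hΦ₀] at hu
    rw [Submodule.mkQ_apply, Submodule.Quotient.mk_eq_zero]
    exact hinj t t.2 hu.1 hu.2
  · rintro ⟨q, y⟩
    obtain ⟨⟨s, hs⟩, rfl⟩ := Submodule.mkQ_surjective _ q
    obtain ⟨t, ht, hts, rfl⟩ := hsurj s hs y
    refine ⟨Submodule.mkQ _ ⟨t, ht⟩, ?_⟩
    rw [Submodule.mkQ_apply, Submodule.liftQ_apply]
    refine Prod.ext ?_ rfl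
    change (T'.submoduleOf Z').mkQ (g.restrict hgZ ⟨t, ht⟩) = (T'.submoduleOf Z').mkQ ⟨s, hs⟩
    rw [← sub_eq_zero, ← map_sub, Submodule.mkQ_apply, Submodule.Quotient.mk_eq_zero]
    exact hts

end SuperGrading

/-! ### Reduction to the pairs of root vectors with vanishing formal product -/

namespace Superdialgebra

variable {R D : Type*} [CommRing R] [AddCommGroup D] [Module R D] {m n : ℕ}

/-- The span of the tensors `E_ij(a) ⊗ E_kl(b)` of root vectors with `j ≠ k` and `i ≠ l`. All
exceptional homology classes come from here. -/
noncomputable def crossed (𝒟 : Superdialgebra R D) (m n : ℕ) :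
    Submodule R ((𝒟.gl m n).commutator ⊗[R] (𝒟.gl m n).commutator) :=
  Submodule.span R {t | ∃ i j k l a b, i ≠ j ∧ k ≠ l ∧ j ≠ k ∧ i ≠ l ∧
    t = 𝒟.root m n i j a ⊗ₜ[R] 𝒟.root m n k l b}

variable {𝒟 : Superdialgebra R D} {e : D}

theorem tmul_root_mem_crossed {i j k l : Fin m ⊕ Fin n} (hij : i ≠ j) (hkl : k ≠ l) (hjk : j ≠ k)
    (hil : i ≠ l) (a b : D) : 𝒟.root m n i j a ⊗ₜ[R] 𝒟.root m n k l b ∈ 𝒟.crossed m n :=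
  Submodule.subset_span ⟨i, j, k, l, a, b, hij, hkl, hjk, hil, rfl⟩

theorem δ₂_of_mem_crossed (S : SteinbergFamily 𝒟 e idx (𝒟.sl m n) (𝒟.root m n)) {t}
    (ht : t ∈ 𝒟.crossed m n) : (𝒟.sl m n).δ₂ t = 0 := by
  have h : 𝒟.crossed m n ≤ LinearMap.ker (𝒟.sl m n).δ₂ := by
    refine Submodule.span_le.2 ?_
    rintro _ ⟨i, j, k, l, a, b, hij, hkl, hjk, hil, rfl⟩
    exact S.zero hij hkl hjk hil a b
  exact h ht

theorem incl₂_tmul_root (he : 𝒟.IsBarUnit e) {i j k l : Fin m ⊕ Fin n} (hij : i ≠ j)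
    (hkl : k ≠ l) (a b : D) :
    (𝒟.gl m n).incl₂ (𝒟.root m n i j a ⊗ₜ 𝒟.root m n k l b)
      = Matrix.single i j a ⊗ₜ[R] Matrix.single k l b := by
  rw [LeibnizSuperalgebra.incl₂, TensorProduct.map_tmul, Submodule.subtype_apply,
    Submodule.subtype_apply, coe_root he hij, coe_root he hkl]

theorem traceForm_incl₂_of_mem_crossed (he : 𝒟.IsBarUnit e) (o : Fin m ⊕ Fin n) {t}
    (ht : t ∈ 𝒟.crossed m n) : traceForm 𝒟.toSuperGrading o ((𝒟.gl m n).incl₂ t) = 0 := by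
  have h : 𝒟.crossed m n ≤
      LinearMap.ker (traceForm 𝒟.toSuperGrading o ∘ₗ (𝒟.gl m n).incl₂) := by
    refine Submodule.span_le.2 ?_
    rintro _ ⟨i, j, k, l, a, b, hij, hkl, hjk, hil, rfl⟩
    change traceForm 𝒟.toSuperGrading o ((𝒟.gl m n).incl₂ _) = 0
    rw [incl₂_tmul_root he hij hkl]
    induction a using 𝒟.induction with
    | hadd x y hx hy => rw [Matrix.single_add, TensorProduct.add_tmul, map_add, hx, hy, add_zero]
    | hom α a ha =>
      induction b using 𝒟.induction with
      | hadd x y hx hy => rw [Matrix.single_add, TensorProduct.tmul_add, map_add, hx, hy, add_zero]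
      | hom β b hb => rw [traceForm_single _ _ _ _ _ _ ha hb, if_neg (by tauto)]
  exact h ht

/-- The Leibniz boundary of `handle` is the Hochschild boundary, placed at `(o, o)`. -/
theorem δ₂_handle (he : 𝒟.IsBarUnit e) (he' : e ∈ 𝒟.deg 0) {o k : Fin m ⊕ Fin n} (hok : o ≠ k)
    (t : D ⊗[R] D) :
    (((𝒟.sl m n).δ₂ (handle 𝒟 e (𝒟.root m n) o k t) : (𝒟.gl m n).commutator) :
      Matrix (Fin m ⊕ Fin n) (Fin m ⊕ Fin n) D) = Matrix.single o o (𝒟.d₁ t) := by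
  rw [← sub_eq_zero]
  refine (Submodule.mem_bot R).1 (tensor_induction 𝒟.toSuperGrading 𝒟.toSuperGrading
    ((𝒟.gl m n).commutator.subtype ∘ₗ (𝒟.sl m n).δ₂ ∘ₗ handle 𝒟 e (𝒟.root m n) o k
      - Matrix.singleLinearMap R o o ∘ₗ 𝒟.d₁) ⊥ ?_ t)
  intro α β a ha b hb
  rw [Submodule.mem_bot, LinearMap.sub_apply, sub_eq_zero]
  simp only [handle, LinearMap.comp_apply, LinearMap.sub_apply, LinearMap.id_apply,
    𝒟.flip_tmul ha hb, map_zsmul, Superdialgebra.rmul, TensorProduct.lift.tmul, map_sub,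
    LinearMap.flip_apply, TensorProduct.mk_apply, TensorProduct.map_tmul,
    LeibnizSuperalgebra.δ₂, Submodule.subtype_apply, 𝒟.d₁_tmul ha hb,
    Matrix.singleLinearMap_apply]
  rw [coe_bracket_root_opposite he hok ha hb,
    coe_bracket_root_opposite he hok (𝒟.right_mem _ _ _ hb _ ha) he', (he _).1, (he _).2,
    smul_sub, smul_smul]
  have h : sgn α β * sgn (idx o + idx k + (β + α)) (idx o + idx k + 0)
      = sgn (idx o + idx k + α) (idx o + idx k + β) := by
    generalize idx o + idx k = x
    clear ha hb
    revert α β x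
    decide
  rw [h, sub_sub_sub_cancel_right]

theorem tmul_unit_mem_range_d₂ (he : 𝒟.IsBarUnit e) (he' : e ∈ 𝒟.deg 0) (a : D) :
    a ⊗ₜ[R] e ∈ LinearMap.range 𝒟.d₂ := by
  induction a using 𝒟.induction with
  | hadd x y hx hy => rw [TensorProduct.add_tmul]; exact add_mem hx hy
  | hom α a ha =>
    refine ⟨a ⊗ₜ (e ⊗ₜ e), ?_⟩
    rw [𝒟.d₂_tmul ha he' he', (he a).1, (he a).2, (he e).1, sgn_zero_left, one_smul, sub_self,
      zero_add]

theorem traceForm_tmul_root (he : 𝒟.IsBarUnit e) {o k : Fin m ⊕ Fin n} (hok : o ≠ k)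
    (t : D ⊗[R] D) : traceForm 𝒟.toSuperGrading o ((𝒟.gl m n).incl₂
      (TensorProduct.map (𝒟.root m n o k) (𝒟.root m n k o) t)) = t := by
  rw [← sub_eq_zero]
  refine (Submodule.mem_bot R).1 (tensor_induction 𝒟.toSuperGrading 𝒟.toSuperGrading
    (traceForm 𝒟.toSuperGrading o ∘ₗ (𝒟.gl m n).incl₂ ∘ₗ
      TensorProduct.map (𝒟.root m n o k) (𝒟.root m n k o) - LinearMap.id) ⊥ ?_ t)
  intro α β a ha b hb
  rw [Submodule.mem_bot, LinearMap.sub_apply, LinearMap.comp_apply, LinearMap.comp_apply,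
    TensorProduct.map_tmul, incl₂_tmul_root he hok hok.symm, traceForm_single _ _ _ _ _ _ ha hb,
    if_pos ⟨rfl, rfl⟩, CharTwo.add_self_eq_zero, sgn_zero_left, one_smul, LinearMap.id_apply,
    sub_self]

/-- On `handle`, the supertrace form is the identity up to boundaries. -/
theorem traceForm_handle_sub_mem (he : 𝒟.IsBarUnit e) (he' : e ∈ 𝒟.deg 0) {o k : Fin m ⊕ Fin n}
    (hok : o ≠ k) (t : D ⊗[R] D) : t - traceForm 𝒟.toSuperGrading o ((𝒟.gl m n).incl₂
      (handle 𝒟 e (𝒟.root m n) o k t)) ∈ LinearMap.range 𝒟.d₂ ⊔ 𝒟.I := by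
  rw [handle, LinearMap.comp_apply, traceForm_tmul_root he hok, LinearMap.sub_apply,
    LinearMap.id_apply, sub_sub_cancel]
  exact Submodule.mem_sup_left (tmul_unit_mem_range_d₂ he he' _)

/-- A root vector for every root `(k, j)`, in the form `E_kl(c) ⊗ E_lj(1)` with
`l = mid k j`. -/
noncomputable def rootPart (𝒟 : Superdialgebra R D) (e : D)
    (mid : Fin m ⊕ Fin n → Fin m ⊕ Fin n → Fin m ⊕ Fin n) :
    Matrix (Fin m ⊕ Fin n) (Fin m ⊕ Fin n) D →ₗ[R]
      (𝒟.gl m n).commutator ⊗[R] (𝒟.gl m n).commutator :=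
  ∑ k, ∑ j, if k = j then 0 else
    (TensorProduct.mk R _ _).flip (𝒟.root m n (mid k j) j e) ∘ₗ 𝒟.root m n k (mid k j) ∘ₗ
      Matrix.entryLinearMap R D k j

/-- The diagonal elements `E_ok(d_k) ⊗ E_ko(1)` for `k ≠ o`. -/
noncomputable def diagPart (𝒟 : Superdialgebra R D) (e : D) (o : Fin m ⊕ Fin n) :
    (Fin m ⊕ Fin n → D) →ₗ[R] (𝒟.gl m n).commutator ⊗[R] (𝒟.gl m n).commutator :=
  ∑ k, if o = k then 0 else
    (TensorProduct.mk R _ _).flip (𝒟.root m n k o e) ∘ₗ 𝒟.root m n o k ∘ₗ LinearMap.proj k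

theorem rootPart_apply (mid : Fin m ⊕ Fin n → Fin m ⊕ Fin n → Fin m ⊕ Fin n) (c) :
    rootPart 𝒟 e mid c = ∑ k, ∑ j, if k = j then 0 else
      𝒟.root m n k (mid k j) (c k j) ⊗ₜ[R] 𝒟.root m n (mid k j) j e := by
  simp only [rootPart, LinearMap.sum_apply]
  refine Finset.sum_congr rfl fun k _ => Finset.sum_congr rfl fun j _ => ?_
  split_ifs <;> rfl

theorem diagPart_apply (o : Fin m ⊕ Fin n) (d) :
    diagPart 𝒟 e o d = ∑ k, if o = k then 0 else
      𝒟.root m n o k (d k) ⊗ₜ[R] 𝒟.root m n k o e := by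
  simp only [diagPart, LinearMap.sum_apply]
  refine Finset.sum_congr rfl fun k _ => ?_
  split_ifs <;> rfl

theorem δ₂_rootPart (he : 𝒟.IsBarUnit e)
    {mid : Fin m ⊕ Fin n → Fin m ⊕ Fin n → Fin m ⊕ Fin n}
    (h : ∀ k j, k ≠ j → k ≠ mid k j ∧ mid k j ≠ j) (c) :
    (((𝒟.sl m n).δ₂ (rootPart 𝒟 e mid c) : (𝒟.gl m n).commutator) :
      Matrix (Fin m ⊕ Fin n) (Fin m ⊕ Fin n) D)
      = ∑ k, ∑ j, if k = j then 0 else Matrix.single k j (c k j) := by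
  rw [rootPart_apply, map_sum, Submodule.coe_sum]
  refine Finset.sum_congr rfl fun k _ => ?_
  rw [map_sum, Submodule.coe_sum]
  refine Finset.sum_congr rfl fun j _ => ?_
  split_ifs with hkj
  · rw [map_zero]
    rfl
  · obtain ⟨h1, h2⟩ := h k j hkj
    rw [LeibnizSuperalgebra.δ₂, TensorProduct.lift.tmul, coe_bracket, coe_root he h1,
      coe_root he h2, 𝒟.bracket_single' (Ne.symm hkj), if_pos rfl, (he _).1]

/-- The diagonal sign operator `d ↦ ∓ d` of the lower entry of `[E_ok(d), E_ko(1)]`. -/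
noncomputable def lowerEntry (𝒟 : Superdialgebra R D) (δ : ZMod 2) : D →ₗ[R] D :=
  -(sgn δ δ • 𝒟.proj 0 + sgn (δ + 1) δ • 𝒟.proj 1)

theorem lowerEntry_of_mem (δ : ZMod 2) {α : ZMod 2} {a : D} (ha : a ∈ 𝒟.deg α) :
    lowerEntry 𝒟 δ a = -(sgn (δ + α) δ • a) := by
  simp only [lowerEntry, LinearMap.neg_apply, LinearMap.add_apply, LinearMap.smul_apply,
    𝒟.proj_of_mem ha]
  rcases two_cases α with rfl | rfl <;> simp

theorem lowerEntry_eq_zero {δ : ZMod 2} {a : D} (h : lowerEntry 𝒟 δ a = 0) : a = 0 := by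
  have key : ∀ a, lowerEntry 𝒟 δ (lowerEntry 𝒟 δ a) = a := by
    intro a
    induction a using 𝒟.induction with
    | hadd x y hx hy => rw [map_add, map_add, hx, hy]
    | hom α a ha =>
      rw [lowerEntry_of_mem δ ha, map_neg, map_zsmul, lowerEntry_of_mem δ ha, smul_neg, neg_neg,
        sgn_smul_sgn_smul]
  rw [← key a, h, map_zero]

theorem δ₂_diagPart (he : 𝒟.IsBarUnit e) (he' : e ∈ 𝒟.deg 0) (o : Fin m ⊕ Fin n) (d) :
    (((𝒟.sl m n).δ₂ (diagPart 𝒟 e o d) : (𝒟.gl m n).commutator) :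
      Matrix (Fin m ⊕ Fin n) (Fin m ⊕ Fin n) D)
      = ∑ k, if o = k then 0 else
        Matrix.single o o (d k) + Matrix.single k k (lowerEntry 𝒟 (idx o + idx k) (d k)) := by
  rw [diagPart_apply, map_sum, Submodule.coe_sum]
  refine Finset.sum_congr rfl fun k _ => ?_
  split_ifs with hok
  · rw [map_zero]
    rfl
  · generalize d k = a
    induction a using 𝒟.induction with
    | hadd x y hx hy =>
      rw [map_add, TensorProduct.add_tmul, map_add, Submodule.coe_add, hx, hy, map_add,
        Matrix.single_add, Matrix.single_add]
      abel
    | hom α a ha =>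
      rw [LeibnizSuperalgebra.δ₂, TensorProduct.lift.tmul, coe_bracket_root_opposite he hok ha he',
        (he a).1, (he a).2, lowerEntry_of_mem _ ha, add_zero, sub_eq_add_neg]
      congr 1
      rw [← Matrix.singleLinearMap_apply (R := R), ← Matrix.singleLinearMap_apply (R := R),
        map_neg, map_zsmul]

/-- Every chain of `sl(m, n, D)` is, up to a boundary, the sum of a root part, a diagonal part,
a `handle` and a crossed part. -/
theorem exists_normalForm (S : SteinbergFamily 𝒟 e idx (𝒟.sl m n) (𝒟.root m n))
    (third : ∀ i j : Fin m ⊕ Fin n, ∃ p, i ≠ p ∧ j ≠ p) {o k₀ : Fin m ⊕ Fin n} (hk₀ : o ≠ k₀)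
    {mid : Fin m ⊕ Fin n → Fin m ⊕ Fin n → Fin m ⊕ Fin n}
    (hmid : ∀ k j, k ≠ j → k ≠ mid k j ∧ mid k j ≠ j) (t) :
    ∃ c d s, ∃ x ∈ 𝒟.crossed m n, ∃ r, t = rootPart 𝒟 e mid c + diagPart 𝒟 e o d
      + handle 𝒟 e (𝒟.root m n) o k₀ s + x + (𝒟.sl m n).δ₃ r := by
  let V := LinearMap.range (rootPart 𝒟 e mid) ⊔ LinearMap.range (diagPart 𝒟 e o)
    ⊔ LinearMap.range (handle 𝒟 e (𝒟.root m n) o k₀) ⊔ 𝒟.crossed m n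
  have hV : ∀ {v}, v ∈ V → (LinearMap.range (𝒟.sl m n).δ₃).mkQ v
      ∈ V.map (LinearMap.range (𝒟.sl m n).δ₃).mkQ := fun hv => Submodule.mem_map_of_mem hv
  have key : ∀ x y, (𝒟.sl m n).cls x y ∈ V.map (LinearMap.range (𝒟.sl m n).δ₃).mkQ := by
    refine S.cls_mem hk₀ third ?_ ?_ ?_ ?_
    · intro k j hkj
      refine ⟨mid k j, (hmid k j hkj).1, (hmid k j hkj).2, fun c => hV ?_⟩
      refine Submodule.mem_sup_left (Submodule.mem_sup_left (Submodule.mem_sup_left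
        ⟨Matrix.single k j c, ?_⟩))
      rw [rootPart_apply, Finset.sum_eq_single k, Finset.sum_eq_single j, if_neg hkj,
        Matrix.single_apply_same]
      · rfl
      · intro q _ hq
        rw [Matrix.single_apply_of_ne _ _ _ _ _ (by tauto), map_zero, TensorProduct.zero_tmul,
          ite_self]
      · simp
      · intro p _ hp
        refine Finset.sum_eq_zero fun q _ => ?_
        rw [Matrix.single_apply_of_ne _ _ _ _ _ (by tauto), map_zero, TensorProduct.zero_tmul,
          ite_self]
      · simp
    · intro k hk c
      refine hV (Submodule.mem_sup_left (Submodule.mem_sup_left (Submodule.mem_sup_right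
        ⟨Pi.single k c, ?_⟩)))
      rw [diagPart_apply, Finset.sum_eq_single k, if_neg hk, Pi.single_eq_same]
      · rfl
      · intro q _ hq
        rw [Pi.single_eq_of_ne hq, map_zero, TensorProduct.zero_tmul, ite_self]
      · simp
    · intro s
      exact hV (Submodule.mem_sup_left (Submodule.mem_sup_right ⟨s, rfl⟩))
    · intro i j k l hij hkl hjk hil a b
      exact hV (Submodule.mem_sup_right (tmul_root_mem_crossed hij hkl hjk hil a b))
  have ht : (LinearMap.range (𝒟.sl m n).δ₃).mkQ t
      ∈ V.map (LinearMap.range (𝒟.sl m n).δ₃).mkQ := by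
    induction t using TensorProduct.induction_on with
    | zero => simp
    | add s t hs ht => rw [map_add]; exact add_mem hs ht
    | tmul x y => exact key x y
  obtain ⟨v, hv, hvt⟩ := ht
  obtain ⟨y, hy, x, hx, rfl⟩ := Submodule.mem_sup.1 hv
  obtain ⟨z, hz, _, ⟨s, rfl⟩, rfl⟩ := Submodule.mem_sup.1 hy
  obtain ⟨_, ⟨c, rfl⟩, _, ⟨d, rfl⟩, rfl⟩ := Submodule.mem_sup.1 hz
  rw [eq_comm, ← sub_eq_zero, ← map_sub, Submodule.mkQ_apply, Submodule.Quotient.mk_eq_zero] at hvt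
  obtain ⟨r, hr⟩ := hvt
  exact ⟨c, d, s, x, hx, r, by rw [hr]; abel⟩

/-- Cycles of `sl(m, n, D)` are homologous to the sum of a `handle` and a crossed part. -/
theorem exists_normalForm_of_cycle (S : SteinbergFamily 𝒟 e idx (𝒟.sl m n) (𝒟.root m n))
    (third : ∀ i j : Fin m ⊕ Fin n, ∃ p, i ≠ p ∧ j ≠ p) {o k₀ : Fin m ⊕ Fin n} (hk₀ : o ≠ k₀)
    {t} (ht : (𝒟.sl m n).δ₂ t = 0) :
    ∃ s, ∃ x ∈ 𝒟.crossed m n, ∃ r,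
      t = handle 𝒟 e (𝒟.root m n) o k₀ s + x + (𝒟.sl m n).δ₃ r := by
  choose mid hmid using third
  have hmid' : ∀ k j, k ≠ j → k ≠ mid k j ∧ mid k j ≠ j :=
    fun k j _ => ⟨(hmid k j).1, (hmid k j).2.symm⟩
  obtain ⟨c, d, s, x, hx, r, rfl⟩ :=
    exists_normalForm S (fun i j => ⟨mid i j, hmid i j⟩) hk₀ hmid' t
  rw [map_add, map_add, map_add, map_add, (𝒟.sl m n).δ₂_δ₃, δ₂_of_mem_crossed S hx, add_zero,
    add_zero] at ht
  have ht' := congrArg (fun y : (𝒟.gl m n).commutator =>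
    (y : Matrix (Fin m ⊕ Fin n) (Fin m ⊕ Fin n) D)) ht
  simp only [Submodule.coe_add, δ₂_rootPart S.bar hmid', δ₂_diagPart S.bar S.even,
    δ₂_handle S.bar S.even hk₀, Submodule.coe_zero] at ht'
  -- the off-diagonal entries of the boundary only see the root part
  have hc : ∀ p q, p ≠ q → c p q = 0 := by
    intro p q hpq
    have h := congrFun (congrFun ht' p) q
    simp only [Matrix.add_apply, Matrix.sum_apply, Matrix.zero_apply] at h
    rw [Finset.sum_eq_single p, Finset.sum_eq_single q, if_neg hpq, Matrix.single_apply_same,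
      Matrix.single_apply_of_ne _ _ _ _ _ (by rintro ⟨rfl, rfl⟩; exact hpq rfl), add_zero,
      Finset.sum_eq_zero, add_zero] at h
    · exact h
    · intro k _
      split_ifs
      · rfl
      · rw [Matrix.add_apply, Matrix.single_apply_of_ne _ _ _ _ _
          (by rintro ⟨rfl, rfl⟩; exact hpq rfl), Matrix.single_apply_of_ne _ _ _ _ _
          (by rintro ⟨rfl, rfl⟩; exact hpq rfl), add_zero]
    · intro j _ hj
      split_ifs
      · rfl
      · exact Matrix.single_apply_of_ne _ _ _ _ _ (by tauto)
    · simp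
    · intro k _ hk
      refine Finset.sum_eq_zero fun j _ => ?_
      split_ifs
      · rfl
      · exact Matrix.single_apply_of_ne _ _ _ _ _ (by tauto)
    · simp
  -- the diagonal entries at `k ≠ o` only see the diagonal part
  have hd : ∀ k, o ≠ k → d k = 0 := by
    intro k hk
    have h := congrFun (congrFun ht' k) k
    simp only [Matrix.add_apply, Matrix.sum_apply, Matrix.zero_apply] at h
    rw [Finset.sum_eq_zero, zero_add, Finset.sum_eq_single k, if_neg hk, Matrix.add_apply,
      Matrix.single_apply_same, Matrix.single_apply_of_ne _ _ _ _ _ (by tauto),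
      Matrix.single_apply_of_ne _ _ _ _ _ (by tauto), zero_add, add_zero] at h
    · exact lowerEntry_eq_zero h
    · intro j _ hj
      split_ifs
      · rfl
      · rw [Matrix.add_apply, Matrix.single_apply_of_ne _ _ _ _ _ (by tauto),
          Matrix.single_apply_of_ne _ _ _ _ _ (by tauto), add_zero]
    · simp
    · intro p _
      refine Finset.sum_eq_zero fun q _ => ?_
      split_ifs with hpq
      · rfl
      · exact Matrix.single_apply_of_ne _ _ _ _ _ (by rintro ⟨rfl, rfl⟩; exact hpq rfl)
  have hF : rootPart 𝒟 e mid c = 0 := by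
    rw [rootPart_apply]
    refine Finset.sum_eq_zero fun k _ => Finset.sum_eq_zero fun j _ => ?_
    split_ifs with hkj
    · rfl
    · rw [hc k j hkj, map_zero, TensorProduct.zero_tmul]
  have hG : diagPart 𝒟 e o d = 0 := by
    rw [diagPart_apply]
    refine Finset.sum_eq_zero fun k _ => ?_
    split_ifs with hk
    · rfl
    · rw [hd k hk, map_zero, TensorProduct.zero_tmul]
  exact ⟨s, x, hx, r, by rw [hF, hG, zero_add, zero_add]⟩

/-- If an even cocycle `f` with values in `M` identifies the crossed classes with `M`, then together
with the supertrace form it identifies `HL₂(sl(m, n, D))` with `HHS₁(D) ⊕ M`. -/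
theorem iso_of_crossed {M : Type*} [AddCommGroup M] [Module R M] (𝓜 : SuperGrading R M)
    (S : SteinbergFamily 𝒟 e idx (𝒟.sl m n) (𝒟.root m n))
    (third : ∀ i j : Fin m ⊕ Fin n, ∃ p, i ≠ p ∧ j ≠ p) {o k₀ : Fin m ⊕ Fin n} (hk₀ : o ≠ k₀)
    (f : (𝒟.gl m n).commutator ⊗[R] (𝒟.gl m n).commutator →ₗ[R] M)
    (hf : IsEven ((𝒟.sl m n).tensor (𝒟.sl m n).toSuperGrading) 𝓜 f)
    (hfδ : ∀ t, f ((𝒟.sl m n).δ₃ t) = 0)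
    (hfH : ∀ i j, i ≠ j → ∀ a b, f (𝒟.root m n i j a ⊗ₜ 𝒟.root m n j i b) = 0)
    (hsurj : ∀ y, ∃ t ∈ 𝒟.crossed m n, f t = y)
    (hinj : ∀ t ∈ 𝒟.crossed m n, f t = 0 → t ∈ LinearMap.range (𝒟.sl m n).δ₃) :
    (𝒟.sl m n).gradingHL₂.Iso (𝒟.gradingHHS₁.prod 𝓜) := by
  have he := S.bar
  have he' := S.even
  let Ω := traceForm 𝒟.toSuperGrading o ∘ₗ (𝒟.gl m n).incl₂
  have hΩker : ∀ t ∈ LinearMap.ker (𝒟.sl m n).δ₂, Ω t ∈ LinearMap.ker 𝒟.d₁ := by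
    intro t ht
    rw [LinearMap.mem_ker] at ht ⊢
    change 𝒟.d₁ (traceForm 𝒟.toSuperGrading o ((𝒟.gl m n).incl₂ t)) = 0
    rw [𝒟.d₁_traceForm, LeibnizSuperalgebra.δ₂_incl₂]
    change strace 𝒟.toSuperGrading o ((𝒟.sl m n).δ₂ t : (𝒟.gl m n).commutator) = 0
    rw [ht, Submodule.coe_zero, map_zero]
  have hΩδ : ∀ t, Ω ((𝒟.sl m n).δ₃ t) ∈ LinearMap.range 𝒟.d₂ ⊔ 𝒟.I := by
    intro t
    obtain ⟨s, hs⟩ := (𝒟.gl m n).incl₂_δ₃ t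
    change traceForm 𝒟.toSuperGrading o ((𝒟.gl m n).incl₂ ((𝒟.gl m n).derived.δ₃ t)) ∈ _
    rw [hs]
    exact 𝒟.traceForm_δ₃_mem o s
  have hΩeven : IsEven ((𝒟.sl m n).tensor (𝒟.sl m n).toSuperGrading)
      (𝒟.tensor 𝒟.toSuperGrading) Ω :=
    (traceForm_isEven 𝒟.toSuperGrading o).comp (𝒟.gl m n).incl₂_isEven
  have hfh : ∀ s, f (handle 𝒟 e (𝒟.root m n) o k₀ s) = 0 := by
    intro s
    rw [handle, LinearMap.comp_apply]
    generalize (LinearMap.id - (TensorProduct.mk R D D).flip e ∘ₗ 𝒟.rmul ∘ₗ 𝒟.flip :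
      D ⊗[R] D →ₗ[R] D ⊗[R] D) s = t
    induction t using TensorProduct.induction_on with
    | zero => simp
    | add s t hs ht => rw [map_add, map_add, hs, ht, add_zero]
    | tmul a b => exact hfH o k₀ hk₀ a b
  have hΩx : ∀ x ∈ 𝒟.crossed m n, Ω x = 0 := fun x hx => traceForm_incl₂_of_mem_crossed he o hx
  refine subquotient_iso_prod 𝓜 _ _ _ _ Ω f hΩeven hf hΩker ?_ ?_ ?_
  · rintro _ ⟨r, rfl⟩
    exact ⟨hΩδ r, hfδ r⟩
  · intro t ht hu₁ hu₂
    obtain ⟨s, x, hx, r, rfl⟩ := exists_normalForm_of_cycle S third hk₀ ht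
    rw [map_add, map_add, hfh, hfδ, zero_add, add_zero] at hu₂
    rw [map_add, map_add, hΩx x hx, add_zero] at hu₁
    have hs : s ∈ LinearMap.range 𝒟.d₂ ⊔ 𝒟.I := by
      have h := add_mem (traceForm_handle_sub_mem he he' hk₀ s) (sub_mem hu₁ (hΩδ r))
      rwa [add_sub_cancel_right, LinearMap.comp_apply, sub_add_cancel] at h
    obtain ⟨p, hop, hkp⟩ := third o k₀
    exact add_mem (add_mem (S.handle_mem_range hk₀ hop hkp hs) (hinj x hx hu₂)) ⟨r, rfl⟩
  · intro s hs y
    obtain ⟨x, hx, rfl⟩ := hsurj y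
    refine ⟨handle 𝒟 e (𝒟.root m n) o k₀ s + x, ?_, ?_, ?_⟩
    · rw [LinearMap.mem_ker, map_add, δ₂_of_mem_crossed S hx, add_zero]
      apply Subtype.ext
      rw [δ₂_handle he he' hk₀, LinearMap.mem_ker.1 hs, Matrix.single_zero]
      rfl
    · rw [map_add, hΩx x hx, add_zero, ← neg_mem_iff, neg_sub]
      exact traceForm_handle_sub_mem he he' hk₀ s
    · rw [map_add, hfh, zero_add]

end Superdialgebra

/-! ### The quotients `D_N` -/

namespace Superdialgebra

variable {R D : Type*} [CommRing R] [AddCommGroup D] [Module R D] {m n : ℕ}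

theorem isIdeal_idealI (𝒟 : Superdialgebra R D) (N : ℕ) : 𝒟.IsIdeal (𝒟.idealI N) := by
  intro x y h
  have h' : ∀ J ∈ {J | 𝒟.IsIdeal J ∧ (∀ a, N • a ∈ J) ∧
      ∀ i j, ∀ a ∈ 𝒟.deg i, ∀ b ∈ 𝒟.deg j, 𝒟.left a b - sgn i j • 𝒟.right b a ∈ J},
      𝒟.left x y ∈ J ∧ 𝒟.right x y ∈ J := fun J hJ =>
    hJ.1 x y (h.imp (fun h => Submodule.mem_sInf.1 h J hJ) fun h => Submodule.mem_sInf.1 h J hJ)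
  exact ⟨Submodule.mem_sInf.2 fun J hJ => (h' J hJ).1, Submodule.mem_sInf.2 fun J hJ => (h' J hJ).2⟩

theorem nsmul_quo (𝒟 : Superdialgebra R D) (N : ℕ) (x : 𝒟.Quo N) : N • x = 0 := by
  obtain ⟨a, rfl⟩ := Submodule.mkQ_surjective _ x
  rw [← map_nsmul, Submodule.mkQ_apply, Submodule.Quotient.mk_eq_zero]
  exact Submodule.mem_sInf.2 fun J hJ => hJ.2.1 a

theorem mkQ_left (𝒟 : Superdialgebra R D) (N : ℕ) {α β : ZMod 2} {a b : D} (ha : a ∈ 𝒟.deg α)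
    (hb : b ∈ 𝒟.deg β) :
    (𝒟.idealI N).mkQ (𝒟.left a b) = sgn α β • (𝒟.idealI N).mkQ (𝒟.right b a) := by
  rw [← sub_eq_zero, ← map_zsmul, ← map_sub, Submodule.mkQ_apply, Submodule.Quotient.mk_eq_zero]
  exact Submodule.mem_sInf.2 fun J hJ => hJ.2.2 _ _ _ ha _ hb

theorem mkQ_d₁ (𝒟 : Superdialgebra R D) (N : ℕ) (t : D ⊗[R] D) :
    (𝒟.idealI N).mkQ (𝒟.d₁ t) = 0 := by
  refine (Submodule.mem_bot R).1 (tensor_induction 𝒟.toSuperGrading 𝒟.toSuperGrading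
    ((𝒟.idealI N).mkQ ∘ₗ 𝒟.d₁) ⊥ ?_ t)
  intro α β a ha b hb
  rw [Submodule.mem_bot, LinearMap.comp_apply, 𝒟.d₁_tmul ha hb, map_sub, map_zsmul,
    𝒟.mkQ_left N ha hb, sub_self]

/-- A linear map kills `I_N` as soon as it is a trace which is invariant under permutations of all
factors but the first and takes `N`-torsion values. -/
theorem idealI_le_ker {M : Type*} [AddCommGroup M] [Module R M] (𝒟 : Superdialgebra R D) {e : D}
    (he : 𝒟.IsBarUnit e) (he' : e ∈ 𝒟.deg 0) (N : ℕ) (g : D →ₗ[R] M)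
    (htr : ∀ {α β a b}, a ∈ 𝒟.deg α → b ∈ 𝒟.deg β →
      g (𝒟.left a b) = sgn α β • g (𝒟.right b a))
    (hperm : ∀ {α β γ a b c}, a ∈ 𝒟.deg α → b ∈ 𝒟.deg β → c ∈ 𝒟.deg γ →
      g (𝒟.left (𝒟.left a b) c) = sgn β γ • g (𝒟.left (𝒟.left a c) b))
    (hN : ∀ a, N • g a = 0) : 𝒟.idealI N ≤ LinearMap.ker g := by
  -- the elements all of whose multiples, with the centre anywhere, are killed by `g`
  let P : D → Prop := fun z => (∀ γ, ∀ c ∈ 𝒟.deg γ, g (𝒟.left z c) = 0) ∧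
    ∀ ξ γ, ∀ x ∈ 𝒟.deg ξ, ∀ c ∈ 𝒟.deg γ, g (𝒟.left (𝒟.left x z) c) = 0
  have P0 : P 0 := ⟨by simp, by simp⟩
  let J : Submodule R D :=
    { carrier := {z | ∀ i, P (𝒟.proj i z)}
      zero_mem' := fun i => by rw [map_zero]; exact P0
      add_mem' := fun {y z} hy hz i => by
        rw [map_add]
        exact ⟨fun γ c hc => by simp [(hy i).1 γ c hc, (hz i).1 γ c hc],
          fun ξ γ x hx c hc => by simp [(hy i).2 ξ γ x hx c hc, (hz i).2 ξ γ x hx c hc]⟩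
      smul_mem' := fun r z hz i => by
        rw [map_smul]
        exact ⟨fun γ c hc => by simp [(hz i).1 γ c hc],
          fun ξ γ x hx c hc => by simp [(hz i).2 ξ γ x hx c hc]⟩ }
  have hhom : ∀ {i z}, z ∈ 𝒟.deg i → P z → z ∈ J := by
    intro i z hz hPz j
    rw [𝒟.proj_of_mem hz]
    split_ifs
    · exact hPz
    · exact P0
  have hleft : ∀ {i j d y}, d ∈ 𝒟.deg i → y ∈ 𝒟.deg j → P d ∨ P y →
      P (𝒟.left d y) ∧ P (𝒟.right d y) := by
    intro i j d y hd hy h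
    rcases h with h | h
    · refine ⟨⟨?_, ?_⟩, ?_, ?_⟩
      · intro γ c hc
        rw [𝒟.left_assoc]
        exact h.1 _ _ (𝒟.left_mem _ _ _ hy _ hc)
      · intro ξ γ x hx c hc
        rw [← 𝒟.left_assoc, 𝒟.left_assoc (𝒟.left x d)]
        exact h.2 _ _ _ hx _ (𝒟.left_mem _ _ _ hy _ hc)
      · intro γ c hc
        have hyc := 𝒟.left_mem _ _ _ hy _ hc
        rw [𝒟.right_left, ← sgn_smul_eq_zero_iff, ← htr hyc hd, ← (he (𝒟.left _ d)).1]
        exact h.2 _ _ _ hyc _ he'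
      · intro ξ γ x hx c hc
        rw [← 𝒟.left_left, ← 𝒟.left_assoc, 𝒟.left_assoc (𝒟.left x d)]
        exact h.2 _ _ _ hx _ (𝒟.left_mem _ _ _ hy _ hc)
    · have h1 : ∀ ξ γ, ∀ x ∈ 𝒟.deg ξ, ∀ c ∈ 𝒟.deg γ,
          g (𝒟.left (𝒟.left x (𝒟.left d y)) c) = 0 := by
        intro ξ γ x hx c hc
        rw [← 𝒟.left_assoc]
        exact h.2 _ _ _ (𝒟.left_mem _ _ _ hx _ hd) _ hc
      refine ⟨⟨fun γ c hc => h.2 _ _ _ hd _ hc, h1⟩, ?_, ?_⟩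
      · intro γ c hc
        rw [𝒟.right_left, ← sgn_smul_eq_zero_iff, ← htr (𝒟.left_mem _ _ _ hy _ hc) hd,
          𝒟.left_assoc]
        exact h.1 _ _ (𝒟.left_mem _ _ _ hc _ hd)
      · intro ξ γ x hx c hc
        rw [← 𝒟.left_left]
        exact h1 _ _ _ hx _ hc
  have hJ : 𝒟.idealI N ≤ J := by
    refine sInf_le ⟨?_, ?_, ?_⟩
    · intro y z h
      have key : ∀ i j, 𝒟.left (𝒟.proj i y) (𝒟.proj j z) ∈ J ∧
          𝒟.right (𝒟.proj i y) (𝒟.proj j z) ∈ J := by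
        intro i j
        have h' := hleft (𝒟.proj_mem i y) (𝒟.proj_mem j z) (h.imp (fun h => h i) fun h => h j)
        exact ⟨hhom (𝒟.left_mem _ _ _ (𝒟.proj_mem i y) _ (𝒟.proj_mem j z)) h'.1,
          hhom (𝒟.right_mem _ _ _ (𝒟.proj_mem i y) _ (𝒟.proj_mem j z)) h'.2⟩
      rw [← 𝒟.proj_add y, ← 𝒟.proj_add z]
      simp only [map_add, LinearMap.add_apply]
      exact ⟨add_mem (add_mem (key 0 0).1 (key 1 0).1) (add_mem (key 0 1).1 (key 1 1).1),
        add_mem (add_mem (key 0 0).2 (key 1 0).2) (add_mem (key 0 1).2 (key 1 1).2)⟩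
    · intro a i
      rw [map_nsmul]
      exact ⟨fun γ c hc => by rw [map_nsmul, LinearMap.smul_apply, map_nsmul, hN],
        fun ξ γ x hx c hc => by rw [map_nsmul, map_nsmul, LinearMap.smul_apply, map_nsmul, hN]⟩
    · intro α β a ha b hb
      refine hhom (i := α + β) ?_ ⟨?_, ?_⟩
      · rw [← 𝒟.d₁_tmul ha hb]
        exact 𝒟.isEven_d₁ _ _ (tmul_mem ha hb)
      · intro γ c hc
        rw [map_sub, map_zsmul, LinearMap.sub_apply, LinearMap.smul_apply, map_sub, map_zsmul,
          𝒟.right_left, hperm ha hb hc, htr (𝒟.left_mem _ _ _ ha _ hc) hb, smul_smul, sub_eq_zero]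
        congr 1
        clear ha hb hc
        revert α β γ
        decide
      · intro ξ γ x hx c hc
        have hbc := 𝒟.left_mem _ _ _ hb _ hc
        rw [map_sub, map_zsmul, ← 𝒟.left_left, map_sub, map_zsmul, LinearMap.sub_apply,
          LinearMap.smul_apply, map_sub, map_zsmul, sub_eq_zero, ← 𝒟.left_assoc,
          𝒟.left_assoc (𝒟.left x a), hperm hx ha hbc, ← 𝒟.left_assoc x b c,
          hperm (𝒟.left_mem _ _ _ hx _ hb) hc ha, smul_smul, ← 𝒟.left_assoc x b a]
        congr 1
        clear ha hb hc hbc hx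
        revert α β γ
        decide
  intro z hz
  have h : ∀ i, g (𝒟.proj i z) = 0 := by
    intro i
    rw [← (he (𝒟.proj i z)).1]
    exact (hJ hz i).1 0 e he'
  rw [LinearMap.mem_ker, ← 𝒟.proj_add z, map_add, h, h, add_zero]

/-- The triple product `a ⊣ b ⊣ c` with values in `D_N`. There all products of `a`, `b` and `c`,
with any choice of the operations, agree with it up to the sign of the permutation of the factors.
-/
def tri (𝒟 : Superdialgebra R D) (N : ℕ) : D →ₗ[R] D →ₗ[R] D →ₗ[R] 𝒟.Quo N :=
  𝒟.left.compr₂ (𝒟.left.compr₂ (𝒟.idealI N).mkQ)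

theorem tri_apply (𝒟 : Superdialgebra R D) (N : ℕ) (a b c : D) :
    𝒟.tri N a b c = (𝒟.idealI N).mkQ (𝒟.left (𝒟.left a b) c) := rfl

theorem mkQ_left_left (𝒟 : Superdialgebra R D) (N : ℕ) (a b c : D) :
    (𝒟.idealI N).mkQ (𝒟.left a (𝒟.left b c)) = 𝒟.tri N a b c := by
  rw [tri_apply, 𝒟.left_assoc]

theorem tri_swap (𝒟 : Superdialgebra R D) (N : ℕ) (a : D) {β γ : ZMod 2} {b c : D}
    (hb : b ∈ 𝒟.deg β) (hc : c ∈ 𝒟.deg γ) : 𝒟.tri N a b c = sgn β γ • 𝒟.tri N a c b := by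
  rw [← mkQ_left_left, ← mkQ_left_left, 𝒟.left_left a c b, ← map_zsmul, ← map_zsmul,
    ← sub_eq_zero, ← map_sub, ← map_sub, Submodule.mkQ_apply, Submodule.Quotient.mk_eq_zero]
  exact (𝒟.isIdeal_idealI N _ _
    (Or.inr (Submodule.mem_sInf.2 fun J hJ => hJ.2.2 _ _ _ hb _ hc))).1

theorem mkQ_left_right (𝒟 : Superdialgebra R D) (N : ℕ) (a : D) {β γ : ZMod 2} {b c : D}
    (hb : b ∈ 𝒟.deg β) (hc : c ∈ 𝒟.deg γ) :
    (𝒟.idealI N).mkQ (𝒟.left a (𝒟.right b c)) = sgn β γ • 𝒟.tri N a c b := by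
  rw [← 𝒟.left_left, mkQ_left_left, 𝒟.tri_swap N a hb hc]

theorem mkQ_right_left (𝒟 : Superdialgebra R D) (N : ℕ) {α β γ : ZMod 2} {a b c : D}
    (ha : a ∈ 𝒟.deg α) (hb : b ∈ 𝒟.deg β) (hc : c ∈ 𝒟.deg γ) :
    (𝒟.idealI N).mkQ (𝒟.left (𝒟.right b a) c) = sgn β α • 𝒟.tri N a b c := by
  have h := 𝒟.mkQ_left N (𝒟.left_mem _ _ _ ha _ hc) hb
  rw [𝒟.right_left, ← sgn_smul_sgn_smul (α + γ) β ((𝒟.idealI N).mkQ (𝒟.right b (𝒟.left a c))),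
    ← h, ← tri_apply, 𝒟.tri_swap N a hc hb, smul_smul]
  congr 1
  clear ha hb hc h
  revert α β γ
  decide

theorem tri_eq_zero_left (𝒟 : Superdialgebra R D) (N : ℕ) {a : D} (b c : D)
    (ha : (𝒟.idealI N).mkQ a = 0) : 𝒟.tri N a b c = 0 := by
  rw [Submodule.mkQ_apply, Submodule.Quotient.mk_eq_zero] at ha
  rw [tri_apply, Submodule.mkQ_apply, Submodule.Quotient.mk_eq_zero]
  exact (𝒟.isIdeal_idealI N _ _ (Or.inl (𝒟.isIdeal_idealI N _ _ (Or.inl ha)).1)).1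

theorem tri_eq_zero_middle (𝒟 : Superdialgebra R D) (N : ℕ) {b : D} (a c : D)
    (hb : (𝒟.idealI N).mkQ b = 0) : 𝒟.tri N a b c = 0 := by
  rw [Submodule.mkQ_apply, Submodule.Quotient.mk_eq_zero] at hb
  rw [tri_apply, Submodule.mkQ_apply, Submodule.Quotient.mk_eq_zero]
  exact (𝒟.isIdeal_idealI N _ _ (Or.inl (𝒟.isIdeal_idealI N _ _ (Or.inr hb)).1)).1

theorem tri_eq_zero_right (𝒟 : Superdialgebra R D) (N : ℕ) {c : D} (a b : D)
    (hc : (𝒟.idealI N).mkQ c = 0) : 𝒟.tri N a b c = 0 := by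
  rw [Submodule.mkQ_apply, Submodule.Quotient.mk_eq_zero] at hc
  rw [tri_apply, Submodule.mkQ_apply, Submodule.Quotient.mk_eq_zero]
  exact (𝒟.isIdeal_idealI N _ _ (Or.inr hc)).1

/-! ### Bilinear forms on matrices with values in `D_N` -/

/-- The form `x ⊗ y ↦ x_ij ⊣ y_kl` with values in `D_N`. -/
noncomputable def entryForm (𝒟 : Superdialgebra R D) (N : ℕ) (i j k l : Fin m ⊕ Fin n) :
    Matrix (Fin m ⊕ Fin n) (Fin m ⊕ Fin n) D ⊗[R] Matrix (Fin m ⊕ Fin n) (Fin m ⊕ Fin n) D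
      →ₗ[R] 𝒟.Quo N :=
  (𝒟.idealI N).mkQ ∘ₗ 𝒟.lmul ∘ₗ
    TensorProduct.map (Matrix.entryLinearMap R D i j) (Matrix.entryLinearMap R D k l)

theorem entryForm_tmul (𝒟 : Superdialgebra R D) (N : ℕ) (i j k l : Fin m ⊕ Fin n) (x y) :
    𝒟.entryForm N i j k l (x ⊗ₜ y) = (𝒟.idealI N).mkQ (𝒟.left (x i j) (y k l)) := by
  simp [entryForm, lmul]

theorem entryForm_single (𝒟 : Superdialgebra R D) (N : ℕ) (i j k l p q r s : Fin m ⊕ Fin n)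
    (a b : D) : 𝒟.entryForm N i j k l (Matrix.single p q a ⊗ₜ Matrix.single r s b)
      = if p = i ∧ q = j ∧ r = k ∧ s = l then (𝒟.idealI N).mkQ (𝒟.left a b) else 0 := by
  rw [entryForm_tmul]
  split_ifs with h
  · obtain ⟨rfl, rfl, rfl, rfl⟩ := h
    rw [Matrix.single_apply_same, Matrix.single_apply_same]
  · by_cases h' : p = i ∧ q = j
    · rw [Matrix.single_apply_of_ne r s _ _ _ (by tauto), map_zero, map_zero]
    · rw [Matrix.single_apply_of_ne p q _ _ _ h', map_zero, LinearMap.zero_apply, map_zero]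

theorem mkQ_left_mem (𝒟 : Superdialgebra R D) (N : ℕ) {i j k l : Fin m ⊕ Fin n} {p q : ZMod 2}
    {x y} (hx : x ∈ (𝒟.gl m n).deg p) (hy : y ∈ (𝒟.gl m n).deg q) :
    (𝒟.idealI N).mkQ (𝒟.left (x i j) (y k l))
      ∈ (𝒟.gradingQuo N).deg (p + q + (idx i + idx j + idx k + idx l)) := by
  refine ⟨_, ?_, rfl⟩
  have h := 𝒟.left_mem _ _ _ (hx i j) _ (hy k l)
  rwa [CharTwo.sub_eq_add, CharTwo.sub_eq_add, CharTwo.sub_eq_add, CharTwo.sub_eq_add,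
    show p + idx i + idx j + (q + idx k + idx l)
      = p + q + (idx i + idx j + idx k + idx l) by ring] at h

theorem bracket_apply (𝒟 : Superdialgebra R D) {q r : ZMod 2} {y z}
    (hy : y ∈ (𝒟.gl m n).deg q) (hz : z ∈ (𝒟.gl m n).deg r) (k l : Fin m ⊕ Fin n) :
    (𝒟.gl m n).bracket y z k l
      = ∑ s, (𝒟.left (y k s) (z s l) - sgn q r • 𝒟.right (z k s) (y s l)) := by
  have h : (𝒟.gl m n).bracket y z = (𝒟.matrix m n).left y z - sgn q r • (𝒟.matrix m n).right z y :=
    (𝒟.matrix m n).d₁_tmul hy hz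
  rw [h, Finset.sum_sub_distrib, ← Finset.smul_sum]
  rfl

/-- Expansion into triple products whose factors come from `x`, `y` and `z` in this order, so that
the terms of the cocycle identity can be compared. -/
theorem mkQ_left_bracket (𝒟 : Superdialgebra R D) (N : ℕ) {q r : ZMod 2}
    {x y z : Matrix (Fin m ⊕ Fin n) (Fin m ⊕ Fin n) D}
    (hy : y ∈ (𝒟.gl m n).deg q) (hz : z ∈ (𝒟.gl m n).deg r) (i j k l : Fin m ⊕ Fin n) :
    (𝒟.idealI N).mkQ (𝒟.left (x i j) ((𝒟.gl m n).bracket y z k l))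
      = ∑ s, (𝒟.tri N (x i j) (y k s) (z s l)
        - (sgn q r * sgn (r - idx k - idx s) (q - idx s - idx l))
          • 𝒟.tri N (x i j) (y s l) (z k s)) := by
  rw [𝒟.bracket_apply hy hz, map_sum, map_sum]
  refine Finset.sum_congr rfl fun s _ => ?_
  rw [map_sub, map_sub, map_zsmul, map_zsmul, mkQ_left_left,
    𝒟.mkQ_left_right N _ (hz k s) (hy s l), smul_smul]

theorem mkQ_bracket_left (𝒟 : Superdialgebra R D) (N : ℕ) {p q r : ZMod 2}
    {x y z : Matrix (Fin m ⊕ Fin n) (Fin m ⊕ Fin n) D}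
    (hx : x ∈ (𝒟.gl m n).deg p) (hy : y ∈ (𝒟.gl m n).deg q) (hz : z ∈ (𝒟.gl m n).deg r)
    (i j k l : Fin m ⊕ Fin n) :
    (𝒟.idealI N).mkQ (𝒟.left ((𝒟.gl m n).bracket x y i j) (z k l))
      = ∑ s, (𝒟.tri N (x i s) (y s j) (z k l)
        - (sgn p q * sgn (q - idx i - idx s) (p - idx s - idx j))
          • 𝒟.tri N (x s j) (y i s) (z k l)) := by
  rw [𝒟.bracket_apply hx hy, map_sum, LinearMap.sum_apply, map_sum]
  refine Finset.sum_congr rfl fun s _ => ?_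
  rw [map_sub, LinearMap.sub_apply, map_sub, map_zsmul, LinearMap.smul_apply, map_zsmul,
    ← tri_apply, 𝒟.mkQ_right_left N (hx s j) (hy i s) (hz k l), smul_smul]

theorem mkQ_bracket_left_swap (𝒟 : Superdialgebra R D) (N : ℕ) {p q r : ZMod 2}
    {x y z : Matrix (Fin m ⊕ Fin n) (Fin m ⊕ Fin n) D}
    (hx : x ∈ (𝒟.gl m n).deg p) (hy : y ∈ (𝒟.gl m n).deg q) (hz : z ∈ (𝒟.gl m n).deg r)
    (i j k l : Fin m ⊕ Fin n) :
    (𝒟.idealI N).mkQ (𝒟.left ((𝒟.gl m n).bracket x z i j) (y k l))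
      = ∑ s, (sgn (r - idx s - idx j) (q - idx k - idx l) • 𝒟.tri N (x i s) (y k l) (z s j)
        - (sgn p r * sgn (r - idx i - idx s) (p - idx s - idx j)
            * sgn (r - idx i - idx s) (q - idx k - idx l))
          • 𝒟.tri N (x s j) (y k l) (z i s)) := by
  rw [𝒟.mkQ_bracket_left N hx hz hy]
  refine Finset.sum_congr rfl fun s _ => ?_
  rw [𝒟.tri_swap N _ (hz s j) (hy k l), 𝒟.tri_swap N _ (hz i s) (hy k l), smul_smul]

theorem mkQ_strace (𝒟 : Superdialgebra R D) (N : ℕ) (o : Fin m ⊕ Fin n) {x}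
    (hx : x ∈ (𝒟.gl m n).commutator) :
    (𝒟.idealI N).mkQ (strace 𝒟.toSuperGrading o x) = 0 := by
  have h : (𝒟.gl m n).commutator
      ≤ LinearMap.ker ((𝒟.idealI N).mkQ ∘ₗ strace 𝒟.toSuperGrading o) := by
    refine Submodule.span_le.2 ?_
    rintro _ ⟨x, y, rfl⟩
    have h := 𝒟.d₁_traceForm o (x ⊗ₜ y)
    rw [LeibnizSuperalgebra.δ₂, TensorProduct.lift.tmul] at h
    change (𝒟.idealI N).mkQ (strace 𝒟.toSuperGrading o ((𝒟.gl m n).bracket x y)) = 0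
    rw [← h, 𝒟.mkQ_d₁]
  exact h hx

/-- Matrices in `sl(m, n, D)` have vanishing supertrace in `D_N`. -/
theorem mkQ_sum_diag (𝒟 : Superdialgebra R D) (N : ℕ) (o : Fin m ⊕ Fin n) {p : ZMod 2} {x}
    (hx : x ∈ (𝒟.gl m n).commutator) (hp : x ∈ (𝒟.gl m n).deg p) :
    (𝒟.idealI N).mkQ (∑ s, sgn (idx s + idx o) (1 + p) • x s s) = 0 := by
  rw [← 𝒟.mkQ_strace N o hx]
  congr 1
  simp only [strace, LinearMap.sum_apply, LinearMap.comp_apply, Matrix.entryLinearMap_apply]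
  refine Finset.sum_congr rfl fun s _ => ?_
  have h := hp s s
  rw [sub_sub, CharTwo.add_self_eq_zero, sub_zero] at h
  rw [twist_of_mem _ _ h]

/-- A form on matrices is a cocycle on `sl(m, n, D)` if it satisfies the cocycle identity on
homogeneous elements. -/
theorem form_δ₃_eq_zero {M : Type*} [AddCommGroup M] [Module R M] (𝒟 : Superdialgebra R D)
    (f : Matrix (Fin m ⊕ Fin n) (Fin m ⊕ Fin n) D ⊗[R] Matrix (Fin m ⊕ Fin n) (Fin m ⊕ Fin n) D
      →ₗ[R] M)
    (h : ∀ p q r, ∀ x ∈ (𝒟.gl m n).commutator, ∀ y ∈ (𝒟.gl m n).commutator,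
      ∀ z ∈ (𝒟.gl m n).commutator, x ∈ (𝒟.gl m n).deg p → y ∈ (𝒟.gl m n).deg q →
      z ∈ (𝒟.gl m n).deg r → f (x ⊗ₜ (𝒟.gl m n).bracket y z)
        - f ((𝒟.gl m n).bracket x y ⊗ₜ z) + sgn q r • f ((𝒟.gl m n).bracket x z ⊗ₜ y) = 0) (t) :
    f ((𝒟.gl m n).incl₂ ((𝒟.sl m n).δ₃ t)) = 0 := by
  refine (Submodule.mem_bot R).1 (tensor_induction₃ (𝒟.sl m n).toSuperGrading
    (𝒟.sl m n).toSuperGrading (𝒟.sl m n).toSuperGrading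
    (f ∘ₗ (𝒟.gl m n).incl₂ ∘ₗ (𝒟.sl m n).δ₃) ⊥ ?_ t)
  intro p q r x hx y hy z hz
  rw [Submodule.mem_bot, ← h p q r x x.2 y y.2 z z.2 hx hy hz]
  change f ((𝒟.gl m n).incl₂ ((𝒟.gl m n).derived.δ₃ (x ⊗ₜ (y ⊗ₜ z)))) = _
  rw [(𝒟.gl m n).incl₂_δ₃_tmul x hy hz, map_add, map_add, map_neg, map_zsmul]
  abel

end Superdialgebra

/-! ### The exceptional cocycles -/

theorem sum_eq_of_enumeration {ι M : Type*} [Fintype ι] [AddCommMonoid M] {v : List ι}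
    (hv : v.Nodup) (hv' : ∀ s, s ∈ v) (F : ι → M) : ∑ s, F s = (v.map F).sum := by
  classical
  rw [← List.sum_toFinset F hv]
  congr 1
  ext s
  simp [hv' s]

namespace Superdialgebra

variable {R D : Type*} [CommRing R] [AddCommGroup D] [Module R D] {m n : ℕ}

theorem quo_two_add_self (𝒟 : Superdialgebra R D) (x : 𝒟.Quo 2) : x + x = 0 := by
  rw [← two_nsmul, nsmul_quo]

theorem quo_two_sgn_smul (𝒟 : Superdialgebra R D) (i j : ZMod 2) (x : 𝒟.Quo 2) :
    sgn i j • x = x := sgn_smul_of_two_nsmul i j (𝒟.nsmul_quo 2 x)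

/-- The symmetric form `x_kl y_ij + x_ij y_kl + x_kj y_il + x_il y_kj` with values in `D_2`. -/
noncomputable def form₂ (𝒟 : Superdialgebra R D) (k l i j : Fin m ⊕ Fin n) :
    Matrix (Fin m ⊕ Fin n) (Fin m ⊕ Fin n) D ⊗[R] Matrix (Fin m ⊕ Fin n) (Fin m ⊕ Fin n) D
      →ₗ[R] 𝒟.Quo 2 :=
  𝒟.entryForm 2 k l i j + 𝒟.entryForm 2 i j k l + 𝒟.entryForm 2 k j i l + 𝒟.entryForm 2 i l k j

/-- All terms of the cocycle identity are triple products of entries of `x`, `y` and `z`. Vanishing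
of the supertrace in `D_2` eliminates the diagonal entries at `j`, and the remaining terms occur in
pairs. That `k`, `l`, `i` and `j` exhaust the indices is essential. -/
theorem form₂_cocycle (𝒟 : Superdialgebra R D) {k l i j : Fin m ⊕ Fin n}
    (hv : [k, l, i, j].Nodup) (hv' : ∀ s, s ∈ [k, l, i, j]) (t) :
    𝒟.form₂ k l i j ((𝒟.gl m n).incl₂ ((𝒟.sl m n).δ₃ t)) = 0 := by
  refine 𝒟.form_δ₃_eq_zero _ ?_ t
  intro p q r x hx y hy z hz hxp hyq hzr
  have hn : ∀ x : 𝒟.Quo 2, -x = x := fun x => by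
    rw [neg_eq_iff_add_eq_zero, quo_two_add_self]
  have tx : ∀ b c, 𝒟.tri 2 (x j j) b c
      = 𝒟.tri 2 (x k k) b c + 𝒟.tri 2 (x l l) b c + 𝒟.tri 2 (x i i) b c := by
    intro b c
    have h := 𝒟.tri_eq_zero_left 2 b c (𝒟.mkQ_sum_diag 2 k hx hxp)
    simp only [sum_eq_of_enumeration hv hv', List.map_cons, List.map_nil, List.sum_cons,
      List.sum_nil, add_zero, map_add, LinearMap.add_apply, map_zsmul, LinearMap.smul_apply,
      quo_two_sgn_smul] at h
    rw [← hn (_ + _ + _), ← add_eq_zero_iff_eq_neg, ← h]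
    abel
  have ty : ∀ b c, 𝒟.tri 2 b (y j j) c
      = 𝒟.tri 2 b (y k k) c + 𝒟.tri 2 b (y l l) c + 𝒟.tri 2 b (y i i) c := by
    intro b c
    have h := 𝒟.tri_eq_zero_middle 2 b c (𝒟.mkQ_sum_diag 2 k hy hyq)
    simp only [sum_eq_of_enumeration hv hv', List.map_cons, List.map_nil, List.sum_cons,
      List.sum_nil, add_zero, map_add, LinearMap.add_apply, map_zsmul, LinearMap.smul_apply,
      quo_two_sgn_smul] at h
    rw [← hn (_ + _ + _), ← add_eq_zero_iff_eq_neg, ← h]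
    abel
  have tz : ∀ b c, 𝒟.tri 2 b c (z j j)
      = 𝒟.tri 2 b c (z k k) + 𝒟.tri 2 b c (z l l) + 𝒟.tri 2 b c (z i i) := by
    intro b c
    have h := 𝒟.tri_eq_zero_right 2 b c (𝒟.mkQ_sum_diag 2 k hz hzr)
    simp only [sum_eq_of_enumeration hv hv', List.map_cons, List.map_nil, List.sum_cons,
      List.sum_nil, add_zero, map_add, map_zsmul, quo_two_sgn_smul] at h
    rw [← hn (_ + _ + _), ← add_eq_zero_iff_eq_neg, ← h]
    abel
  have h2 : ∀ x : 𝒟.Quo 2, (2 : ℤ) • x = 0 := fun x => by rw [two_zsmul, quo_two_add_self]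
  simp only [form₂, LinearMap.add_apply, entryForm_tmul, 𝒟.mkQ_left_bracket 2 hyq hzr,
    𝒟.mkQ_bracket_left 2 hxp hyq hzr, 𝒟.mkQ_bracket_left_swap 2 hxp hyq hzr,
    sum_eq_of_enumeration hv hv', List.map_cons, List.map_nil, List.sum_cons, List.sum_nil,
    add_zero, mul_smul, quo_two_sgn_smul, sub_eq_add_neg, hn, tx, ty, tz]
  abel_nf
  simp only [h2, add_zero]

/-- The antisymmetric form `x_kl y_ij - x_ij y_kl` with values in `D_3`. -/
noncomputable def form₃ (𝒟 : Superdialgebra R D) (k l i j : Fin m ⊕ Fin n) :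
    Matrix (Fin m ⊕ Fin n) (Fin m ⊕ Fin n) D ⊗[R] Matrix (Fin m ⊕ Fin n) (Fin m ⊕ Fin n) D
      →ₗ[R] 𝒟.Quo 3 :=
  𝒟.entryForm 3 k l i j - 𝒟.entryForm 3 i j k l

/-- Vanishing of the trace in `D_3` eliminates the diagonal entries at `j`, and the remaining terms
of the cocycle identity cancel or occur three times. -/
theorem form₃_cocycle (𝒟 : Superdialgebra R D) {k l j : Fin m ⊕ Fin n}
    (hv : [k, l, j].Nodup) (hv' : ∀ s, s ∈ [k, l, j]) (hidx : ∀ s : Fin m ⊕ Fin n, idx s = 0) (t) :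
    𝒟.form₃ k l k j ((𝒟.gl m n).incl₂ ((𝒟.sl m n).δ₃ t)) = 0
      ∧ 𝒟.form₃ l k j k ((𝒟.gl m n).incl₂ ((𝒟.sl m n).δ₃ t)) = 0 := by
  have key : ∀ p q r, ∀ x ∈ (𝒟.gl m n).commutator, ∀ y ∈ (𝒟.gl m n).commutator,
      ∀ z ∈ (𝒟.gl m n).commutator, x ∈ (𝒟.gl m n).deg p → y ∈ (𝒟.gl m n).deg q →
      z ∈ (𝒟.gl m n).deg r → (𝒟.form₃ k l k j (x ⊗ₜ (𝒟.gl m n).bracket y z)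
        - 𝒟.form₃ k l k j ((𝒟.gl m n).bracket x y ⊗ₜ z)
          + sgn q r • 𝒟.form₃ k l k j ((𝒟.gl m n).bracket x z ⊗ₜ y) = 0 ∧
        𝒟.form₃ l k j k (x ⊗ₜ (𝒟.gl m n).bracket y z)
        - 𝒟.form₃ l k j k ((𝒟.gl m n).bracket x y ⊗ₜ z)
          + sgn q r • 𝒟.form₃ l k j k ((𝒟.gl m n).bracket x z ⊗ₜ y) = 0) := by
    intro p q r x hx y hy z hz hxp hyq hzr
    have tx : ∀ b c, 𝒟.tri 3 (x j j) b c = -𝒟.tri 3 (x k k) b c - 𝒟.tri 3 (x l l) b c := by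
      intro b c
      have h := 𝒟.tri_eq_zero_left 3 b c (𝒟.mkQ_sum_diag 3 k hx hxp)
      simp only [sum_eq_of_enumeration hv hv', List.map_cons, List.map_nil, List.sum_cons,
        List.sum_nil, add_zero, map_add, LinearMap.add_apply, hidx, sgn_zero_left, one_smul] at h
      rw [← sub_eq_zero, ← h]
      abel
    have ty : ∀ b c, 𝒟.tri 3 b (y j j) c = -𝒟.tri 3 b (y k k) c - 𝒟.tri 3 b (y l l) c := by
      intro b c
      have h := 𝒟.tri_eq_zero_middle 3 b c (𝒟.mkQ_sum_diag 3 k hy hyq)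
      simp only [sum_eq_of_enumeration hv hv', List.map_cons, List.map_nil, List.sum_cons,
        List.sum_nil, add_zero, map_add, LinearMap.add_apply, hidx, sgn_zero_left, one_smul] at h
      rw [← sub_eq_zero, ← h]
      abel
    have tz : ∀ b c, 𝒟.tri 3 b c (z j j) = -𝒟.tri 3 b c (z k k) - 𝒟.tri 3 b c (z l l) := by
      intro b c
      have h := 𝒟.tri_eq_zero_right 3 b c (𝒟.mkQ_sum_diag 3 k hz hzr)
      simp only [sum_eq_of_enumeration hv hv', List.map_cons, List.map_nil, List.sum_cons,
        List.sum_nil, add_zero, map_add, hidx, sgn_zero_left, one_smul] at h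
      rw [← sub_eq_zero, ← h]
      abel
    have h3 : ∀ x : 𝒟.Quo 3, (3 : ℤ) • x = 0 := fun x => by
      rw [show (3 : ℤ) = ((3 : ℕ) : ℤ) by rfl, natCast_zsmul, nsmul_quo]
    have h3' : ∀ x : 𝒟.Quo 3, (-3 : ℤ) • x = 0 := fun x => by rw [neg_smul, h3, neg_zero]
    simp only [form₃, LinearMap.sub_apply, entryForm_tmul, 𝒟.mkQ_left_bracket 3 hyq hzr,
      𝒟.mkQ_bracket_left 3 hxp hyq hzr, 𝒟.mkQ_bracket_left_swap 3 hxp hyq hzr,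
      sum_eq_of_enumeration hv hv', List.map_cons, List.map_nil, List.sum_cons, List.sum_nil,
      add_zero, mul_smul, hidx, sub_zero, smul_add, smul_sub, smul_neg, tx, ty, tz]
    clear hx hy hz hxp hyq hzr
    have h : ∀ i j, sgn i j = 1 ∨ sgn i j = -1 := by decide
    have hc : ∀ i j, sgn i j = sgn j i := by decide
    rw [hc r q, hc r p, hc q p]
    constructor
    all_goals
      rcases h q r with h1 | h1 <;> rcases h p r with h2 | h2 <;> rcases h p q with h4 | h4 <;>
        (simp only [h1, h2, h4]; abel_nf; try simp only [h3, h3', add_zero])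
  exact ⟨𝒟.form_δ₃_eq_zero _ (fun p q r x hx y hy z hz hxp hyq hzr =>
      (key p q r x hx y hy z hz hxp hyq hzr).1) t,
    𝒟.form_δ₃_eq_zero _ (fun p q r x hx y hy z hz hxp hyq hzr =>
      (key p q r x hx y hy z hz hxp hyq hzr).2) t⟩

/-- The form `x_kl σ(y_ij) + x_ij σ(y_kl) - x_kj σ(y_il) - x_il σ(y_kj)` with values in `D_0`, up to
a sign. Here `σ` is the parity operator, which is applied to `y` as a whole. -/
noncomputable def form₀ (𝒟 : Superdialgebra R D) (k l i j : Fin m ⊕ Fin n) :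
    Matrix (Fin m ⊕ Fin n) (Fin m ⊕ Fin n) D ⊗[R] Matrix (Fin m ⊕ Fin n) (Fin m ⊕ Fin n) D
      →ₗ[R] 𝒟.Quo 0 :=
  -(𝒟.entryForm 0 k l i j + 𝒟.entryForm 0 i j k l - 𝒟.entryForm 0 k j i l - 𝒟.entryForm 0 i l k j)
    ∘ₗ LinearMap.lTensor _ (𝒟.gl m n).parity

theorem form₀_tmul (𝒟 : Superdialgebra R D) (k l i j : Fin m ⊕ Fin n) (x) {q : ZMod 2} {y}
    (hy : y ∈ (𝒟.gl m n).deg q) : 𝒟.form₀ k l i j (x ⊗ₜ y) = sgn (q + 1) 1 •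
      (𝒟.entryForm 0 k l i j (x ⊗ₜ y) + 𝒟.entryForm 0 i j k l (x ⊗ₜ y)
        - 𝒟.entryForm 0 k j i l (x ⊗ₜ y) - 𝒟.entryForm 0 i l k j (x ⊗ₜ y)) := by
  have h : sgn (q + 1) 1 = -sgn q 1 := by
    clear hy
    revert q
    decide
  rw [form₀, LinearMap.neg_apply, LinearMap.comp_apply, LinearMap.lTensor_tmul,
    parity_of_mem _ hy, TensorProduct.tmul_smul, map_zsmul, h, neg_smul]
  rfl

set_option maxHeartbeats 1600000 in
-- sixteen parity cases are normalised one by one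
/-- Vanishing of the supertrace eliminates the diagonal entries at `j`. Since the rows `k`, `i` have
one parity and the columns `l`, `j` the other, the remaining terms cancel integrally. -/
theorem form₀_cocycle (𝒟 : Superdialgebra R D) {k l i j : Fin m ⊕ Fin n}
    (hv : [k, l, i, j].Nodup) (hv' : ∀ s, s ∈ [k, l, i, j]) (hi : idx i = idx k)
    (hl : idx l = idx k + 1) (hj : idx j = idx k + 1) (t) :
    𝒟.form₀ k l i j ((𝒟.gl m n).incl₂ ((𝒟.sl m n).δ₃ t)) = 0 := by
  refine 𝒟.form_δ₃_eq_zero _ ?_ t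
  intro p q r x hx y hy z hz hxp hyq hzr
  rw [𝒟.form₀_tmul _ _ _ _ _ ((𝒟.gl m n).bracket_mem _ _ _ hyq _ hzr),
    𝒟.form₀_tmul _ _ _ _ _ hyq, 𝒟.form₀_tmul _ _ _ _ _ hzr]
  have tx : ∀ b c, 𝒟.tri 0 (x j j) b c = -𝒟.tri 0 (x l l) b c
      - sgn 1 (1 + p) • (𝒟.tri 0 (x k k) b c + 𝒟.tri 0 (x i i) b c) := by
    intro b c
    have h := 𝒟.tri_eq_zero_left 0 b c (𝒟.mkQ_sum_diag 0 j hx hxp)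
    simp only [sum_eq_of_enumeration hv hv', List.map_cons, List.map_nil, List.sum_cons,
      List.sum_nil, add_zero, map_add, LinearMap.add_apply, map_zsmul, LinearMap.smul_apply, hi, hl,
      hj, CharTwo.add_self_eq_zero, CharTwo.add_cancel_left, sgn_zero_left, one_smul] at h
    rw [← sub_eq_zero, ← h, smul_add]
    abel
  have ty : ∀ b c, 𝒟.tri 0 b (y j j) c = -𝒟.tri 0 b (y l l) c
      - sgn 1 (1 + q) • (𝒟.tri 0 b (y k k) c + 𝒟.tri 0 b (y i i) c) := by
    intro b c
    have h := 𝒟.tri_eq_zero_middle 0 b c (𝒟.mkQ_sum_diag 0 j hy hyq)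
    simp only [sum_eq_of_enumeration hv hv', List.map_cons, List.map_nil, List.sum_cons,
      List.sum_nil, add_zero, map_add, LinearMap.add_apply, map_zsmul, LinearMap.smul_apply, hi, hl,
      hj, CharTwo.add_self_eq_zero, CharTwo.add_cancel_left, sgn_zero_left, one_smul] at h
    rw [← sub_eq_zero, ← h, smul_add]
    abel
  have tz : ∀ b c, 𝒟.tri 0 b c (z j j) = -𝒟.tri 0 b c (z l l)
      - sgn 1 (1 + r) • (𝒟.tri 0 b c (z k k) + 𝒟.tri 0 b c (z i i)) := by
    intro b c
    have h := 𝒟.tri_eq_zero_right 0 b c (𝒟.mkQ_sum_diag 0 j hz hzr)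
    simp only [sum_eq_of_enumeration hv hv', List.map_cons, List.map_nil, List.sum_cons,
      List.sum_nil, add_zero, map_add, map_zsmul, hi, hl,
      hj, CharTwo.add_self_eq_zero, CharTwo.add_cancel_left, sgn_zero_left, one_smul] at h
    rw [← sub_eq_zero, ← h, smul_add]
    abel
  simp only [entryForm_tmul, 𝒟.mkQ_left_bracket 0 hyq hzr,
    𝒟.mkQ_bracket_left 0 hxp hyq hzr, 𝒟.mkQ_bracket_left_swap 0 hxp hyq hzr,
    sum_eq_of_enumeration hv hv', List.map_cons, List.map_nil, List.sum_cons, List.sum_nil,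
    add_zero, hi, hl, hj, tx, ty, tz, CharTwo.sub_eq_add]
  clear hx hy hz hxp hyq hzr tx ty tz hi hl hj hv hv'
  generalize (idx k : ZMod 2) = u
  have h00 : sgn 0 0 = 1 := by decide
  have h01 : sgn 0 1 = 1 := by decide
  have h10 : sgn 1 0 = 1 := by decide
  have h11 : sgn 1 1 = -1 := by decide
  have h2 : (1 : ZMod 2) + 1 = 0 := by decide
  rcases two_cases p with rfl | rfl <;> rcases two_cases q with rfl | rfl <;>
    rcases two_cases r with rfl | rfl <;> rcases two_cases u with rfl | rfl <;>
    (simp only [add_zero, zero_add, h2, h00, h01, h10, h11, mul_one, one_smul, mul_neg, neg_neg,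
      neg_smul]; abel)

end Superdialgebra

/-! ### Relations between crossed classes -/

namespace SteinbergFamily

variable {R D L ι : Type*} [CommRing R] [AddCommGroup D] [Module R D]
  [AddCommGroup L] [Module R L] {𝒟 : Superdialgebra R D} {e : D} {par : ι → ZMod 2}
  {𝔏 : LeibnizSuperalgebra R L} {E : ι → ι → D →ₗ[R] L}

/-- The right action of `[E_kl(1), E_lk(1)]` on root vectors in the row `k`. -/
theorem weight_row (S : SteinbergFamily 𝒟 e par 𝔏 E) {k l p : ι} (hkl : k ≠ l) (hkp : k ≠ p)
    (hlp : l ≠ p) {α : ZMod 2} {a : D} (ha : a ∈ 𝒟.deg α) :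
    𝔏.bracket (E k p a) (𝔏.bracket (E k l e) (E l k e)) = -E k p a := by
  rw [𝔏.leibniz _ _ (E k p a) _ (S.mem_unit hkl) _ (S.mem_unit hkl.symm),
    S.zero hkp hkl hkp.symm hkl, map_zero, LinearMap.zero_apply, zero_sub,
    S.mul_swap hkl.symm hkp hlp S.even ha, (S.bar a).2, map_neg, LinearMap.neg_apply, map_zsmul,
    LinearMap.smul_apply, S.mul_swap hkl hlp hkp S.even ha, (S.bar a).2, smul_neg, neg_neg,
    smul_smul, smul_neg, smul_smul, add_zero, add_zero]
  conv_rhs => rw [← one_smul ℤ (E k p a)]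
  congr 2
  clear ha
  generalize par k = k, par l = l, par p = p
  revert k l p α
  decide

/-- The right action of `[E_lk(1), E_kl(1)]` on root vectors in the column `k`. -/
theorem weight_column (S : SteinbergFamily 𝒟 e par 𝔏 E) {k l p : ι} (hkl : k ≠ l) (hkp : k ≠ p)
    (hlp : l ≠ p) (a : D) :
    𝔏.bracket (E p k a) (𝔏.bracket (E l k e) (E k l e))
      = -(sgn (par k + par l) (par k + par l) • E p k a) := by
  rw [𝔏.leibniz _ _ (E p k a) _ (S.mem_unit hkl.symm) _ (S.mem_unit hkl),
    S.mul hkp.symm hkl hlp.symm, S.mul hlp.symm hkl.symm hkp.symm, (S.bar a).1, (S.bar a).1,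
    S.zero hkp.symm hkl.symm hkl hkp.symm, map_zero, LinearMap.zero_apply, zero_sub,
    add_comm (par l)]

/-- The right action of `[E_kl(1), E_lk(1)]` on `E_kl`. -/
theorem weight_root (S : SteinbergFamily 𝒟 e par 𝔏 E) {k l p : ι} (hkl : k ≠ l) (hkp : k ≠ p)
    (hlp : l ≠ p) {α : ZMod 2} {a : D} (ha : a ∈ 𝒟.deg α) :
    𝔏.bracket (E k l a) (𝔏.bracket (E k l e) (E l k e))
      = -(E k l a + sgn (par k + par l) (par k + par l) • E k l a) := by
  have hh := 𝔏.bracket_mem _ _ _ (S.mem_unit hkl) _ (S.mem_unit hkl.symm)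
  have h1 : 𝔏.bracket (E p l e) (𝔏.bracket (E k l e) (E l k e))
      = -(sgn (par k + par l) (par k + par l) • E p l (𝒟.left e e)) := by
    rw [𝔏.leibniz _ _ (E p l e) _ (S.mem_unit hkl) _ (S.mem_unit hkl.symm),
      S.mul hlp.symm hkl.symm hkp.symm, S.mul hkp.symm hkl hlp.symm,
      S.zero hlp.symm hkl hkl.symm hlp.symm, map_zero, LinearMap.zero_apply, zero_sub,
      (S.bar e).1, add_comm (par l), (S.bar e).1]
  have h := 𝔏.leibniz _ _ (E k p a) _ (S.mem_unit hlp.symm) _ hh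
  rw [h1, S.weight_row hkl hkp hlp ha, S.mul hkp hlp.symm hkl, (S.bar a).1, map_neg, map_neg,
    LinearMap.neg_apply, map_zsmul, S.mul hkp hlp.symm hkl, S.mul hkp hlp.symm hkl,
    S.left_unit_left, (S.bar a).1, add_comm (par l), CharTwo.add_self_eq_zero, sgn_zero_right,
    one_smul, sub_neg_eq_add] at h
  rw [eq_sub_of_add_eq h.symm]
  abel

/-- Let `x` and `y` have vanishing bracket. If they are eigenvectors of the right action of
`[E_kl(1), E_lk(1)]`, then the class of `x ⊗ y` is killed by the sum of the eigenvalues. -/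
theorem cls_weight (S : SteinbergFamily 𝒟 e par 𝔏 E) {k l : ι} (hkl : k ≠ l) {x y : L}
    {β : ZMod 2} (hy : y ∈ 𝔏.deg β) (hxy : 𝔏.bracket x y = 0) {p q : ℤ}
    (hx' : 𝔏.bracket x (𝔏.bracket (E k l e) (E l k e)) = p • x)
    (hy' : 𝔏.bracket y (𝔏.bracket (E k l e) (E l k e)) = q • y) :
    (p + q) • 𝔏.cls x y = 0 := by
  have hh := 𝔏.bracket_mem _ _ _ (S.mem_unit hkl) _ (S.mem_unit hkl.symm)
  have h := 𝔏.cls_bracket_left x hy hh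
  rw [hxy, hx', hy', add_comm (par l), CharTwo.add_self_eq_zero, sgn_zero_right, one_smul,
    map_zero, LinearMap.zero_apply, map_zsmul, map_zsmul, LinearMap.smul_apply, ← add_smul,
    add_comm] at h
  exact h.symm

section Row

/-! Pairs of root vectors in the common row `k`. -/

variable {k l j : ι}

theorem cls_row_left (S : SteinbergFamily 𝒟 e par 𝔏 E) (hkl : k ≠ l) (hkj : k ≠ j) (hlj : l ≠ j)
    (b : D) {α α' : ZMod 2} {a a' : D} (ha : a ∈ 𝒟.deg α) (ha' : a' ∈ 𝒟.deg α') :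
    𝔏.cls (E k l b) (E k j (𝒟.left a a')) = -(sgn (par k + par l + α) (par l + par j + α')
      • 𝔏.cls (E k j (𝒟.left b a')) (E k l a)) := by
  rw [← S.mul hkl hlj hkj, 𝔏.cls_bracket_right _ (S.mem hkl ha) (S.mem hlj ha'),
    S.mul hkl hlj hkj, S.zero hkl hkl hkl.symm hkl, map_zero, LinearMap.zero_apply, zero_sub]

theorem cls_row_swap (S : SteinbergFamily 𝒟 e par 𝔏 E) (hkl : k ≠ l) (hkj : k ≠ j) (hlj : l ≠ j)
    (b : D) {α : ZMod 2} {a : D} (ha : a ∈ 𝒟.deg α) :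
    𝔏.cls (E k l b) (E k j a) = -(sgn (par k + par l + α) (par l + par j)
      • 𝔏.cls (E k j b) (E k l a)) := by
  have h := S.cls_row_left hkl hkj hlj b ha S.even
  rwa [(S.bar a).1, (S.bar b).1, add_zero] at h

theorem cls_row_unit (S : SteinbergFamily 𝒟 e par 𝔏 E) (hkl : k ≠ l) (hkj : k ≠ j) (hlj : l ≠ j)
    (b : D) {α : ZMod 2} {a : D} (ha : a ∈ 𝒟.deg α) :
    𝔏.cls (E k l b) (E k j a) = -(sgn (par l + par j + α) (par k + par l)
      • 𝔏.cls (E k j (𝒟.left b a)) (E k l e)) := by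
  have h := 𝔏.cls_bracket_right (E k l b) (S.mem hlj ha) (S.mem_unit hkl)
  rw [S.mul_swap hkl hlj hkj S.even ha, (S.bar a).2, S.mul hkl hlj hkj,
    S.zero hkl hkl hkl.symm hkl, map_zero, LinearMap.zero_apply, smul_zero, sub_zero, map_neg,
    map_zsmul, add_zero, neg_eq_iff_eq_neg] at h
  rw [← sgn_smul_sgn_smul (par l + par j + α) (par k + par l) (𝔏.cls (E k l b) (E k j a)), h,
    smul_neg]

theorem cls_row_weight (S : SteinbergFamily 𝒟 e par 𝔏 E) (hkl : k ≠ l) (hkj : k ≠ j)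
    (hlj : l ≠ j) {α β : ZMod 2} {a b : D} (hb : b ∈ 𝒟.deg β) (ha : a ∈ 𝒟.deg α) :
    (-(1 + sgn (par k + par l) (par k + par l)) + -1 : ℤ) • 𝔏.cls (E k l b) (E k j a) = 0 := by
  refine S.cls_weight hkl (S.mem hkj ha) (S.zero hkl hkj hkl.symm hkj _ _) ?_ ?_
  · rw [S.weight_root hkl hkj hlj hb, neg_smul, add_smul, one_smul]
  · rw [S.weight_row hkl hkj hlj ha, neg_smul, one_smul]

/-- If the parity of `l` or `j` differs from that of `k`, the weight of the class of
`E_kl(b) ⊗ E_kj(a)` is `-1`, hence the class vanishes. -/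
theorem cls_row_eq_zero (S : SteinbergFamily 𝒟 e par 𝔏 E) (hkl : k ≠ l) (hkj : k ≠ j)
    (hlj : l ≠ j) (h : par k ≠ par l ∨ par k ≠ par j) (b a : D) :
    𝔏.cls (E k l b) (E k j a) = 0 := by
  have key : ∀ {l j : ι}, k ≠ l → k ≠ j → l ≠ j → par k ≠ par l → ∀ {α β : ZMod 2} {a b : D},
      b ∈ 𝒟.deg β → a ∈ 𝒟.deg α → 𝔏.cls (E k l b) (E k j a) = 0 := by
    intro l j hkl hkj hlj hp α β a b hb ha
    have h := S.cls_row_weight hkl hkj hlj hb ha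
    have hs : sgn (par k + par l) (par k + par l) = -1 := by
      revert hp
      generalize par k = k, par l = l
      revert k l
      decide
    rw [hs] at h
    simpa using h
  induction b using 𝒟.induction with
  | hadd x y hx hy => simp only [map_add, LinearMap.add_apply, hx, hy, add_zero]
  | hom β b hb =>
    induction a using 𝒟.induction with
    | hadd x y hx hy => rw [map_add, map_add, hx, hy, add_zero]
    | hom α a ha =>
      rcases h with h | h
      · exact key hkl hkj hlj h hb ha
      · rw [S.cls_row_swap hkl hkj hlj b ha, key hkj hkl hlj.symm h hb ha, smul_zero, neg_zero]

/-- Suppose that `k`, `l` and `j` have the same parity. Then the class of `E_kl(b) ⊗ E_kj(a)` only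
depends on the class of `b ⊣ a` in `D_3`. -/
theorem cls_row (S : SteinbergFamily 𝒟 e par 𝔏 E) (hkl : k ≠ l) (hkj : k ≠ j) (hlj : l ≠ j)
    (hl : par l = par k) (hj : par j = par k) :
    (∀ b a, 𝔏.cls (E k l b) (E k j a) = 𝔏.cls (E k l (𝒟.left b a)) (E k j e)) ∧
      𝒟.idealI 3 ≤ LinearMap.ker (𝔏.cls.flip (E k j e) ∘ₗ E k l) := by
  have sw : ∀ {l j : ι}, k ≠ l → k ≠ j → l ≠ j → par l = par k → par j = par k → ∀ b a,
      𝔏.cls (E k l b) (E k j a) = -𝔏.cls (E k j b) (E k l a) := by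
    intro l j hkl hkj hlj hl hj b a
    induction a using 𝒟.induction with
    | hadd x y hx hy => rw [map_add, map_add, hx, hy, map_add, map_add, neg_add]
    | hom α a ha =>
      rw [S.cls_row_swap hkl hkj hlj b ha, hl, hj, CharTwo.add_self_eq_zero, sgn_zero_right,
        one_smul]
  have h₁ : ∀ b a, 𝔏.cls (E k l b) (E k j a) = 𝔏.cls (E k l (𝒟.left b a)) (E k j e) := by
    intro b a
    induction a using 𝒟.induction with
    | hadd x y hx hy => simp only [map_add, LinearMap.add_apply, hx, hy]
    | hom α a ha =>
      rw [S.cls_row_unit hkl hkj hlj b ha, sw hkj hkl hlj.symm hj hl, hl, hj,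
        CharTwo.add_self_eq_zero, sgn_zero_right, one_smul, neg_neg]
  refine ⟨h₁, 𝒟.idealI_le_ker S.bar S.even 3 _ ?_ ?_ ?_⟩
  · intro α β a b ha hb
    have h := 𝔏.cls_bracket_left (E j l a) (S.mem hkj hb) (S.mem_unit hkj)
    have h' := S.mul_swap hkj hlj.symm hkl S.even ha
    rw [S.zero hkj hkj hkj.symm hkj, S.mul_swap hkj hlj.symm hkl hb ha, h', (S.bar a).2] at h
    simp only [hl, hj, CharTwo.add_self_eq_zero, zero_add, sgn_zero_right, one_smul, map_zero,
      map_neg, LinearMap.neg_apply, neg_inj, map_zsmul, LinearMap.smul_apply, h₁ a b] at h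
    change 𝔏.cls (E k l (𝒟.left a b)) (E k j e) = _ • 𝔏.cls (E k l (𝒟.right b a)) (E k j e)
    rw [h]
  · intro α β γ a b c ha hb hc
    have h := S.cls_row_left hkl hkj hlj a hb hc
    rw [h₁ a, sw hkj hkl hlj.symm hj hl, hl, hj, CharTwo.add_self_eq_zero, zero_add, zero_add,
      smul_neg, neg_neg, h₁ (𝒟.left a c), ← 𝒟.left_assoc] at h
    exact h
  · intro a
    change 3 • 𝔏.cls (E k l a) (E k j e) = 0
    induction a using 𝒟.induction with
    | hadd x y hx hy => rw [map_add, map_add, LinearMap.add_apply, smul_add, hx, hy, add_zero]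
    | hom α a ha =>
      have h := S.cls_row_weight hkl hkj hlj ha S.even
      rw [hl, CharTwo.add_self_eq_zero, sgn_zero_right] at h
      rw [← neg_eq_zero, ← natCast_zsmul, ← neg_smul]
      exact h

theorem cls_row_mem (S : SteinbergFamily 𝒟 e par 𝔏 E) (hkl : k ≠ l) (hkj : k ≠ j) (hlj : l ≠ j)
    (hl : par l = par k) (hj : par j = par k) {W : Submodule R _}
    (hW : ∀ c, 𝔏.cls (E k l c) (E k j e) ∈ W) (b a : D) :
    𝔏.cls (E k l b) (E k j a) ∈ W ∧ 𝔏.cls (E k j b) (E k l a) ∈ W := by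
  have h : ∀ b a, 𝔏.cls (E k l b) (E k j a) ∈ W := by
    intro b a
    rw [(S.cls_row hkl hkj hlj hl hj).1]
    exact hW _
  refine ⟨h b a, ?_⟩
  induction a using 𝒟.induction with
  | hadd x y hx hy => rw [map_add, map_add]; exact add_mem hx hy
  | hom α a ha =>
    rw [S.cls_row_swap hkj hkl hlj.symm b ha, neg_mem_iff, sgn_smul_mem_iff]
    exact h b a

end Row

section Column

/-! Pairs of root vectors in the common column `k`. -/

variable {k l j : ι}

theorem cls_column_left (S : SteinbergFamily 𝒟 e par 𝔏 E) (hkl : k ≠ l) (hkj : k ≠ j)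
    (hlj : l ≠ j) {α β : ZMod 2} {a b : D} (hb : b ∈ 𝒟.deg β) (ha : a ∈ 𝒟.deg α) (a' : D) :
    𝔏.cls (E l k b) (E j k (𝒟.left a a')) = -(sgn (par l + par k + β) (par j + par l + α)
      • 𝔏.cls (E j k (𝒟.right a b)) (E l k a')) := by
  induction a' using 𝒟.induction with
  | hadd x y hx hy => rw [map_add, map_add, map_add, hx, hy, map_add, map_add, smul_add, neg_add]
  | hom α' a' ha' =>
    rw [← S.mul hlj.symm hkl.symm hkj.symm, 𝔏.cls_bracket_right _ (S.mem hlj.symm ha)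
      (S.mem hkl.symm ha'), S.mul_swap hlj.symm hkl.symm hkj.symm ha hb,
      S.zero hkl.symm hkl.symm hkl hkl.symm, map_zero, LinearMap.zero_apply, smul_zero, sub_zero,
      map_neg, LinearMap.neg_apply, map_zsmul, LinearMap.smul_apply]

theorem cls_column_swap (S : SteinbergFamily 𝒟 e par 𝔏 E) (hkl : k ≠ l) (hkj : k ≠ j)
    (hlj : l ≠ j) {β : ZMod 2} {b : D} (hb : b ∈ 𝒟.deg β) (a : D) :
    𝔏.cls (E l k b) (E j k a) = -(sgn (par l + par k + β) (par j + par l)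
      • 𝔏.cls (E j k b) (E l k a)) := by
  induction a using 𝒟.induction with
  | hadd x y hx hy => rw [map_add, map_add, map_add, hx, hy, map_add, smul_add, neg_add]
  | hom α a ha =>
    have h := 𝔏.cls_bracket_right (E l k b) (S.mem hkl.symm ha) (S.mem_unit hlj.symm)
    have h₁ := S.mul_swap hlj.symm hkl.symm hkj.symm S.even ha
    have h₂ := S.mul_swap hlj.symm hkl.symm hkj.symm S.even hb
    rw [(S.bar a).2, add_zero] at h₁
    rw [(S.bar b).2, add_zero] at h₂
    rw [h₁, h₂, S.zero hkl.symm hkl.symm hkl hkl.symm, map_zero, LinearMap.zero_apply, zero_sub,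
      map_neg, map_zsmul, neg_inj] at h
    rw [← sgn_smul_sgn_smul (par l + par k + α) (par j + par l) (𝔏.cls (E l k b) (E j k a)), h,
      sgn_smul_sgn_smul, map_neg, LinearMap.neg_apply, map_zsmul, LinearMap.smul_apply]

theorem cls_column_weight (S : SteinbergFamily 𝒟 e par 𝔏 E) (hkl : k ≠ l) (hkj : k ≠ j)
    (hlj : l ≠ j) {α β : ZMod 2} {a b : D} (hb : b ∈ 𝒟.deg β) (ha : a ∈ 𝒟.deg α) :
    (-(1 + sgn (par k + par l) (par k + par l)) + -sgn (par k + par l) (par k + par l) : ℤ)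
      • 𝔏.cls (E l k b) (E j k a) = 0 := by
  refine S.cls_weight hkl.symm (S.mem hkj.symm ha) (S.zero hkl.symm hkj.symm hkj hkl.symm _ _)
    ?_ ?_
  · rw [S.weight_root hkl.symm hlj hkj hb, neg_smul, add_smul, one_smul, add_comm (par k)]
  · rw [S.weight_column hkl hkj hlj, neg_smul]

/-- If the parity of `l` or `j` differs from that of `k`, a weight of the class of
`E_lk(b) ⊗ E_jk(a)` is a unit, hence the class vanishes. -/
theorem cls_column_eq_zero (S : SteinbergFamily 𝒟 e par 𝔏 E) (hkl : k ≠ l) (hkj : k ≠ j)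
    (hlj : l ≠ j) (h : par k ≠ par l ∨ par k ≠ par j) (b a : D) :
    𝔏.cls (E l k b) (E j k a) = 0 := by
  have key : ∀ {l j : ι}, k ≠ l → k ≠ j → l ≠ j → par k ≠ par l → ∀ {α β : ZMod 2} {a b : D},
      b ∈ 𝒟.deg β → a ∈ 𝒟.deg α → 𝔏.cls (E l k b) (E j k a) = 0 := by
    intro l j hkl hkj hlj hp α β a b hb ha
    have h := S.cls_column_weight hkl hkj hlj hb ha
    have hs : sgn (par k + par l) (par k + par l) = -1 := by
      revert hp
      generalize par k = k, par l = l
      revert k l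
      decide
    rw [hs] at h
    simpa using h
  induction b using 𝒟.induction with
  | hadd x y hx hy => simp only [map_add, LinearMap.add_apply, hx, hy, add_zero]
  | hom β b hb =>
    induction a using 𝒟.induction with
    | hadd x y hx hy => rw [map_add, map_add, hx, hy, add_zero]
    | hom α a ha =>
      rcases h with h | h
      · exact key hkl hkj hlj h hb ha
      · rw [S.cls_column_swap hkl hkj hlj hb a, key hkj hkl hlj.symm h hb ha, smul_zero, neg_zero]

theorem cls_column_left_left (S : SteinbergFamily 𝒟 e par 𝔏 E) (hkl : k ≠ l) (hkj : k ≠ j)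
    (hlj : l ≠ j) (b : D) {α β' : ZMod 2} {a b' : D} (hb' : b' ∈ 𝒟.deg β') (ha : a ∈ 𝒟.deg α) :
    𝔏.cls (E l k (𝒟.left b b')) (E j k a) = sgn (par j + par k + β') (par j + par k + α)
      • 𝔏.cls (E l k (𝒟.left b a)) (E j k b') := by
  rw [← S.mul hlj hkj.symm hkl.symm, 𝔏.cls_bracket_left _ (S.mem hkj.symm hb') (S.mem hkj.symm ha),
    S.zero hkj.symm hkj.symm hkj hkj.symm, S.mul hlj hkj.symm hkl.symm, map_zero, zero_add]

/-- Suppose that `k`, `l` and `j` have the same parity. Then the class of `E_lk(b) ⊗ E_jk(a)` only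
depends on the class of `b ⊣ a` in `D_3`. -/
theorem cls_column (S : SteinbergFamily 𝒟 e par 𝔏 E) (hkl : k ≠ l) (hkj : k ≠ j) (hlj : l ≠ j)
    (hl : par l = par k) (hj : par j = par k) :
    (∀ b a, 𝔏.cls (E l k b) (E j k a) = 𝔏.cls (E l k (𝒟.left b a)) (E j k e)) ∧
      𝒟.idealI 3 ≤ LinearMap.ker (𝔏.cls.flip (E j k e) ∘ₗ E l k) := by
  have h₁ : ∀ b a, 𝔏.cls (E l k b) (E j k a) = 𝔏.cls (E l k (𝒟.left b a)) (E j k e) := by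
    intro b a
    induction a using 𝒟.induction with
    | hadd x y hx hy => simp only [map_add, LinearMap.add_apply, hx, hy]
    | hom α a ha =>
      have h := S.cls_column_left_left hkl hkj hlj b S.even ha
      rwa [(S.bar b).1, hj, CharTwo.add_self_eq_zero, add_zero, sgn_zero_left, one_smul] at h
  refine ⟨h₁, 𝒟.idealI_le_ker S.bar S.even 3 _ ?_ ?_ ?_⟩
  · intro α β a b ha hb
    have h := S.cls_column_left hkl hkj hlj ha hb e
    rw [(S.bar b).1, S.cls_column_swap hkj hkl hlj.symm (𝒟.right_mem _ _ _ hb _ ha), h₁ a, hl, hj,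
      CharTwo.add_self_eq_zero, sgn_zero_right, one_smul, smul_neg, neg_neg, zero_add, zero_add]
      at h
    exact h
  · intro α β γ a b c ha hb hc
    have h := S.cls_column_left_left hkl hkj hlj a hb hc
    rw [hj, CharTwo.add_self_eq_zero, zero_add, zero_add, h₁ (𝒟.left a b),
      h₁ (𝒟.left a c)] at h
    exact h
  · intro a
    change 3 • 𝔏.cls (E l k a) (E j k e) = 0
    induction a using 𝒟.induction with
    | hadd x y hx hy => rw [map_add, map_add, LinearMap.add_apply, smul_add, hx, hy, add_zero]
    | hom α a ha =>
      have h := S.cls_column_weight hkl hkj hlj ha S.even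
      rw [hl, CharTwo.add_self_eq_zero, sgn_zero_right] at h
      rw [← neg_eq_zero, ← natCast_zsmul, ← neg_smul]
      exact h

theorem cls_column_mem (S : SteinbergFamily 𝒟 e par 𝔏 E) (hkl : k ≠ l) (hkj : k ≠ j) (hlj : l ≠ j)
    (hl : par l = par k) (hj : par j = par k) {W : Submodule R _}
    (hW : ∀ c, 𝔏.cls (E l k c) (E j k e) ∈ W) (b a : D) :
    𝔏.cls (E l k b) (E j k a) ∈ W ∧ 𝔏.cls (E j k b) (E l k a) ∈ W := by
  have h : ∀ b a, 𝔏.cls (E l k b) (E j k a) ∈ W := by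
    intro b a
    rw [(S.cls_column hkl hkj hlj hl hj).1]
    exact hW _
  refine ⟨h b a, ?_⟩
  induction b using 𝒟.induction with
  | hadd x y hx hy => simp only [map_add, LinearMap.add_apply]; exact add_mem hx hy
  | hom β b hb =>
    rw [S.cls_column_swap hkj hkl hlj.symm hb, neg_mem_iff, sgn_smul_mem_iff]
    exact h b a

end Column

end SteinbergFamily

/-! ### Crossed classes with four distinct indices -/

namespace SteinbergFamily

variable {R D L ι : Type*} [CommRing R] [AddCommGroup D] [Module R D]
  [AddCommGroup L] [Module R L] {𝒟 : Superdialgebra R D} {e : D} {par : ι → ZMod 2}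
  {𝔏 : LeibnizSuperalgebra R L} {E : ι → ι → D →ₗ[R] L} {k l i j : ι}

theorem cls_swap_rows (S : SteinbergFamily 𝒟 e par 𝔏 E) (hv : [k, l, i, j].Nodup) {β : ZMod 2}
    {b : D} (hb : b ∈ 𝒟.deg β) (a : D) :
    𝔏.cls (E k l b) (E i j a)
      = -(sgn (par k + par l + β) (par i + par k) • 𝔏.cls (E i l b) (E k j a)) := by
  obtain ⟨⟨hkl, hki, hkj⟩, ⟨hli, hlj⟩, hij⟩ :
    (k ≠ l ∧ k ≠ i ∧ k ≠ j) ∧ (l ≠ i ∧ l ≠ j) ∧ i ≠ j := by simpa using hv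
  induction a using 𝒟.induction with
  | hadd x y hx hy => rw [map_add, map_add, map_add, hx, hy, map_add, smul_add, neg_add]
  | hom α a ha =>
    have h := 𝔏.cls_bracket_right (E k l b) (S.mem hkj ha) (S.mem_unit hki.symm)
    have h₁ := S.mul_swap hki.symm hkj hij S.even ha
    have h₂ := S.mul_swap hki.symm hkl hli.symm S.even hb
    rw [(S.bar a).2, add_zero] at h₁
    rw [(S.bar b).2, add_zero] at h₂
    rw [h₁, h₂, S.zero hkl hkj hkl.symm hkj, map_zero, LinearMap.zero_apply, zero_sub,
      map_neg, map_zsmul, neg_inj] at h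
    rw [← sgn_smul_sgn_smul (par k + par j + α) (par i + par k) (𝔏.cls (E k l b) (E i j a)), h,
      sgn_smul_sgn_smul, map_neg, LinearMap.neg_apply, map_zsmul, LinearMap.smul_apply]

theorem cls_left_columns (S : SteinbergFamily 𝒟 e par 𝔏 E) (hv : [k, l, i, j].Nodup) (b : D)
    {α α' : ZMod 2} {a a' : D} (ha : a ∈ 𝒟.deg α) (ha' : a' ∈ 𝒟.deg α') :
    𝔏.cls (E k l b) (E i j (𝒟.left a a')) = -(sgn (par i + par l + α) (par l + par j + α')
      • 𝔏.cls (E k j (𝒟.left b a')) (E i l a)) := by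
  obtain ⟨⟨hkl, hki, hkj⟩, ⟨hli, hlj⟩, hij⟩ :
    (k ≠ l ∧ k ≠ i ∧ k ≠ j) ∧ (l ≠ i ∧ l ≠ j) ∧ i ≠ j := by simpa using hv
  rw [← S.mul hli.symm hlj hij, 𝔏.cls_bracket_right _ (S.mem hli.symm ha) (S.mem hlj ha'),
    S.zero hkl hli.symm hli hkl, S.mul hkl hlj hkj, map_zero, LinearMap.zero_apply, zero_sub]

theorem cls_swap_columns (S : SteinbergFamily 𝒟 e par 𝔏 E) (hv : [k, l, i, j].Nodup) (b : D)
    {α : ZMod 2} {a : D} (ha : a ∈ 𝒟.deg α) :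
    𝔏.cls (E k l b) (E i j a)
      = -(sgn (par i + par l + α) (par l + par j) • 𝔏.cls (E k j b) (E i l a)) := by
  have h := S.cls_left_columns hv b ha S.even
  rwa [(S.bar a).1, (S.bar b).1, add_zero] at h

theorem nodup_swap_columns (hv : [k, l, i, j].Nodup) : [k, j, i, l].Nodup := by
  simp only [List.nodup_cons, List.mem_cons, List.not_mem_nil, or_false, not_or] at hv ⊢
  tauto

theorem nodup_swap_rows (hv : [k, l, i, j].Nodup) : [i, l, k, j].Nodup := by
  simp only [List.nodup_cons, List.mem_cons, List.not_mem_nil, or_false, not_or] at hv ⊢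
  tauto

theorem cls_right_unit (S : SteinbergFamily 𝒟 e par 𝔏 E) (hv : [k, l, i, j].Nodup) {α β : ZMod 2}
    {a b : D} (hb : b ∈ 𝒟.deg β) (ha : a ∈ 𝒟.deg α) :
    𝔏.cls (E k l b) (E i j a)
      = (sgn (par k + par l + β) (par i + par k + α)
          * sgn (par i + par l + (α + β)) (par k + par i))
        • 𝔏.cls (E k l (𝒟.right a b)) (E i j e) := by
  obtain ⟨⟨hkl, hki, hkj⟩, ⟨hli, hlj⟩, hij⟩ :
    (k ≠ l ∧ k ≠ i ∧ k ≠ j) ∧ (l ≠ i ∧ l ≠ j) ∧ i ≠ j := by simpa using hv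
  have h := 𝔏.cls_bracket_right (E k l b) (S.mem hki.symm ha) (S.mem_unit hkj)
  rw [S.mul hki.symm hkj hij, (S.bar a).1, S.mul_swap hki.symm hkl hli.symm ha hb,
    S.zero hkl hkj hkl.symm hkj, map_zero, LinearMap.zero_apply, smul_zero, sub_zero,
    map_neg, LinearMap.neg_apply, map_zsmul, LinearMap.smul_apply,
    S.cls_swap_rows (nodup_swap_rows hv) (𝒟.right_mem _ _ _ ha _ hb), smul_neg, neg_neg,
    smul_smul] at h
  exact h

theorem cls_left_unit (S : SteinbergFamily 𝒟 e par 𝔏 E) (hv : [k, l, i, j].Nodup) (b : D)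
    {α : ZMod 2} {a : D} (ha : a ∈ 𝒟.deg α) :
    𝔏.cls (E k l b) (E i j a)
      = (sgn (par l + par j + α) (par i + par l) * sgn (par i + par j) (par j + par l))
        • 𝔏.cls (E k l (𝒟.left b a)) (E i j e) := by
  obtain ⟨⟨hkl, hki, hkj⟩, ⟨hli, hlj⟩, hij⟩ :
    (k ≠ l ∧ k ≠ i ∧ k ≠ j) ∧ (l ≠ i ∧ l ≠ j) ∧ i ≠ j := by simpa using hv
  have h := 𝔏.cls_bracket_right (E k l b) (S.mem hlj ha) (S.mem_unit hli.symm)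
  have h₁ := S.mul_swap hli.symm hlj hij S.even ha
  rw [(S.bar a).2, add_zero] at h₁
  rw [h₁, S.mul hkl hlj hkj, S.zero hkl hli.symm hli hkl, map_zero, LinearMap.zero_apply,
    smul_zero, sub_zero, map_neg, map_zsmul, S.cls_swap_columns (nodup_swap_columns hv) _ S.even,
    neg_inj, add_zero] at h
  rw [← sgn_smul_sgn_smul (par l + par j + α) (par i + par l) (𝔏.cls (E k l b) (E i j a)), h,
    smul_smul]

theorem cls_left_left (S : SteinbergFamily 𝒟 e par 𝔏 E) (hv : [k, l, i, j].Nodup) (b : D)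
    {α α' : ZMod 2} {a a' : D} (ha : a ∈ 𝒟.deg α) (ha' : a' ∈ 𝒟.deg α') :
    𝔏.cls (E k l b) (E i j (𝒟.left a a'))
      = (sgn (par i + par l + α) (par l + par j + α') * sgn (par i + par j + α) (par j + par l))
        • 𝔏.cls (E k l (𝒟.left b a')) (E i j a) := by
  rw [S.cls_left_columns hv b ha ha', S.cls_swap_columns (nodup_swap_columns hv) _ ha, smul_neg,
    neg_neg, smul_smul]

/-- The classes on four distinct indices span the same module for all arrangements of the indices
with the same rows and the same columns. -/
theorem cls_four_mem (S : SteinbergFamily 𝒟 e par 𝔏 E) (hv : [k, l, i, j].Nodup)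
    {W : Submodule R _} (hW : ∀ c, 𝔏.cls (E k l c) (E i j e) ∈ W) (b a : D) :
    𝔏.cls (E k l b) (E i j a) ∈ W ∧ 𝔏.cls (E i l b) (E k j a) ∈ W ∧
      𝔏.cls (E k j b) (E i l a) ∈ W ∧ 𝔏.cls (E i j b) (E k l a) ∈ W := by
  have h₁ : ∀ b a, 𝔏.cls (E k l b) (E i j a) ∈ W := by
    intro b a
    induction a using 𝒟.induction with
    | hadd x y hx hy => rw [map_add, map_add]; exact add_mem hx hy
    | hom α a ha => rw [S.cls_left_unit hv b ha]; exact zsmul_mem (hW _) _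
  have h₂ : ∀ b a, 𝔏.cls (E i l b) (E k j a) ∈ W := by
    intro b a
    induction b using 𝒟.induction with
    | hadd x y hx hy => simp only [map_add, LinearMap.add_apply]; exact add_mem hx hy
    | hom β b hb =>
      rw [S.cls_swap_rows (nodup_swap_rows hv) hb, neg_mem_iff]
      exact zsmul_mem (h₁ _ _) _
  have h₃ : ∀ {k i : ι}, [k, l, i, j].Nodup → (∀ b a, 𝔏.cls (E k l b) (E i j a) ∈ W) →
      ∀ b a, 𝔏.cls (E k j b) (E i l a) ∈ W := by
    intro k i hv h b a
    induction a using 𝒟.induction with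
    | hadd x y hx hy => rw [map_add, map_add]; exact add_mem hx hy
    | hom α a ha =>
      rw [S.cls_swap_columns (nodup_swap_columns hv) b ha, neg_mem_iff]
      exact zsmul_mem (h _ _) _
  exact ⟨h₁ b a, h₂ b a, h₃ hv h₁ b a, h₃ (nodup_swap_rows hv) h₂ b a⟩

/-- If `k` and `l` have the same parity, the classes of `E_kl(c) ⊗ E_ij(1)` factor through
`D_2`. -/
theorem idealI_two_le_ker (S : SteinbergFamily 𝒟 e par 𝔏 E) (hv : [k, l, i, j].Nodup)
    (hl : par l = par k) :
    𝒟.idealI 2 ≤ LinearMap.ker (𝔏.cls.flip (E i j e) ∘ₗ E k l) := by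
  obtain ⟨⟨hkl, hki, hkj⟩, ⟨hli, hlj⟩, hij⟩ :
    (k ≠ l ∧ k ≠ i ∧ k ≠ j) ∧ (l ≠ i ∧ l ≠ j) ∧ i ≠ j := by simpa using hv
  have h2 : ∀ b, 2 • 𝔏.cls (E k l b) (E i j e) = 0 := by
    intro b
    induction b using 𝒟.induction with
    | hadd x y hx hy => rw [map_add, map_add, LinearMap.add_apply, smul_add, hx, hy, add_zero]
    | hom β b hb =>
      have h := S.cls_weight (p := -2) (q := 0) hkl (S.mem_unit hij)
        (S.zero hkl hij hli hkj b e) ?_ ?_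
      · rw [add_zero, neg_smul, neg_eq_zero] at h
        rw [← natCast_zsmul]
        exact h
      · rw [S.weight_root hkl hki hli hb, hl, CharTwo.add_self_eq_zero, sgn_zero_right, one_smul,
          neg_smul, two_smul]
      · rw [𝔏.leibniz _ _ (E i j e) _ (S.mem_unit hkl) _ (S.mem_unit hkl.symm),
          S.zero hij hkl hkj.symm hli.symm, S.zero hij hkl.symm hlj.symm hki.symm, map_zero,
          LinearMap.zero_apply, LinearMap.zero_apply, smul_zero, sub_zero, zero_smul]
  have h1 : ∀ u v b, sgn u v • 𝔏.cls (E k l b) (E i j e) = 𝔏.cls (E k l b) (E i j e) :=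
    fun u v b => sgn_smul_of_two_nsmul u v (h2 b)
  have hr : ∀ {α β a b}, b ∈ 𝒟.deg β → a ∈ 𝒟.deg α →
      𝔏.cls (E k l b) (E i j a) = 𝔏.cls (E k l (𝒟.right a b)) (E i j e) := by
    intro α β a b hb ha
    rw [S.cls_right_unit hv hb ha, mul_smul, h1, h1]
  have hl' : ∀ {α a}, ∀ b, a ∈ 𝒟.deg α →
      𝔏.cls (E k l b) (E i j a) = 𝔏.cls (E k l (𝒟.left b a)) (E i j e) := by
    intro α a b ha
    rw [S.cls_left_unit hv b ha, mul_smul, h1, h1]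
  refine 𝒟.idealI_le_ker S.bar S.even 2 _ ?_ ?_ h2
  · intro α β a b ha hb
    change 𝔏.cls (E k l (𝒟.left a b)) (E i j e) = _ • 𝔏.cls (E k l (𝒟.right b a)) (E i j e)
    rw [h1, ← hr ha hb, hl' a hb]
  · intro α β γ a b c ha hb hc
    change 𝔏.cls (E k l (𝒟.left (𝒟.left a b) c)) (E i j e)
      = _ • 𝔏.cls (E k l (𝒟.left (𝒟.left a c) b)) (E i j e)
    rw [h1, ← hl' _ hb, 𝒟.left_assoc, ← hl' _ (𝒟.left_mem _ _ _ hb _ hc),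
      S.cls_left_left hv a hb hc, hl' _ hb, mul_smul, h1, h1]

/-- If the rows have one parity and the columns the other, the classes of `E_kl(c) ⊗ E_ij(1)` factor
through `D_0`. -/
theorem idealI_zero_le_ker (S : SteinbergFamily 𝒟 e par 𝔏 E) (hv : [k, l, i, j].Nodup)
    (hi : par i = par k) (hl : par l = par k + 1) (hj : par j = par k + 1) :
    𝒟.idealI 0 ≤ LinearMap.ker (𝔏.cls.flip (E i j e) ∘ₗ E k l) := by
  have hl' : ∀ {α a}, ∀ b, a ∈ 𝒟.deg α →
      𝔏.cls (E k l (𝒟.left b a)) (E i j e) = sgn α 1 • 𝔏.cls (E k l b) (E i j a) := by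
    intro α a b ha
    rw [S.cls_left_unit hv b ha, hi, hl, hj, CharTwo.add_self_eq_zero, CharTwo.add_cancel_left,
      sgn_zero_right, mul_one, zero_add, sgn_smul_sgn_smul]
  refine 𝒟.idealI_le_ker S.bar S.even 0 _ ?_ ?_ fun a => zero_smul ℕ _
  · intro α β a b ha hb
    change 𝔏.cls (E k l (𝒟.left a b)) (E i j e) = _ • 𝔏.cls (E k l (𝒟.right b a)) (E i j e)
    rw [hl' a hb, S.cls_right_unit hv ha hb, hi, hl, CharTwo.add_self_eq_zero,
      CharTwo.add_cancel_left, sgn_zero_right, mul_one, zero_add, smul_smul]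
    congr 1
    clear ha hb
    revert α β
    decide
  · intro α β γ a b c ha hb hc
    change 𝔏.cls (E k l (𝒟.left (𝒟.left a b) c)) (E i j e)
      = _ • 𝔏.cls (E k l (𝒟.left (𝒟.left a c) b)) (E i j e)
    rw [hl' _ hb, 𝒟.left_assoc, hl' _ (𝒟.left_mem _ _ _ hb _ hc), S.cls_left_left hv a hb hc,
      hi, hl, hj, CharTwo.add_self_eq_zero, CharTwo.add_cancel_left, sgn_zero_right, mul_one,
      zero_add, smul_smul, smul_smul]
    congr 1
    clear ha hb hc
    revert β γ
    decide

end SteinbergFamily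

/-! ### The crossed part of the homology -/

namespace Superdialgebra

variable {R D : Type*} [CommRing R] [AddCommGroup D] [Module R D] {m n : ℕ}

section Forms

variable {𝒟 : Superdialgebra R D}

/-- The parity of `entryForm` is the sum of the parities of its indices. -/
theorem entryForm_isEven {N : ℕ} {C : SuperGrading R (𝒟.Quo N)} {w : ZMod 2}
    (hC : ∀ q, C.deg q = (𝒟.gradingQuo N).deg (q + w)) {i j k l : Fin m ⊕ Fin n}
    (hw : idx i + idx j + idx k + idx l = w) :
    IsEven ((𝒟.gl m n).tensor (𝒟.gl m n).toSuperGrading) C (𝒟.entryForm N i j k l) := by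
  refine isEven_tensor fun p q x hx y hy => ?_
  rw [hC, entryForm_tmul, ← hw]
  exact 𝒟.mkQ_left_mem N hx hy

theorem form₂_isEven {C : SuperGrading R (𝒟.Quo 2)} {w : ZMod 2}
    (hC : ∀ q, C.deg q = (𝒟.gradingQuo 2).deg (q + w)) {k l i j : Fin m ⊕ Fin n}
    (hw : idx k + idx l + idx i + idx j = w) :
    IsEven ((𝒟.gl m n).tensor (𝒟.gl m n).toSuperGrading) C (𝒟.form₂ k l i j) := by
  refine (((entryForm_isEven hC hw).add (entryForm_isEven hC ?_)).add
    (entryForm_isEven hC ?_)).add (entryForm_isEven hC ?_) <;> rw [← hw] <;> ring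

theorem form₃_isEven {C : SuperGrading R (𝒟.Quo 3)} {w : ZMod 2}
    (hC : ∀ q, C.deg q = (𝒟.gradingQuo 3).deg (q + w)) {k l i j : Fin m ⊕ Fin n}
    (hw : idx k + idx l + idx i + idx j = w) :
    IsEven ((𝒟.gl m n).tensor (𝒟.gl m n).toSuperGrading) C (𝒟.form₃ k l i j) := by
  refine (entryForm_isEven hC hw).sub (entryForm_isEven hC ?_)
  rw [← hw]
  ring

theorem form₀_isEven {C : SuperGrading R (𝒟.Quo 0)} {w : ZMod 2}
    (hC : ∀ q, C.deg q = (𝒟.gradingQuo 0).deg (q + w)) {k l i j : Fin m ⊕ Fin n}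
    (hw : idx k + idx l + idx i + idx j = w) :
    IsEven ((𝒟.gl m n).tensor (𝒟.gl m n).toSuperGrading) C (𝒟.form₀ k l i j) := by
  have h : IsEven (𝒟.gl m n).toSuperGrading (𝒟.gl m n).toSuperGrading (𝒟.gl m n).parity := by
    intro q x hx
    rw [parity_of_mem _ hx]
    exact zsmul_mem hx _
  have h' : IsEven ((𝒟.gl m n).tensor (𝒟.gl m n).toSuperGrading) C (𝒟.entryForm 0 k l i j
      + 𝒟.entryForm 0 i j k l - 𝒟.entryForm 0 k j i l - 𝒟.entryForm 0 i l k j) := by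
    refine (((entryForm_isEven hC hw).add (entryForm_isEven hC ?_)).sub
      (entryForm_isEven hC ?_)).sub (entryForm_isEven hC ?_) <;> rw [← hw] <;> ring
  exact (h'.comp (h.lTensor (A := (𝒟.gl m n).toSuperGrading))).neg

/-- The quadruple `(p, q, r, u)` arises from `(k, l, i, j)` by exchanging rows and exchanging
columns. -/
def IsArrangement {ι : Type*} (k l i j p q r u : ι) : Prop :=
  (p = k ∧ q = l ∧ r = i ∧ u = j) ∨ (p = i ∧ q = j ∧ r = k ∧ u = l) ∨
    (p = k ∧ q = j ∧ r = i ∧ u = l) ∨ (p = i ∧ q = l ∧ r = k ∧ u = j)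

instance {ι : Type*} [DecidableEq ι] (k l i j p q r u : ι) :
    Decidable (IsArrangement k l i j p q r u) := by
  unfold IsArrangement
  infer_instance

variable {k l i j p q r u : Fin m ⊕ Fin n}

theorem form₂_single_eq_zero (h : ¬IsArrangement k l i j p q r u) (a b : D) :
    𝒟.form₂ k l i j (Matrix.single p q a ⊗ₜ Matrix.single r u b) = 0 := by
  rw [IsArrangement, not_or, not_or, not_or] at h
  simp only [form₂, LinearMap.add_apply, entryForm_single, if_neg h.1, if_neg h.2.1,
    if_neg h.2.2.1, if_neg h.2.2.2, add_zero]

theorem form₂_single_self (hv : [k, l, i, j].Nodup) (a b : D) :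
    𝒟.form₂ k l i j (Matrix.single k l a ⊗ₜ Matrix.single i j b)
      = (𝒟.idealI 2).mkQ (𝒟.left a b) := by
  simp only [List.nodup_cons, List.mem_cons, List.not_mem_nil, or_false, not_or] at hv
  rw [form₂, LinearMap.add_apply, LinearMap.add_apply, LinearMap.add_apply, entryForm_single,
    entryForm_single, entryForm_single, entryForm_single, if_pos (by tauto), if_neg (by tauto),
    if_neg (by tauto), if_neg (by tauto), add_zero, add_zero, add_zero]

theorem form₀_single_eq_zero (h : ¬IsArrangement k l i j p q r u) (a b : D) :
    𝒟.form₀ k l i j (Matrix.single p q a ⊗ₜ Matrix.single r u b) = 0 := by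
  rw [IsArrangement, not_or, not_or, not_or] at h
  induction b using 𝒟.induction with
  | hadd x y hx hy => rw [Matrix.single_add, TensorProduct.tmul_add, map_add, hx, hy, add_zero]
  | hom β b hb =>
    rw [𝒟.form₀_tmul _ _ _ _ _ (single_mem 𝒟.toSuperGrading r u hb)]
    simp only [entryForm_single, if_neg h.1, if_neg h.2.1, if_neg h.2.2.1, if_neg h.2.2.2, add_zero,
      sub_zero, smul_zero]

theorem form₀_single_self (hv : [k, l, i, j].Nodup) (hij : idx i + idx j = 1) (a : D) {b : D}
    (hb : b ∈ 𝒟.deg 0) : 𝒟.form₀ k l i j (Matrix.single k l a ⊗ₜ Matrix.single i j b)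
      = (𝒟.idealI 0).mkQ (𝒟.left a b) := by
  simp only [List.nodup_cons, List.mem_cons, List.not_mem_nil, or_false, not_or] at hv
  rw [𝒟.form₀_tmul _ _ _ _ _ (single_mem 𝒟.toSuperGrading i j hb), entryForm_single,
    entryForm_single, entryForm_single, entryForm_single, if_pos (by tauto), if_neg (by tauto),
    if_neg (by tauto), if_neg (by tauto), add_zero, sub_zero, sub_zero, hij, add_zero,
    CharTwo.add_self_eq_zero, sgn_zero_left, one_smul]

end Forms

variable {𝒟 : Superdialgebra R D} {e : D}

/-- If all crossed classes vanish, then `HL₂(sl(m, n, D))` is isomorphic to `HHS₁(D)`. -/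
theorem iso_of_cls_eq_zero (S : SteinbergFamily 𝒟 e idx (𝒟.sl m n) (𝒟.root m n))
    (third : ∀ i j : Fin m ⊕ Fin n, ∃ p, i ≠ p ∧ j ≠ p) {o k₀ : Fin m ⊕ Fin n} (hk₀ : o ≠ k₀)
    (h : ∀ i j k l, i ≠ j → k ≠ l → j ≠ k → i ≠ l → ∀ a b,
      (𝒟.sl m n).cls (𝒟.root m n i j a) (𝒟.root m n k l b) = 0) :
    (𝒟.sl m n).gradingHL₂.Iso 𝒟.gradingHHS₁ := by
  have hx : 𝒟.crossed m n ≤ LinearMap.range (𝒟.sl m n).δ₃ := by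
    refine Submodule.span_le.2 ?_
    rintro _ ⟨i, j, k, l, a, b, hij, hkl, hjk, hil, rfl⟩
    exact (Submodule.Quotient.mk_eq_zero _).1 (h i j k l hij hkl hjk hil a b)
  refine (iso_of_crossed ((𝒟.gradingQuo 0).copies 0) S third hk₀ 0 (fun i x _ => ?_)
    (fun t => rfl) (fun i j _ a b => rfl) (fun y => ⟨0, zero_mem _, Subsingleton.elim _ _⟩)
    fun t ht _ => hx ht).trans (iso_prod_of_subsingleton _ _)
  rw [LinearMap.zero_apply]
  exact zero_mem _

/-- If the crossed classes are spanned by families `E_kl(c) ⊗ E_ij(1)`, one for each `s`, which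
factor through `D_N` and are separated by cocycles `F s` with values in `D_N`, then
`HL₂(sl(m, n, D))` is isomorphic to the direct sum of `HHS₁(D)` and of the modules `D_N`. -/
theorem iso_of_representatives {I M : Type*} [Fintype I] [AddCommGroup M] [Module R M]
    (𝓜 : SuperGrading R M) (S : SteinbergFamily 𝒟 e idx (𝒟.sl m n) (𝒟.root m n))
    (third : ∀ i j : Fin m ⊕ Fin n, ∃ p, i ≠ p ∧ j ≠ p) {o k₀ : Fin m ⊕ Fin n} (hk₀ : o ≠ k₀)
    {k l i j : I → Fin m ⊕ Fin n} (hkl : ∀ s, k s ≠ l s) (hij : ∀ s, i s ≠ j s)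
    (hli : ∀ s, l s ≠ i s) (hkj : ∀ s, k s ≠ j s) (N : I → ℕ)
    (F : ∀ s, Matrix (Fin m ⊕ Fin n) (Fin m ⊕ Fin n) D ⊗[R]
      Matrix (Fin m ⊕ Fin n) (Fin m ⊕ Fin n) D →ₗ[R] 𝒟.Quo (N s))
    (φ : (∀ s, 𝒟.Quo (N s)) ≃ₗ[R] M)
    (hF : ∀ q, ∀ t ∈ ((𝒟.gl m n).tensor (𝒟.gl m n).toSuperGrading).deg q,
      φ (fun s => F s t) ∈ 𝓜.deg q)
    (hδ : ∀ s t, F s ((𝒟.gl m n).incl₂ ((𝒟.sl m n).δ₃ t)) = 0)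
    (hH : ∀ s p q, p ≠ q → ∀ a b, F s (Matrix.single p q a ⊗ₜ Matrix.single q p b) = 0)
    (hself : ∀ s c, F s (Matrix.single (k s) (l s) c ⊗ₜ Matrix.single (i s) (j s) e)
      = (𝒟.idealI (N s)).mkQ c)
    (hne : ∀ s t, s ≠ t → ∀ c,
      F t (Matrix.single (k s) (l s) c ⊗ₜ Matrix.single (i s) (j s) e) = 0)
    (hker : ∀ s, 𝒟.idealI (N s) ≤ LinearMap.ker
      ((𝒟.sl m n).cls.flip (𝒟.root m n (i s) (j s) e) ∘ₗ 𝒟.root m n (k s) (l s)))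
    (hcover : ∀ W : Submodule R _, (∀ s c, (𝒟.sl m n).cls (𝒟.root m n (k s) (l s) c)
        (𝒟.root m n (i s) (j s) e) ∈ W) →
      ∀ p q r u, p ≠ q → r ≠ u → q ≠ r → p ≠ u → ∀ a b,
        (𝒟.sl m n).cls (𝒟.root m n p q a) (𝒟.root m n r u b) ∈ W) :
    (𝒟.sl m n).gradingHL₂.Iso (𝒟.gradingHHS₁.prod 𝓜) := by
  classical
  have he := S.bar
  let G : (𝒟.gl m n).commutator ⊗[R] (𝒟.gl m n).commutator →ₗ[R] ∀ s, 𝒟.Quo (N s) :=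
    LinearMap.pi fun s => F s ∘ₗ (𝒟.gl m n).incl₂
  have hG : ∀ t s, G t s = F s ((𝒟.gl m n).incl₂ t) := fun t s => rfl
  let X : (I → D) →ₗ[R] (𝒟.gl m n).commutator ⊗[R] (𝒟.gl m n).commutator :=
    ∑ s, (TensorProduct.mk R _ _).flip (𝒟.root m n (i s) (j s) e) ∘ₗ 𝒟.root m n (k s) (l s) ∘ₗ
      LinearMap.proj s
  have hX : ∀ c, X c = ∑ s, 𝒟.root m n (k s) (l s) (c s) ⊗ₜ[R] 𝒟.root m n (i s) (j s) e :=
    fun c => LinearMap.sum_apply _ _ _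
  have hXc : ∀ c, X c ∈ 𝒟.crossed m n := by
    intro c
    rw [hX]
    exact sum_mem fun s _ => tmul_root_mem_crossed (hkl s) (hij s) (hli s) (hkj s) _ _
  have hGX : ∀ c, G (X c) = fun s => (𝒟.idealI (N s)).mkQ (c s) := by
    intro c
    funext t
    rw [hG, hX, map_sum, map_sum, Finset.sum_eq_single t]
    · rw [incl₂_tmul_root he (hkl t) (hij t), hself]
    · intro s _ hs
      rw [incl₂_tmul_root he (hkl s) (hij s), hne s t hs]
    · simp
  let V := LinearMap.range X ⊔ LinearMap.range (𝒟.sl m n).δ₃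
  have hXV : ∀ s c, (𝒟.sl m n).cls (𝒟.root m n (k s) (l s) c)
      (𝒟.root m n (i s) (j s) e) ∈ V.map (LinearMap.range (𝒟.sl m n).δ₃).mkQ := by
    intro s c
    have h : X (Pi.single s c)
        = 𝒟.root m n (k s) (l s) c ⊗ₜ[R] 𝒟.root m n (i s) (j s) e := by
      rw [hX, Finset.sum_eq_single s, Pi.single_eq_same]
      · intro t _ ht
        rw [Pi.single_eq_of_ne ht, map_zero, TensorProduct.zero_tmul]
      · simp
    exact Submodule.mem_map_of_mem (Submodule.mem_sup_left ⟨_, h⟩)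
  have hxV : 𝒟.crossed m n ≤ V := by
    refine Submodule.span_le.2 ?_
    rintro _ ⟨p, q, r, u, a, b, hpq, hru, hqr, hpu, rfl⟩
    obtain ⟨v, hv, hvt⟩ := hcover _ hXV p q r u hpq hru hqr hpu a b
    rw [LeibnizSuperalgebra.cls_apply, eq_comm, ← sub_eq_zero, ← map_sub, Submodule.mkQ_apply,
      Submodule.Quotient.mk_eq_zero] at hvt
    obtain ⟨w, hw⟩ := hvt
    have h : 𝒟.root m n p q a ⊗ₜ[R] 𝒟.root m n r u b = v + (𝒟.sl m n).δ₃ w := by rw [hw]; abel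
    rw [h]
    exact add_mem hv (Submodule.mem_sup_right ⟨w, rfl⟩)
  refine iso_of_crossed 𝓜 S third hk₀ (φ.toLinearMap ∘ₗ G) ?_ ?_ ?_ ?_ ?_
  · intro q t ht
    exact hF q _ ((𝒟.gl m n).incl₂_isEven q t ht)
  · intro t
    rw [LinearMap.comp_apply, show G ((𝒟.sl m n).δ₃ t) = 0 from funext fun s => hδ s t, map_zero]
  · intro p q hpq a b
    have h : G (𝒟.root m n p q a ⊗ₜ 𝒟.root m n q p b) = 0 := by
      funext s
      rw [hG, incl₂_tmul_root he hpq hpq.symm, hH s p q hpq, Pi.zero_apply]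
    rw [LinearMap.comp_apply, h, map_zero]
  · intro y
    choose c hc using fun s => Submodule.mkQ_surjective (𝒟.idealI (N s)) (φ.symm y s)
    refine ⟨X c, hXc c, ?_⟩
    rw [LinearMap.comp_apply, hGX, funext hc]
    exact φ.apply_symm_apply y
  · intro t ht hft
    obtain ⟨_, ⟨c, rfl⟩, _, ⟨r, rfl⟩, rfl⟩ := Submodule.mem_sup.1 (hxV ht)
    have hGt : G (X c + (𝒟.sl m n).δ₃ r) = 0 := φ.map_eq_zero_iff.1 hft
    rw [map_add, show G ((𝒟.sl m n).δ₃ r) = 0 from funext fun s => hδ s r, add_zero, hGX] at hGt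
    refine add_mem ?_ ⟨r, rfl⟩
    rw [hX]
    refine sum_mem fun s _ => ?_
    have hs : (𝒟.idealI (N s)).mkQ (c s) = 0 := congrFun hGt s
    rw [Submodule.mkQ_apply, Submodule.Quotient.mk_eq_zero] at hs
    have h : (𝒟.sl m n).cls (𝒟.root m n (k s) (l s) (c s)) (𝒟.root m n (i s) (j s) e) = 0 :=
      hker s hs
    exact (Submodule.Quotient.mk_eq_zero _).1 h

end Superdialgebra

/-! ### The exceptional cases -/

namespace SteinbergFamily

variable {R D L ι : Type*} [CommRing R] [AddCommGroup D] [Module R D]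
  [AddCommGroup L] [Module R L] {𝒟 : Superdialgebra R D} {e : D} {par : ι → ZMod 2}
  {𝔏 : LeibnizSuperalgebra R L} {E : ι → ι → D →ₗ[R] L} {k l i j : ι}

theorem idealI_three_le_ker (S : SteinbergFamily 𝒟 e par 𝔏 E) (hpar : ∀ s, par s = 0)
    (hv : (i = k ∧ [k, l, j].Nodup) ∨ (j = l ∧ [l, k, i].Nodup)) :
    𝒟.idealI 3 ≤ LinearMap.ker (𝔏.cls.flip (E i j e) ∘ₗ E k l) := by
  simp only [List.nodup_cons, List.mem_cons, List.not_mem_nil, or_false, not_or] at hv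
  rcases hv with ⟨rfl, ⟨h₁, h₂⟩, h₃, -⟩ | ⟨rfl, ⟨h₁, h₂⟩, h₃, -⟩
  · exact (S.cls_row h₁ h₂ h₃ (by rw [hpar, hpar]) (by rw [hpar, hpar])).2
  · exact (S.cls_column h₁ h₂ h₃ (by rw [hpar, hpar]) (by rw [hpar, hpar])).2

theorem cls_three_mem (S : SteinbergFamily 𝒟 e par 𝔏 E) (hpar : ∀ s, par s = 0)
    (hv : (i = k ∧ [k, l, j].Nodup) ∨ (j = l ∧ [l, k, i].Nodup)) {W : Submodule R _}
    (hW : ∀ c, 𝔏.cls (E k l c) (E i j e) ∈ W) (b a : D) :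
    𝔏.cls (E k l b) (E i j a) ∈ W ∧ 𝔏.cls (E i j b) (E k l a) ∈ W := by
  simp only [List.nodup_cons, List.mem_cons, List.not_mem_nil, or_false, not_or] at hv
  rcases hv with ⟨rfl, ⟨h₁, h₂⟩, h₃, -⟩ | ⟨rfl, ⟨h₁, h₂⟩, h₃, -⟩
  · exact S.cls_row_mem h₁ h₂ h₃ (by rw [hpar, hpar]) (by rw [hpar, hpar]) hW b a
  · exact S.cls_column_mem h₁ h₂ h₃ (by rw [hpar, hpar]) (by rw [hpar, hpar]) hW b a

end SteinbergFamily

/-- Representatives `(vertex 0 s, vertex 1 s, vertex 2 s, vertex 3 s)` of the six classes of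
arrangements of four indices: such a class amounts to the choice of two rows among four indices.
The last two classes are those with rows `{0, 1}` and `{2, 3}`. -/
def vertex : Fin 4 → Fin 6 → Fin 4 :=
  ![![0, 1, 0, 1, 0, 2], ![1, 0, 1, 0, 2, 0], ![2, 3, 3, 2, 1, 3], ![3, 2, 2, 3, 3, 1]]

namespace Superdialgebra

theorem nodup_vertex : ∀ s, [vertex 0 s, vertex 1 s, vertex 2 s, vertex 3 s].Nodup := by
  decide

theorem mem_vertex : ∀ s x, x ∈ [vertex 0 s, vertex 1 s, vertex 2 s, vertex 3 s] := by
  decide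

theorem eq_of_isArrangement_vertex : ∀ s t, IsArrangement (vertex 0 t) (vertex 1 t) (vertex 2 t)
    (vertex 3 t) (vertex 0 s) (vertex 1 s) (vertex 2 s) (vertex 3 s) → s = t := by
  decide

theorem exists_isArrangement_vertex : ∀ p q r u : Fin 4, p ≠ q → r ≠ u → q ≠ r → p ≠ u →
    (∃ x, p ≠ x ∧ x ≠ q ∧ x ≠ r ∧ x ≠ u) ∨
      ∃ s, IsArrangement (vertex 0 s) (vertex 1 s) (vertex 2 s) (vertex 3 s) p q r u := by
  decide

variable {R D : Type*} [CommRing R] [AddCommGroup D] [Module R D] {m n : ℕ}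
  {𝒟 : Superdialgebra R D} {e : D}

theorem nodup_map_vertex (v : Fin 4 ≃ Fin m ⊕ Fin n) (s : Fin 6) :
    [v (vertex 0 s), v (vertex 1 s), v (vertex 2 s), v (vertex 3 s)].Nodup :=
  (nodup_vertex s).map v.injective

theorem mem_map_vertex (v : Fin 4 ≃ Fin m ⊕ Fin n) (s : Fin 6) (x) :
    x ∈ [v (vertex 0 s), v (vertex 1 s), v (vertex 2 s), v (vertex 3 s)] := by
  have h := List.mem_map_of_mem (f := v) (mem_vertex s (v.symm x))
  rwa [v.apply_symm_apply] at h

/-- The case of four indices, with cocycles `F s` supported on the arrangements of the vertex class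
`σ s`: all other crossed classes vanish because one of the four indices is not involved. -/
theorem iso_of_four {I M : Type*} [Fintype I] [AddCommGroup M] [Module R M]
    (𝓜 : SuperGrading R M) (S : SteinbergFamily 𝒟 e idx (𝒟.sl m n) (𝒟.root m n))
    (v : Fin 4 ≃ Fin m ⊕ Fin n) (σ : I ≃ Fin 6) (N : I → ℕ)
    (F : ∀ s, Matrix (Fin m ⊕ Fin n) (Fin m ⊕ Fin n) D ⊗[R]
      Matrix (Fin m ⊕ Fin n) (Fin m ⊕ Fin n) D →ₗ[R] 𝒟.Quo (N s))
    (φ : (∀ s, 𝒟.Quo (N s)) ≃ₗ[R] M)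
    (hF : ∀ q, ∀ t ∈ ((𝒟.gl m n).tensor (𝒟.gl m n).toSuperGrading).deg q,
      φ (fun s => F s t) ∈ 𝓜.deg q)
    (hδ : ∀ s t, F s ((𝒟.gl m n).incl₂ ((𝒟.sl m n).δ₃ t)) = 0)
    (hzero : ∀ s p q r u, ¬IsArrangement (v (vertex 0 (σ s))) (v (vertex 1 (σ s)))
      (v (vertex 2 (σ s))) (v (vertex 3 (σ s))) p q r u →
      ∀ a b, F s (Matrix.single p q a ⊗ₜ Matrix.single r u b) = 0)
    (hself : ∀ s c, F s (Matrix.single (v (vertex 0 (σ s))) (v (vertex 1 (σ s))) c ⊗ₜ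
      Matrix.single (v (vertex 2 (σ s))) (v (vertex 3 (σ s))) e) = (𝒟.idealI (N s)).mkQ c)
    (hker : ∀ s, 𝒟.idealI (N s) ≤ LinearMap.ker
      ((𝒟.sl m n).cls.flip (𝒟.root m n (v (vertex 2 (σ s))) (v (vertex 3 (σ s))) e) ∘ₗ
        𝒟.root m n (v (vertex 0 (σ s))) (v (vertex 1 (σ s))))) :
    (𝒟.sl m n).gradingHL₂.Iso (𝒟.gradingHHS₁.prod 𝓜) := by
  have third : ∀ i j : Fin m ⊕ Fin n, ∃ p, i ≠ p ∧ j ≠ p := by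
    intro i j
    have h : ∀ i j : Fin 4, ∃ p, i ≠ p ∧ j ≠ p := by decide
    obtain ⟨p, h₁, h₂⟩ := h (v.symm i) (v.symm j)
    exact ⟨v p, fun h => h₁ (by rw [h, v.symm_apply_apply]),
      fun h => h₂ (by rw [h, v.symm_apply_apply])⟩
  have hv : ∀ s, (v (vertex 0 s) ≠ v (vertex 1 s) ∧ v (vertex 0 s) ≠ v (vertex 2 s) ∧
      v (vertex 0 s) ≠ v (vertex 3 s)) ∧ (v (vertex 1 s) ≠ v (vertex 2 s) ∧
      v (vertex 1 s) ≠ v (vertex 3 s)) ∧ v (vertex 2 s) ≠ v (vertex 3 s) :=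
    fun s => by simpa [-EmbeddingLike.apply_eq_iff_eq] using nodup_map_vertex v s
  refine iso_of_representatives 𝓜 S third (v.injective.ne (show (0 : Fin 4) ≠ 1 by decide))
    (fun s => (hv (σ s)).1.1) (fun s => (hv (σ s)).2.2) (fun s => (hv (σ s)).2.1.1)
    (fun s => (hv (σ s)).1.2.2) N F φ hF hδ ?_ hself ?_ hker ?_
  · intro s p q hpq a b
    refine hzero s _ _ _ _ ?_ a b
    obtain ⟨⟨h₁, h₂, h₃⟩, ⟨h₄, h₅⟩, h₆⟩ := hv (σ s)
    rintro (⟨h, h', h'', -⟩ | ⟨h, h', h'', -⟩ | ⟨h, h', h'', -⟩ | ⟨h, h', h'', -⟩)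
    · exact h₄ (h'.symm.trans h'')
    · exact h₃ (h''.symm.trans h')
    · exact h₆ (h''.symm.trans h')
    · exact h₁ (h''.symm.trans h')
  · intro s t hst c
    refine hzero t _ _ _ _ (fun h => hst (σ.injective (eq_of_isArrangement_vertex _ _ ?_))) _ _
    simpa only [IsArrangement, v.injective.eq_iff] using h
  · intro W hW p q r u hpq hru hqr hpu a b
    obtain ⟨p, rfl⟩ := v.surjective p
    obtain ⟨q, rfl⟩ := v.surjective q
    obtain ⟨r, rfl⟩ := v.surjective r
    obtain ⟨u, rfl⟩ := v.surjective u
    rw [v.injective.ne_iff] at hpq hru hqr hpu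
    rcases exists_isArrangement_vertex p q r u hpq hru hqr hpu with ⟨x, h₁, h₂, h₃, h₄⟩ | ⟨s, hs⟩
    · rw [S.cls_eq_zero (v.injective.ne hpq) (v.injective.ne hru) (v.injective.ne hqr)
        (v.injective.ne hpu) (v.injective.ne h₁) (v.injective.ne h₂) (v.injective.ne h₃)
        (v.injective.ne h₄)]
      exact zero_mem _
    · obtain ⟨s, rfl⟩ := σ.surjective s
      obtain ⟨h₁, h₂, h₃, h₄⟩ := S.cls_four_mem (nodup_map_vertex v (σ s)) (hW s) a b
      rcases hs with ⟨rfl, rfl, rfl, rfl⟩ | ⟨rfl, rfl, rfl, rfl⟩ | ⟨rfl, rfl, rfl, rfl⟩ |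
        ⟨rfl, rfl, rfl, rfl⟩
      exacts [h₁, h₄, h₃, h₂]

/-- Four indices, when every vertex class has a row and a column of the same parity: all classes
take values in `D_2`, up to a parity shift by the total parity `w` of the indices. -/
theorem iso_of_four_of_idx_eq {C : SuperGrading R (𝒟.Quo 2)} {w : ZMod 2}
    (hC : ∀ q, C.deg q = (𝒟.gradingQuo 2).deg (q + w))
    (S : SteinbergFamily 𝒟 e idx (𝒟.sl m n) (𝒟.root m n)) (v : Fin 4 ≃ Fin m ⊕ Fin n)
    (hv : ∀ s, idx (v (vertex 1 s)) = idx (v (vertex 0 s)))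
    (hw : ∀ s, idx (v (vertex 0 s)) + idx (v (vertex 1 s)) + idx (v (vertex 2 s))
      + idx (v (vertex 3 s)) = w) :
    (𝒟.sl m n).gradingHL₂.Iso (𝒟.gradingHHS₁.prod (C.copies 6)) := by
  refine iso_of_four (C.copies 6) S v (Equiv.refl _) (fun _ => 2) (fun s => 𝒟.form₂
    (v (vertex 0 s)) (v (vertex 1 s)) (v (vertex 2 s)) (v (vertex 3 s))) (LinearEquiv.refl R _)
    ?_ ?_ ?_ ?_ ?_
  · intro q t ht s _
    exact form₂_isEven hC (hw s) q t ht
  · intro s t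
    exact 𝒟.form₂_cocycle (nodup_map_vertex v s) (mem_map_vertex v s) t
  · intro s p q r u h a b
    exact form₂_single_eq_zero h a b
  · intro s c
    exact (form₂_single_self (nodup_map_vertex v s) c e).trans (by rw [(S.bar c).1])
  · intro s
    exact S.idealI_two_le_ker (nodup_map_vertex v s) (hv s)

theorem steinbergFamily_root_of_three_le (he : 𝒟.IsBarUnit e) (he' : e ∈ 𝒟.deg 0)
    (h : 3 ≤ m + n) : (∀ i j : Fin m ⊕ Fin n, ∃ p, i ≠ p ∧ j ≠ p) ∧
      SteinbergFamily 𝒟 e idx (𝒟.sl m n) (𝒟.root m n) := by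
  have third : ∀ i j : Fin m ⊕ Fin n, ∃ p, i ≠ p ∧ j ≠ p := by
    intro i j
    obtain ⟨p, -, hp⟩ := Finset.exists_mem_notMem_of_card_lt_card (s := {i, j})
      (t := Finset.univ) (Finset.card_le_two.trans_lt (by
        rw [Finset.card_univ, Fintype.card_sum, Fintype.card_fin, Fintype.card_fin]; omega))
    simp only [Finset.mem_insert, Finset.mem_singleton, not_or] at hp
    exact ⟨p, Ne.symm hp.1, Ne.symm hp.2⟩
  exact ⟨third, steinbergFamily_root he he' third⟩

theorem iso_four_zero (he : 𝒟.IsBarUnit e) (he' : e ∈ 𝒟.deg 0) :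
    (𝒟.sl 4 0).gradingHL₂.Iso (𝒟.gradingHHS₁.prod ((𝒟.gradingQuo 2).copies 6)) :=
  iso_of_four_of_idx_eq (w := 0) (fun q => by rw [add_zero])
    (steinbergFamily_root_of_three_le he he' (by norm_num)).2
    (finSumFinEquiv (m := 4) (n := 0)).symm (by decide) (by decide)

theorem iso_three_one (he : 𝒟.IsBarUnit e) (he' : e ∈ 𝒟.deg 0) :
    (𝒟.sl 3 1).gradingHL₂.Iso
      (𝒟.gradingHHS₁.prod ((𝒟.gradingQuo 2).parityChange.copies 6)) :=
  iso_of_four_of_idx_eq (w := 1) (fun q => rfl)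
    (steinbergFamily_root_of_three_le he he' (by norm_num)).2
    (finSumFinEquiv (m := 3) (n := 1)).symm (by decide) (by decide)

/-- The last two vertex classes have rows of one parity and columns of the other, and contribute
`D_0` instead of `D_2`. -/
theorem iso_two_two (he : 𝒟.IsBarUnit e) (he' : e ∈ 𝒟.deg 0) :
    (𝒟.sl 2 2).gradingHL₂.Iso (𝒟.gradingHHS₁.prod
      (((𝒟.gradingQuo 2).copies 4).prod ((𝒟.gradingQuo 0).copies 2))) := by
  have S := (steinbergFamily_root_of_three_le (m := 2) (n := 2) he he' (by norm_num)).2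
  let v : Fin 4 ≃ Fin 2 ⊕ Fin 2 := (finSumFinEquiv (m := 2) (n := 2)).symm
  let σ : Fin 4 ⊕ Fin 2 ≃ Fin 6 := finSumFinEquiv
  have hl : ∀ s : Fin 4, idx (v (vertex 1 (σ (.inl s)))) = idx (v (vertex 0 (σ (.inl s)))) := by
    decide
  have hw : ∀ s : Fin 6, idx (v (vertex 0 s)) + idx (v (vertex 1 s)) + idx (v (vertex 2 s))
      + idx (v (vertex 3 s)) = 0 := by decide
  have h₀ : ∀ s : Fin 2, idx (v (vertex 2 (σ (.inr s)))) = idx (v (vertex 0 (σ (.inr s)))) ∧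
      idx (v (vertex 1 (σ (.inr s)))) = idx (v (vertex 0 (σ (.inr s)))) + 1 ∧
      idx (v (vertex 3 (σ (.inr s)))) = idx (v (vertex 0 (σ (.inr s)))) + 1 ∧
      idx (v (vertex 2 (σ (.inr s)))) + idx (v (vertex 3 (σ (.inr s)))) = 1 := by decide
  let N : Fin 4 ⊕ Fin 2 → ℕ := Sum.elim (fun _ => 2) fun _ => 0
  let F : ∀ s, Matrix (Fin 2 ⊕ Fin 2) (Fin 2 ⊕ Fin 2) D ⊗[R]
      Matrix (Fin 2 ⊕ Fin 2) (Fin 2 ⊕ Fin 2) D →ₗ[R] 𝒟.Quo (N s) := fun s => match s with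
    | .inl s => 𝒟.form₂ (v (vertex 0 (σ (.inl s)))) (v (vertex 1 (σ (.inl s))))
      (v (vertex 2 (σ (.inl s)))) (v (vertex 3 (σ (.inl s))))
    | .inr s => 𝒟.form₀ (v (vertex 0 (σ (.inr s)))) (v (vertex 1 (σ (.inr s))))
      (v (vertex 2 (σ (.inr s)))) (v (vertex 3 (σ (.inr s))))
  refine iso_of_four _ S v σ N F
    (LinearEquiv.sumPiEquivProdPi R (Fin 4) (Fin 2) fun s => 𝒟.Quo (N s)) ?_ ?_ ?_ ?_ ?_
  · intro q t ht
    refine ⟨fun s _ => ?_, fun s _ => ?_⟩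
    · exact form₂_isEven (fun q => by rw [add_zero]) (hw _) q t ht
    · exact form₀_isEven (fun q => by rw [add_zero]) (hw _) q t ht
  · rintro (s | s) t
    · exact 𝒟.form₂_cocycle (nodup_map_vertex v _) (mem_map_vertex v _) t
    · exact 𝒟.form₀_cocycle (nodup_map_vertex v _) (mem_map_vertex v _) (h₀ s).1 (h₀ s).2.1
        (h₀ s).2.2.1 t
  · rintro (s | s) p q r u h a b
    · exact form₂_single_eq_zero h a b
    · exact form₀_single_eq_zero h a b
  · rintro (s | s) c
    · exact (form₂_single_self (nodup_map_vertex v _) c e).trans (by rw [(he c).1]; rfl)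
    · exact (form₀_single_self (nodup_map_vertex v _) (h₀ s).2.2.2 c he').trans
        (by rw [(he c).1]; rfl)
  · rintro (s | s)
    · exact S.idealI_two_le_ker (nodup_map_vertex v _) (hl s)
    · exact S.idealI_zero_le_ker (nodup_map_vertex v _) (h₀ s).1 (h₀ s).2.1 (h₀ s).2.2.1

/-- Representatives `(vertex₃ 0 s, vertex₃ 1 s, vertex₃ 2 s, vertex₃ 3 s)` of the crossed pairs of
roots for three indices, up to exchanging the two roots. The two roots lie in a common row for the
first three and in a common column for the last three. -/
def vertex₃ : Fin 4 → Fin 6 → Fin 3 :=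
  ![![0, 1, 2, 1, 2, 0], ![1, 2, 0, 0, 1, 2], ![0, 1, 2, 2, 0, 1], ![2, 0, 1, 0, 1, 2]]

theorem vertex₃_row_or_column : ∀ s,
    (vertex₃ 2 s = vertex₃ 0 s ∧ [vertex₃ 0 s, vertex₃ 1 s, vertex₃ 3 s].Nodup) ∨
      (vertex₃ 3 s = vertex₃ 1 s ∧ [vertex₃ 1 s, vertex₃ 0 s, vertex₃ 2 s].Nodup) := by
  decide

theorem mem_of_nodup_three : ∀ p q r : Fin 3, [p, q, r].Nodup → ∀ x, x ∈ [p, q, r] := by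
  decide

theorem exists_vertex₃ : ∀ p q r u : Fin 3, p ≠ q → r ≠ u → q ≠ r → p ≠ u →
    (∃ x, p ≠ x ∧ x ≠ q ∧ x ≠ r ∧ x ≠ u) ∨ ∃ s,
      (p = vertex₃ 0 s ∧ q = vertex₃ 1 s ∧ r = vertex₃ 2 s ∧ u = vertex₃ 3 s) ∨
      (p = vertex₃ 2 s ∧ q = vertex₃ 3 s ∧ r = vertex₃ 0 s ∧ u = vertex₃ 1 s) := by
  decide

theorem vertex₃_separated : ∀ s t, s ≠ t → ¬((vertex₃ 0 s = vertex₃ 0 t ∧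
    vertex₃ 1 s = vertex₃ 1 t ∧ vertex₃ 2 s = vertex₃ 2 t ∧ vertex₃ 3 s = vertex₃ 3 t) ∨
      (vertex₃ 0 s = vertex₃ 2 t ∧ vertex₃ 1 s = vertex₃ 3 t ∧ vertex₃ 2 s = vertex₃ 0 t ∧
        vertex₃ 3 s = vertex₃ 1 t)) := by
  decide

theorem form₃_single_eq_zero {k l i j p q r u : Fin m ⊕ Fin n}
    (h : ¬((p = k ∧ q = l ∧ r = i ∧ u = j) ∨ (p = i ∧ q = j ∧ r = k ∧ u = l))) (a b : D) :
    𝒟.form₃ k l i j (Matrix.single p q a ⊗ₜ Matrix.single r u b) = 0 := by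
  rw [not_or] at h
  rw [form₃, LinearMap.sub_apply, entryForm_single, entryForm_single, if_neg h.1, if_neg h.2,
    sub_zero]

theorem form₃_single_self {k l i j : Fin m ⊕ Fin n} (h : ¬(k = i ∧ l = j)) (a b : D) :
    𝒟.form₃ k l i j (Matrix.single k l a ⊗ₜ Matrix.single i j b)
      = (𝒟.idealI 3).mkQ (𝒟.left a b) := by
  rw [form₃, LinearMap.sub_apply, entryForm_single, entryForm_single, if_pos ⟨rfl, rfl, rfl, rfl⟩,
    if_neg (by tauto), sub_zero]

/-- The case of three indices of the same parity. The hypotheses on `k`, `l`, `i` and `j` say that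
they list the crossed pairs of roots up to exchanging the two roots. -/
theorem iso_of_three (S : SteinbergFamily 𝒟 e idx (𝒟.sl m n) (𝒟.root m n))
    (third : ∀ i j : Fin m ⊕ Fin n, ∃ p, i ≠ p ∧ j ≠ p) {o k₀ : Fin m ⊕ Fin n} (hk₀ : o ≠ k₀)
    (hidx : ∀ s : Fin m ⊕ Fin n, (idx s : ZMod 2) = 0)
    (hmem : ∀ p q r : Fin m ⊕ Fin n, [p, q, r].Nodup → ∀ x, x ∈ [p, q, r])
    {k l i j : Fin 6 → Fin m ⊕ Fin n}
    (hv : ∀ s, (i s = k s ∧ [k s, l s, j s].Nodup) ∨ (j s = l s ∧ [l s, k s, i s].Nodup))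
    (hsep : ∀ s t, s ≠ t → ¬((k s = k t ∧ l s = l t ∧ i s = i t ∧ j s = j t) ∨
      (k s = i t ∧ l s = j t ∧ i s = k t ∧ j s = l t)))
    (hcover : ∀ p q r u : Fin m ⊕ Fin n, p ≠ q → r ≠ u → q ≠ r → p ≠ u →
      (∃ x, p ≠ x ∧ x ≠ q ∧ x ≠ r ∧ x ≠ u) ∨ ∃ s,
        (p = k s ∧ q = l s ∧ r = i s ∧ u = j s) ∨ (p = i s ∧ q = j s ∧ r = k s ∧ u = l s)) :
    (𝒟.sl m n).gradingHL₂.Iso (𝒟.gradingHHS₁.prod ((𝒟.gradingQuo 3).copies 6)) := by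
  have ne : ∀ {p q r : Fin m ⊕ Fin n}, [p, q, r].Nodup → p ≠ q ∧ p ≠ r ∧ q ≠ r := by
    intro p q r h
    simp only [List.nodup_cons, List.mem_cons, List.not_mem_nil, or_false, not_or] at h
    tauto
  have hv' : ∀ s, k s ≠ l s ∧ i s ≠ j s ∧ l s ≠ i s ∧ k s ≠ j s := by
    intro s
    rcases hv s with ⟨h, hs⟩ | ⟨h, hs⟩ <;> obtain ⟨h₁, h₂, h₃⟩ := ne hs <;> rw [h]
    · exact ⟨h₁, h₂, h₁.symm, h₂⟩
    · exact ⟨h₁.symm, h₂.symm, h₂, h₁.symm⟩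
  refine iso_of_representatives ((𝒟.gradingQuo 3).copies 6) S third hk₀ (fun s => (hv' s).1)
    (fun s => (hv' s).2.1) (fun s => (hv' s).2.2.1) (fun s => (hv' s).2.2.2) (fun _ => 3)
    (fun s => 𝒟.form₃ (k s) (l s) (i s) (j s)) (LinearEquiv.refl R _) ?_ ?_ ?_ ?_ ?_
    (fun s => S.idealI_three_le_ker hidx (hv s)) ?_
  · intro q t ht s _
    refine form₃_isEven (fun q => by rw [add_zero]) ?_ q t ht
    rw [hidx, hidx, hidx, hidx, add_zero, add_zero, add_zero]
  · intro s t
    rcases hv s with ⟨h, hs⟩ | ⟨h, hs⟩ <;> rw [h]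
    · exact (𝒟.form₃_cocycle hs (hmem _ _ _ hs) hidx t).1
    · exact (𝒟.form₃_cocycle hs (hmem _ _ _ hs) hidx t).2
  · intro s p q hpq a b
    refine form₃_single_eq_zero ?_ a b
    have h := hv' s
    rintro (⟨-, h₁, h₂, -⟩ | ⟨-, h₁, h₂, -⟩)
    · exact h.2.2.1 (h₁.symm.trans h₂)
    · exact h.2.2.2 (h₂.symm.trans h₁)
  · intro s c
    refine (form₃_single_self ?_ c e).trans (by rw [(S.bar c).1])
    rcases hv s with ⟨h, hs⟩ | ⟨h, hs⟩
    · exact fun h' => (ne hs).2.2 h'.2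
    · exact fun h' => (ne hs).2.2 h'.1
  · intro s t hst c
    exact form₃_single_eq_zero (hsep s t hst) _ _
  · intro W hW p q r u hpq hru hqr hpu a b
    rcases hcover p q r u hpq hru hqr hpu with ⟨x, h₁, h₂, h₃, h₄⟩ |
      ⟨s, ⟨rfl, rfl, rfl, rfl⟩ | ⟨rfl, rfl, rfl, rfl⟩⟩
    · rw [S.cls_eq_zero hpq hru hqr hpu h₁ h₂ h₃ h₄]
      exact zero_mem _
    · exact (S.cls_three_mem hidx (hv s) (hW s) a b).1
    · exact (S.cls_three_mem hidx (hv s) (hW s) a b).2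

theorem iso_three_zero (he : 𝒟.IsBarUnit e) (he' : e ∈ 𝒟.deg 0) :
    (𝒟.sl 3 0).gradingHL₂.Iso (𝒟.gradingHHS₁.prod ((𝒟.gradingQuo 3).copies 6)) := by
  obtain ⟨third, S⟩ := steinbergFamily_root_of_three_le (m := 3) (n := 0) he he' (by norm_num)
  let v : Fin 3 ≃ Fin 3 ⊕ Fin 0 := (finSumFinEquiv (m := 3) (n := 0)).symm
  have hv : Function.Injective v := v.injective
  have hv' : Function.Surjective v := v.surjective
  have hidx : ∀ s : Fin 3 ⊕ Fin 0, (idx s : ZMod 2) = 0 := by decide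
  have hk₀ : v 0 ≠ v 1 := hv.ne (by decide)
  clear_value v
  refine iso_of_three S third hk₀ hidx ?_ (k := fun s => v (vertex₃ 0 s))
    (l := fun s => v (vertex₃ 1 s)) (i := fun s => v (vertex₃ 2 s))
    (j := fun s => v (vertex₃ 3 s)) ?_ ?_ ?_
  · intro p q r h x
    obtain ⟨p, rfl⟩ := hv' p
    obtain ⟨q, rfl⟩ := hv' q
    obtain ⟨r, rfl⟩ := hv' r
    obtain ⟨x, rfl⟩ := hv' x
    exact List.mem_map_of_mem (f := v)
      (mem_of_nodup_three p q r (List.Nodup.of_map (l := [p, q, r]) v h) x)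
  · exact fun s => (vertex₃_row_or_column s).imp (fun h => ⟨congrArg v h.1, h.2.map hv⟩)
      fun h => ⟨congrArg v h.1, h.2.map hv⟩
  · intro s t
    simpa only [hv.eq_iff] using vertex₃_separated s t
  · intro p q r u
    obtain ⟨p, rfl⟩ := hv' p
    obtain ⟨q, rfl⟩ := hv' q
    obtain ⟨r, rfl⟩ := hv' r
    obtain ⟨u, rfl⟩ := hv' u
    simp only [hv.ne_iff, hv.eq_iff, hv'.exists]
    exact exists_vertex₃ p q r u

/-- With three indices of different parities, the crossed pairs lie in a common row or column, and
their classes vanish by weights. -/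
theorem iso_two_one (he : 𝒟.IsBarUnit e) (he' : e ∈ 𝒟.deg 0) :
    (𝒟.sl 2 1).gradingHL₂.Iso 𝒟.gradingHHS₁ := by
  obtain ⟨third, S⟩ := steinbergFamily_root_of_three_le (m := 2) (n := 1) he he' (by norm_num)
  let v : Fin 3 ≃ Fin 2 ⊕ Fin 1 := (finSumFinEquiv (m := 2) (n := 1)).symm
  have hv : Function.Injective v := v.injective
  have hv' : Function.Surjective v := v.surjective
  have hidx : ∀ p q r : Fin 3, p ≠ q → p ≠ r → q ≠ r →
      ((idx (v p) : ZMod 2) ≠ idx (v q) ∨ (idx (v p) : ZMod 2) ≠ idx (v r)) := by decide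
  have hk₀ : v 0 ≠ v 1 := hv.ne (by decide)
  clear_value v
  refine iso_of_cls_eq_zero S third hk₀ ?_
  intro p q r u hpq hru hqr hpu a b
  obtain ⟨p, rfl⟩ := hv' p
  obtain ⟨q, rfl⟩ := hv' q
  obtain ⟨r, rfl⟩ := hv' r
  obtain ⟨u, rfl⟩ := hv' u
  have h : ∀ p q r u : Fin 3, p ≠ q → r ≠ u → q ≠ r → p ≠ u →
      (∃ x, p ≠ x ∧ x ≠ q ∧ x ≠ r ∧ x ≠ u) ∨
        (p = r ∧ q ≠ u) ∨ (q = u ∧ p ≠ r) := by decide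
  rcases h p q r u (hv.ne_iff.1 hpq) (hv.ne_iff.1 hru) (hv.ne_iff.1 hqr) (hv.ne_iff.1 hpu) with
    ⟨x, h₁, h₂, h₃, h₄⟩ | ⟨rfl, h₁⟩ | ⟨rfl, h₁⟩
  · exact S.cls_eq_zero hpq hru hqr hpu (hv.ne h₁) (hv.ne h₂) (hv.ne h₃) (hv.ne h₄) a b
  · exact S.cls_row_eq_zero hpq hru (hv.ne h₁)
      (hidx _ _ _ (hv.ne_iff.1 hpq) (hv.ne_iff.1 hru) h₁) a b
  · exact S.cls_column_eq_zero hpq.symm hqr (hv.ne h₁)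
      (hidx _ _ _ (hv.ne_iff.1 hpq.symm) (hv.ne_iff.1 hqr) h₁) a b

/-- With at least five indices, one of them is not involved in a given crossed pair. -/
theorem iso_of_five_le (he : 𝒟.IsBarUnit e) (he' : e ∈ 𝒟.deg 0) (h : 5 ≤ m + n) :
    (𝒟.sl m n).gradingHL₂.Iso 𝒟.gradingHHS₁ := by
  obtain ⟨third, S⟩ := steinbergFamily_root_of_three_le (m := m) (n := n) he he' (by omega)
  have hcard : Fintype.card (Fin m ⊕ Fin n) = m + n := by
    rw [Fintype.card_sum, Fintype.card_fin, Fintype.card_fin]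
  have : Nontrivial (Fin m ⊕ Fin n) := Fintype.one_lt_card_iff_nontrivial.1 (by omega)
  obtain ⟨o, k, hok⟩ := exists_pair_ne (Fin m ⊕ Fin n)
  refine iso_of_cls_eq_zero S third hok ?_
  intro p q r u hpq hru hqr hpu a b
  obtain ⟨x, -, hx⟩ := Finset.exists_mem_notMem_of_card_lt_card (s := {p, q, r, u})
    (t := Finset.univ) (Finset.card_le_four.trans_lt (by rw [Finset.card_univ]; omega))
  simp only [Finset.mem_insert, Finset.mem_singleton, not_or] at hx
  exact S.cls_eq_zero hpq hru hqr hpu (Ne.symm hx.1) hx.2.1 hx.2.2.1 hx.2.2.2 a b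

end Superdialgebra
end SuperLeibniz

theorem mainTheorem9 {R D ι : Type*} [CommRing R] [AddCommGroup D] [Module R D]
    (𝒟 : SuperLeibniz.Superdialgebra R D) (e : D) (he : 𝒟.IsBarUnit e)
    (b : Module.Basis ι R D) (hb : ∃ s, b s = e) :
    (∀ m n : ℕ, (5 ≤ m + n ∨ (m = 2 ∧ n = 1)) →
      (𝒟.sl m n).gradingHL₂.Iso 𝒟.gradingHHS₁) ∧
    (𝒟.sl 3 0).gradingHL₂.Iso (𝒟.gradingHHS₁.prod ((𝒟.gradingQuo 3).copies 6)) ∧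
    (𝒟.sl 4 0).gradingHL₂.Iso (𝒟.gradingHHS₁.prod ((𝒟.gradingQuo 2).copies 6)) ∧
    (𝒟.sl 3 1).gradingHL₂.Iso (𝒟.gradingHHS₁.prod ((𝒟.gradingQuo 2).parityChange.copies 6)) ∧
    (𝒟.sl 2 2).gradingHL₂.Iso (𝒟.gradingHHS₁.prod
      (((𝒟.gradingQuo 2).copies 4).prod ((𝒟.gradingQuo 0).copies 2))) := by
  -- the Steinberg relations need an even bar-unit
  have he₀ := he.proj_zero
  have h₀ := 𝒟.proj_mem 0 e
  refine ⟨?_, SuperLeibniz.Superdialgebra.iso_three_zero he₀ h₀,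
    SuperLeibniz.Superdialgebra.iso_four_zero he₀ h₀,
    SuperLeibniz.Superdialgebra.iso_three_one he₀ h₀,
    SuperLeibniz.Superdialgebra.iso_two_two he₀ h₀⟩
  rintro m n (h | ⟨rfl, rfl⟩)
  · exact SuperLeibniz.Superdialgebra.iso_of_five_le he₀ h₀ h
  · exact SuperLeibniz.Superdialgebra.iso_two_one he₀ h₀
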